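/- Theorem 2.4 (Local equilibrium). Let $d\ge 1$ and $a,b>0$. For $n\ge 1$ let $\mathbb T^d_n=\mathbb Z^d/n\mathbb Z^d$ and $\Omega_n=\{0,1\}^{\mathbb T^d_n}$; write $x\sim y$ if $x,y\in\mathbb T^d_n$ are nearest neighbours, $\eta^{x,y}$ for $\eta\in\Omega_n$ with the values at $x$ and $y$ exchanged, and $\eta^x$ for $\eta$ with the value at $x$ replaced by $1-\eta_x$. For $\lambda>-a$ consider the continuous-time Markov chain on $\Omega_n$ with generator $$L_nf(\eta)=n^2\sum_{\{x,y\}:\,x\sim y}\big(f(\eta^{x,y})-f(\eta)\big)+\sum_{x\in\mathbb T^d_n}c_x(\eta)\big(f(\eta^x)-f(\eta)\big),$$ $$c_x(\eta)=\Big(a+\frac{\lambda}{2d}\sum_{y\sim x}\eta_y\Big)(1-\eta_x)+b\,\eta_x ,$$ the first sum being over unordered pairs. It has a unique invariant probability measure $\mu^n_{ss}$ (the NESS). Let $\rho_*$ be the unique zero in $[0,1]$ of $F(\rho)=(a+\lambda\rho)(1-\rho)-b\rho$, and let $\nu^n_{\rho_*}$ be the Bernoulli product measure on $\Omega_n$ of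 density $\rho_*$. Let $g_1(n)=n$, $g_2(n)=\log n$ and $g_d(n)=1$ for $d\ge3$. For $R\in\mathbb N$ let $B_R=\{x\in\mathbb Z^d:|x_i|\le R,\ i=1,\dots,d\}$, let $\Pi_R:\Omega_n\to\{0,1\}^{B_R}$ be given by $(\Pi_R\eta)_x=\eta_{x\bmod n}$, and let $\mu^n_{ss,R}$ and $\nu^n_{\rho_*,R}$ be the push-forwards of $\mu^n_{ss}$ and $\nu^n_{\rho_*}$ under $\Pi_R$. For probability measures $\mu,\nu$ on a finite set let $d_{TV}(\mu,\nu)=\frac12\sum_\omega|\mu(\omega)-\nu(\omega)|$. There exists $\lambda_c=\lambda_c(a,b,d)>0$ such that for every $\lambda\in[-\lambda_c,\lambda_c]$ with $\lambda>-a$ and every sequence $(R_n)_{n\ge1}$ of natural numbers: if $$\frac{R_n\,g_d(n)^{1/d}}{n^{2/d}}\to0\quad\text{as } n\to\infty ,$$ then $$d_{TV}\big(\mu^n_{ss,R_n},\nu^n_{\rho_*,R_n}\big)\to0\quad\text{as } n\to\infty .$$ -/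

import Mathlib

open MeasureTheory Filter Topology

namespace ReactionDiffusion

/-! ### The reaction-diffusion model on the discrete torus -/

/-- The discrete torus `ℤ^d / n ℤ^d`. -/
abbrev Torus (d n : ℕ) : Type := Fin d → ZMod n

/-- Particle configurations on a set of sites `S`: `η x = true` means that there is a particle
at `x`. -/
abbrev Config (S : Type) : Type := S → Bool

/-- The occupation variable `η_x ∈ {0, 1}` as a real number. -/
def occ {S : Type} (η : Config S) (x : S) : ℝ := if η x then 1 else 0

/-- `η^{x,y}`: the values at `x` and `y` are exchanged. -/
def exchange {S : Type} [DecidableEq S] (η : Config S) (x y : S) : Config S :=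
  fun z => η (Equiv.swap x y z)

/-- `η^x`: the value at `x` is changed. -/
def flipAt {S : Type} [DecidableEq S] (η : Config S) (x : S) : Config S :=
  Function.update η x (!η x)

/-- The nearest neighbours of `x`: the sites other than `x` which differ from `x` by a unit
step `± e_i` (for `n = 1` there are none). -/
def neighbors {d n : ℕ} [NeZero n] (x : Torus d n) : Finset (Torus d n) :=
  {y | y ≠ x ∧ ∃ i : Fin d, y = x + Pi.single i 1 ∨ y = x - Pi.single i 1}

/-- The rate `c_x(η) = (a + (λ / 2d) ∑_{y ∼ x} η_y) (1 - η_x) + b η_x` at which `η_x` flips. -/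
noncomputable def flipRate {d n : ℕ} [NeZero n] (a b lam : ℝ) (x : Torus d n)
    (η : Config (Torus d n)) : ℝ :=
  (a + lam / (2 * d) * ∑ y ∈ neighbors x, occ η y) * (1 - occ η x) + b * occ η x

/-- The generator `L_n`. The sum over unordered pairs of neighbours is written as one half of
the sum over ordered pairs. -/
noncomputable def generator {d n : ℕ} [NeZero n] (a b lam : ℝ) (f : Config (Torus d n) → ℝ)
    (η : Config (Torus d n)) : ℝ :=
  (n : ℝ) ^ 2 * (1 / 2 * ∑ x, ∑ y ∈ neighbors x, (f (exchange η x y) - f η))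
    + ∑ x, flipRate a b lam x η * (f (flipAt η x) - f η)

/-- `μ` is an invariant probability measure of the Markov chain generated by `L_n`. -/
def IsInvariant {d n : ℕ} [NeZero n] (a b lam : ℝ) (μ : Measure (Config (Torus d n))) : Prop :=
  IsProbabilityMeasure μ ∧
    ∀ f : Config (Torus d n) → ℝ, ∫ η, generator a b lam f η ∂μ = 0

/-! ### Existence and uniqueness of the invariant measure -/

theorem occ_nonneg {S : Type} (η : Config S) (x : S) : 0 ≤ occ η x := by
  unfold occ; split_ifs <;> norm_num

theorem occ_le_one {S : Type} (η : Config S) (x : S) : occ η x ≤ 1 := by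
  unfold occ; split_ifs <;> norm_num

theorem card_neighbors_le {d n : ℕ} [NeZero n] (x : Torus d n) :
    (neighbors x).card ≤ 2 * d := by
  have hsub : neighbors x ⊆
      (Finset.univ : Finset (Fin d)).image (fun i => x + Pi.single i 1) ∪
        (Finset.univ : Finset (Fin d)).image (fun i => x - Pi.single i 1) := by
    intro y hy
    simp only [neighbors, Finset.mem_filter, Finset.mem_univ, true_and] at hy
    obtain ⟨-, i, h | h⟩ := hy
    · exact Finset.mem_union_left _ (Finset.mem_image.2 ⟨i, Finset.mem_univ _, h.symm⟩)
    · exact Finset.mem_union_right _ (Finset.mem_image.2 ⟨i, Finset.mem_univ _, h.symm⟩)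
  refine (Finset.card_le_card hsub).trans ((Finset.card_union_le _ _).trans ?_)
  have h1 := Finset.card_image_le (s := (Finset.univ : Finset (Fin d)))
    (f := fun i => x + (Pi.single i 1 : Torus d n))
  have h2 := Finset.card_image_le (s := (Finset.univ : Finset (Fin d)))
    (f := fun i => x - (Pi.single i 1 : Torus d n))
  simp only [Finset.card_univ, Fintype.card_fin] at h1 h2
  omega

theorem flipRate_pos {d n : ℕ} [NeZero n] {a b lam : ℝ} (ha : 0 < a) (hb : 0 < b)
    (hlam : -a < lam) (x : Torus d n) (η : Config (Torus d n)) : 0 < flipRate a b lam x η := by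
  have hs0 : 0 ≤ ∑ y ∈ neighbors x, occ η y := Finset.sum_nonneg fun y _ => occ_nonneg η y
  have hs1 : ∑ y ∈ neighbors x, occ η y ≤ 2 * d := by
    calc ∑ y ∈ neighbors x, occ η y ≤ ∑ y ∈ neighbors x, (1 : ℝ) :=
          Finset.sum_le_sum fun y _ => occ_le_one η y
      _ = ((neighbors x).card : ℝ) := by simp
      _ ≤ ((2 * d : ℕ) : ℝ) := by exact_mod_cast card_neighbors_le x
      _ = 2 * d := by push_cast; ring
  have key : 0 < a + lam / (2 * d) * ∑ y ∈ neighbors x, occ η y := by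
    generalize (∑ y ∈ neighbors x, occ η y) = s at hs0 hs1
    rcases Nat.eq_zero_or_pos d with rfl | hd
    · simpa using ha
    · have hd' : (0 : ℝ) < 2 * d := by positivity
      have ht0 : 0 ≤ s / (2 * d) := by positivity
      have ht1 : s / (2 * d) ≤ 1 := (div_le_one hd').2 hs1
      have : lam / (2 * d) * s = lam * (s / (2 * d)) := by ring
      rw [this]
      rcases le_total 0 lam with h | h
      · have := mul_nonneg h ht0
        linarith
      · nlinarith
  unfold flipRate occ
  unfold occ at key
  split_ifs
  · simpa using hb
  · simpa using key

theorem flipAt_flipAt {S : Type} [DecidableEq S] (η : Config S) (x : S) : flipAt (flipAt η x) x = η := by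
  funext z
  by_cases h : z = x
  · subst h; simp [flipAt]
  · simp [flipAt, h]

theorem flipAt_ne {S : Type} [DecidableEq S] (η : Config S) (x : S) : flipAt η x ≠ η := by
  intro h
  have := congrFun h x
  simp [flipAt] at this

/-- The generator as a linear map. -/
noncomputable def generatorLin {d n : ℕ} [NeZero n] (a b lam : ℝ) :
    (Config (Torus d n) → ℝ) →ₗ[ℝ] (Config (Torus d n) → ℝ) where
  toFun := generator a b lam
  map_add' f g := by
    funext η
    simp only [generator, Pi.add_apply, Finset.mul_sum]
    rw [add_add_add_comm]
    simp only [← Finset.sum_add_distrib]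
    refine Finset.sum_congr rfl fun x _ => ?_
    congr 1
    · exact Finset.sum_congr rfl fun y _ => by ring
    · ring
  map_smul' c f := by
    funext η
    simp only [generator, Pi.smul_apply, smul_eq_mul, RingHom.id_apply, mul_add, Finset.mul_sum]
    congr 1
    · exact Finset.sum_congr rfl fun x _ => Finset.sum_congr rfl fun y _ => by ring
    · exact Finset.sum_congr rfl fun x _ => by ring

/-- Positivity of the off-diagonal rates. -/
theorem generator_nonneg_of_eq_zero {d n : ℕ} [NeZero n] {a b lam : ℝ} (ha : 0 < a) (hb : 0 < b)
    (hlam : -a < lam) (f : Config (Torus d n) → ℝ) (hf : ∀ η, 0 ≤ f η)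
    (η : Config (Torus d n)) (h0 : f η = 0) : 0 ≤ generator a b lam f η := by
  unfold generator
  rw [h0]
  simp only [sub_zero]
  have h1 : 0 ≤ ∑ x, ∑ y ∈ neighbors x, f (exchange η x y) :=
    Finset.sum_nonneg fun x _ => Finset.sum_nonneg fun y _ => hf _
  have h2 : 0 ≤ ∑ x, flipRate a b lam x η * f (flipAt η x) :=
    Finset.sum_nonneg fun x _ => mul_nonneg (flipRate_pos ha hb hlam x η).le (hf _)
  positivity

theorem generator_pos_of_flipAt {d n : ℕ} [NeZero n] {a b lam : ℝ} (ha : 0 < a) (hb : 0 < b)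
    (hlam : -a < lam) (f : Config (Torus d n) → ℝ) (hf : ∀ η, 0 ≤ f η)
    (η : Config (Torus d n)) (h0 : f η = 0) (x : Torus d n) (hx : 0 < f (flipAt η x)) :
    0 < generator a b lam f η := by
  unfold generator
  rw [h0]
  simp only [sub_zero]
  have h1 : 0 ≤ ∑ x, ∑ y ∈ neighbors x, f (exchange η x y) :=
    Finset.sum_nonneg fun x _ => Finset.sum_nonneg fun y _ => hf _
  have h2 : 0 < ∑ x, flipRate a b lam x η * f (flipAt η x) :=
    Finset.sum_pos' (fun x _ => mul_nonneg (flipRate_pos ha hb hlam x η).le (hf _))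
      ⟨x, Finset.mem_univ _, mul_pos (flipRate_pos ha hb hlam x η) hx⟩
  positivity

theorem generator_const {d n : ℕ} [NeZero n] (a b lam c : ℝ) (η : Config (Torus d n)) :
    generator a b lam (fun _ => c) η = 0 := by
  simp [generator]

/-- Irreducibility: a nonnegative invariant weight that vanishes somewhere vanishes everywhere. -/
theorem weight_eq_zero {d n : ℕ} [NeZero n] {a b lam : ℝ} (ha : 0 < a) (hb : 0 < b)
    (hlam : -a < lam) (w : Config (Torus d n) → ℝ) (hw : ∀ η, 0 ≤ w η)
    (hinv : ∀ f, ∑ η, w η * generator a b lam f η = 0) (η₀ : Config (Torus d n))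
    (h₀ : w η₀ = 0) : w = 0 := by
  classical
  have step : ∀ η, w η = 0 → ∀ x, w (flipAt η x) = 0 := by
    intro η hη x
    set f : Config (Torus d n) → ℝ := fun ζ => if ζ = η then 1 else 0 with hf
    have hf0 : ∀ ζ, 0 ≤ f ζ := by
      intro ζ; simp only [hf]; split_ifs <;> norm_num
    have hterm : ∀ ζ, 0 ≤ w ζ * generator a b lam f ζ := by
      intro ζ
      by_cases h : ζ = η
      · rw [h, hη, zero_mul]
      · exact mul_nonneg (hw ζ)
          (generator_nonneg_of_eq_zero ha hb hlam f hf0 ζ (by simp [hf, h]))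
    have hz := (Finset.sum_eq_zero_iff_of_nonneg fun ζ _ => hterm ζ).1 (hinv f)
      (flipAt η x) (Finset.mem_univ _)
    have hpos : 0 < generator a b lam f (flipAt η x) :=
      generator_pos_of_flipAt ha hb hlam f hf0 _ (by simp [hf, flipAt_ne]) x
        (by simp [hf, flipAt_flipAt])
    exact (mul_eq_zero.1 hz).resolve_right hpos.ne'
  funext η
  have hall : ∀ s : Finset (Torus d n), w (fun x => if x ∈ s then η x else η₀ x) = 0 := by
    intro s
    induction s using Finset.induction_on with
    | empty => simpa using h₀
    | insert x s hx ih =>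
      by_cases h : η x = η₀ x
      · convert ih using 2
        funext z
        by_cases hz : z = x
        · subst hz; simp [h]
        · simp [hz]
      · convert step _ ih x using 2
        funext z
        by_cases hz : z = x
        · subst hz
          simp only [flipAt, Finset.mem_insert, true_or, if_true, Function.update_self, hx, if_false]
          cases h1 : η z <;> cases h2 : η₀ z <;> simp_all
        · simp [flipAt, hz]
  simpa using hall Finset.univ

theorem abs_invariant {d n : ℕ} [NeZero n] {a b lam : ℝ} (ha : 0 < a) (hb : 0 < b)
    (hlam : -a < lam) (v : Config (Torus d n) → ℝ)
    (hinv : ∀ f, ∑ η, v η * generator a b lam f η = 0) :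
    ∀ f, ∑ η, |v η| * generator a b lam f η = 0 := by
  classical
  let e : Config (Torus d n) → Config (Torus d n) → ℝ := fun ζ η => if η = ζ then 1 else 0
  have he0 : ∀ ζ η, 0 ≤ e ζ η := by
    intro ζ η; simp only [e]; split_ifs <;> norm_num
  have hdec : ∀ f : Config (Torus d n) → ℝ, f = ∑ ζ, f ζ • e ζ := by
    intro f; funext η; simp [e, Finset.sum_apply]
  have hone : ∑ ζ, e ζ = fun _ => 1 := by
    funext η; simp [e, Finset.sum_apply]
  have hlin : ∀ (u : Config (Torus d n) → ℝ) (f : Config (Torus d n) → ℝ),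
      ∑ η, u η * generator a b lam f η = ∑ ζ, f ζ * ∑ η, u η * generator a b lam (e ζ) η := by
    intro u f
    have : generator a b lam f = ∑ ζ, f ζ • generator a b lam (e ζ) := by
      conv_lhs => rw [hdec f]
      have := map_sum (generatorLin (d := d) (n := n) a b lam) (fun ζ => f ζ • e ζ) Finset.univ
      simp only [map_smul] at this
      exact this
    rw [this]
    simp only [Finset.sum_apply, Pi.smul_apply, smul_eq_mul, Finset.mul_sum]
    rw [Finset.sum_comm]
    exact Finset.sum_congr rfl fun ζ _ => Finset.sum_congr rfl fun η _ => by ring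
  have hge : ∀ ζ, 0 ≤ ∑ η, |v η| * generator a b lam (e ζ) η := by
    intro ζ
    have hsplit : ∀ u : Config (Torus d n) → ℝ, ∑ η, u η * generator a b lam (e ζ) η
        = u ζ * generator a b lam (e ζ) ζ
          + ∑ η ∈ Finset.univ.erase ζ, u η * generator a b lam (e ζ) η := fun u =>
      (Finset.add_sum_erase _ _ (Finset.mem_univ ζ)).symm
    have hoff : ∀ η ∈ Finset.univ.erase ζ, 0 ≤ generator a b lam (e ζ) η := by
      intro η hη
      exact generator_nonneg_of_eq_zero ha hb hlam _ (he0 ζ) η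
        (by simp [e, Finset.ne_of_mem_erase hη])
    have hdiag : generator a b lam (e ζ) ζ ≤ 0 := by
      have h1 : generator a b lam (e ζ) ζ
          + generator a b lam (fun η => 1 - e ζ η) ζ = 0 := by
        have := congrFun ((generatorLin (d := d) (n := n) a b lam).map_add
          (e ζ) (fun η => 1 - e ζ η)) ζ
        have h2 : e ζ + (fun η => 1 - e ζ η) = fun _ => 1 := by funext η; simp
        rw [h2] at this
        rw [← generator_const a b lam 1 ζ]
        exact this.symm
      have h2 : 0 ≤ generator a b lam (fun η => 1 - e ζ η) ζ :=
        generator_nonneg_of_eq_zero ha hb hlam _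
          (fun η => by simp only [e]; split_ifs <;> norm_num) ζ (by simp [e])
      linarith
    have hv := hinv (e ζ)
    rw [hsplit] at hv ⊢
    have h1 : |∑ η ∈ Finset.univ.erase ζ, v η * generator a b lam (e ζ) η|
        ≤ ∑ η ∈ Finset.univ.erase ζ, |v η| * generator a b lam (e ζ) η := by
      refine (Finset.abs_sum_le_sum_abs _ _).trans (Finset.sum_le_sum fun η hη => ?_)
      rw [abs_mul, abs_of_nonneg (hoff η hη)]
    have h2 : |v ζ * generator a b lam (e ζ) ζ| = -(|v ζ| * generator a b lam (e ζ) ζ) := by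
      rw [abs_mul, abs_of_nonpos hdiag]; ring
    have h3 : v ζ * generator a b lam (e ζ) ζ
        = -∑ η ∈ Finset.univ.erase ζ, v η * generator a b lam (e ζ) η := by linarith
    rw [h3, abs_neg] at h2
    linarith
  have hsum : ∑ ζ, ∑ η, |v η| * generator a b lam (e ζ) η = 0 := by
    have := hlin (fun η => |v η|) (fun _ => 1)
    simp only [generator_const, mul_zero, Finset.sum_const_zero, one_mul] at this
    exact this.symm
  have hz := (Finset.sum_eq_zero_iff_of_nonneg fun ζ _ => hge ζ).1 hsum
  intro f
  rw [hlin (fun η => |v η|) f]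
  exact Finset.sum_eq_zero fun ζ hζ => by rw [hz ζ hζ, mul_zero]

theorem exists_invariant_weight {d n : ℕ} [NeZero n] {a b lam : ℝ} (ha : 0 < a) (hb : 0 < b)
    (hlam : -a < lam) :
    ∃ w : Config (Torus d n) → ℝ, (∀ η, 0 ≤ w η) ∧ ∑ η, w η = 1 ∧
      ∀ f, ∑ η, w η * generator a b lam f η = 0 := by
  classical
  have hninj : ¬ Function.Injective (generatorLin (d := d) (n := n) a b lam) := by
    intro h
    have h1 : generatorLin (d := d) (n := n) a b lam (fun _ => 1) = generatorLin a b lam 0 := by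
      rw [map_zero]; funext η; exact generator_const a b lam 1 η
    have := congrFun (h h1) (fun _ => false)
    simp at this
  have hnsurj : LinearMap.range (generatorLin (d := d) (n := n) a b lam) ≠ ⊤ := by
    intro h
    exact hninj (LinearMap.injective_iff_surjective.2 (LinearMap.range_eq_top.1 h))
  obtain ⟨φ, hφ, hle⟩ := Submodule.exists_le_ker_of_lt_top _ (lt_top_iff_ne_top.2 hnsurj)
  let v : Config (Torus d n) → ℝ := fun η => φ (Pi.single η 1)
  have hφv : ∀ g : Config (Torus d n) → ℝ, φ g = ∑ η, v η * g η := by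
    intro g
    conv_lhs => rw [← Finset.univ_sum_single g]
    rw [map_sum]
    refine Finset.sum_congr rfl fun η _ => ?_
    have : (Pi.single η (g η) : Config (Torus d n) → ℝ) = g η • Pi.single η 1 := by
      rw [← Pi.single_smul]; simp
    rw [this, map_smul, smul_eq_mul, mul_comm]
  have hv : ∀ f, ∑ η, v η * generator a b lam f η = 0 := by
    intro f
    rw [← hφv]
    exact hle ⟨f, rfl⟩
  have hv0 : ∃ η, v η ≠ 0 := by
    by_contra hcon
    push Not at hcon
    apply hφ
    refine LinearMap.ext fun g => ?_
    rw [hφv]; simp [hcon]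
  have habs := abs_invariant ha hb hlam v hv
  set Z := ∑ η, |v η| with hZ
  have hZpos : 0 < Z := by
    obtain ⟨η, hη⟩ := hv0
    exact Finset.sum_pos' (fun _ _ => abs_nonneg _) ⟨η, Finset.mem_univ _, abs_pos.2 hη⟩
  refine ⟨fun η => |v η| / Z, fun η => by positivity, ?_, fun f => ?_⟩
  · rw [← Finset.sum_div, ← hZ, div_self hZpos.ne']
  · have : ∀ η, |v η| / Z * generator a b lam f η = (|v η| * generator a b lam f η) / Z :=
      fun η => by ring
    simp only [this]
    rw [← Finset.sum_div, habs f, zero_div]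

theorem invariant_weight_unique {d n : ℕ} [NeZero n] {a b lam : ℝ} (ha : 0 < a) (hb : 0 < b)
    (hlam : -a < lam) (v : Config (Torus d n) → ℝ) (hsum : ∑ η, v η = 0)
    (hinv : ∀ f, ∑ η, v η * generator a b lam f η = 0) : v = 0 := by
  classical
  have habs := abs_invariant ha hb hlam v hinv
  have hp : ∀ f, ∑ η, (|v η| + v η) * generator a b lam f η = 0 := fun f => by
    simp only [add_mul, Finset.sum_add_distrib, habs f, hinv f, add_zero]
  -- the total mass is zero, so the weight cannot be positive everywhere
  have hex : ∃ η, v η ≤ 0 := by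
    by_contra hcon
    push Not at hcon
    exact (Finset.sum_pos (fun η _ => hcon η) Finset.univ_nonempty).ne' hsum
  obtain ⟨η₀, h₀⟩ := hex
  have hzero := weight_eq_zero ha hb hlam (fun η => |v η| + v η)
    (fun η => by linarith [neg_abs_le (v η)]) hp η₀ (by simp [abs_of_nonpos h₀])
  have hle : ∀ η, v η ≤ 0 := fun η => by
    have h1 : |v η| + v η = 0 := congrFun hzero η
    linarith [abs_nonneg (v η)]
  funext η
  exact (Finset.sum_eq_zero_iff_of_nonpos fun η _ => hle η).1 hsum η (Finset.mem_univ _)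

/-- The chain has exactly one invariant probability measure. -/
theorem existsUnique_isInvariant {a b lam : ℝ} (ha : 0 < a) (hb : 0 < b) (hlam : -a < lam)
    (d n : ℕ) [NeZero n] :
    ∃! μ : Measure (Config (Torus d n)), IsInvariant a b lam μ := by
  classical
  obtain ⟨w, hw0, hw1, hinv⟩ := exists_invariant_weight (d := d) (n := n) ha hb hlam
  let p : PMF (Config (Torus d n)) := PMF.ofFintype (fun η => ENNReal.ofReal (w η)) (by
    rw [← ENNReal.ofReal_sum_of_nonneg fun η _ => hw0 η, hw1, ENNReal.ofReal_one])
  refine ⟨p.toMeasure, ⟨inferInstance, fun f => ?_⟩, ?_⟩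
  · rw [PMF.integral_eq_sum]
    simpa [p, PMF.ofFintype_apply, ENNReal.toReal_ofReal (hw0 _)] using hinv f
  · rintro ν ⟨hν, hνinv⟩
    have hsum : ∑ η, ν.real {η} = 1 := by simp
    have hzero := invariant_weight_unique ha hb hlam (fun η => ν.real {η} - w η)
      (by rw [Finset.sum_sub_distrib, hsum, hw1, sub_self])
      (fun f => by
        have h := hνinv f
        rw [integral_fintype Integrable.of_finite] at h
        simp only [smul_eq_mul] at h
        simp only [sub_mul, Finset.sum_sub_distrib, h, hinv f, sub_self])
    refine Measure.ext_of_singleton fun η => ?_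
    have h1 : ν.real {η} = w η := sub_eq_zero.1 (congrFun hzero η)
    rw [PMF.toMeasure_apply_singleton _ _ (measurableSet_singleton η)]
    simp only [p, PMF.ofFintype_apply]
    rw [← h1, ofReal_measureReal]

/-- The non-equilibrium stationary state: the unique invariant probability measure of the
chain. -/
noncomputable def ness {a b lam : ℝ} (ha : 0 < a) (hb : 0 < b) (hlam : -a < lam)
    (d n : ℕ) [NeZero n] : Measure (Config (Torus d n)) :=
  (existsUnique_isInvariant ha hb hlam d n).choose

theorem ness_isInvariant {a b lam : ℝ} (ha : 0 < a) (hb : 0 < b) (hlam : -a < lam)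
    (d n : ℕ) [NeZero n] : IsInvariant a b lam (ness ha hb hlam d n) :=
  (existsUnique_isInvariant ha hb hlam d n).choose_spec.1

/-! ### The Bernoulli reference measure -/

/-- The Bernoulli product measure of density `ρ`. -/
noncomputable def bernoulliProduct (d n : ℕ) [NeZero n] (ρ : unitInterval) :
    Measure (Config (Torus d n)) :=
  Measure.pi fun _ => ProbabilityTheory.bernoulliMeasure true false ρ

/-- The effective reaction function `F(ρ) = (a + λ ρ) (1 - ρ) - b ρ`. -/
def reaction (a b lam ρ : ℝ) : ℝ := (a + lam * ρ) * (1 - ρ) - b * ρ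

/-- `F` has exactly one zero in `[0, 1]`. -/
theorem existsUnique_reaction_eq_zero {a b : ℝ} (ha : 0 < a) (hb : 0 < b) (lam : ℝ) :
    ∃! ρ : unitInterval, reaction a b lam ρ = 0 := by
  have hcont : ContinuousOn (reaction a b lam) (Set.Icc 0 1) := by
    unfold reaction; fun_prop
  obtain ⟨r, hr, hr0⟩ := intermediate_value_Icc' zero_le_one hcont
    (show (0 : ℝ) ∈ Set.Icc (reaction a b lam 1) (reaction a b lam 0) by
      constructor <;> simp [reaction] <;> linarith)
  refine ⟨⟨r, hr⟩, hr0, ?_⟩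
  rintro ⟨s, hs⟩ hs0
  apply Subtype.ext
  change reaction a b lam s = 0 at hs0
  change s = r
  have hid : (s - r) * (a * (1 - r) * (1 - s) + b * r * s) = 0 := by
    have : (s - r) * (a * (1 - r) * (1 - s) + b * r * s)
        = reaction a b lam r * (s * (1 - s)) - reaction a b lam s * (r * (1 - r)) := by
      unfold reaction; ring
    rw [this, hr0, hs0]; ring
  have hr1 : 0 < r := by
    rcases hr.1.eq_or_lt with h | h
    · rw [← h] at hr0; simp [reaction] at hr0; linarith
    · exact h
  have hs1 : 0 < s := by
    rcases hs.1.eq_or_lt with h | h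
    · rw [← h] at hs0; simp [reaction] at hs0; linarith
    · exact h
  have hpos : 0 < a * (1 - r) * (1 - s) + b * r * s := by
    have h1 : 0 ≤ a * (1 - r) * (1 - s) :=
      mul_nonneg (mul_nonneg ha.le (by linarith [hr.2])) (by linarith [hs.2])
    have h2 : 0 < b * r * s := by positivity
    linarith
  exact sub_eq_zero.1 ((mul_eq_zero.1 hid).resolve_right hpos.ne')

/-- The density `ρ_*`: the unique zero of `F` in `[0, 1]`. -/
noncomputable def rhoStar {a b : ℝ} (ha : 0 < a) (hb : 0 < b) (lam : ℝ) : unitInterval :=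
  (existsUnique_reaction_eq_zero ha hb lam).choose

theorem reaction_rhoStar {a b : ℝ} (ha : 0 < a) (hb : 0 < b) (lam : ℝ) :
    reaction a b lam (rhoStar ha hb lam) = 0 :=
  (existsUnique_reaction_eq_zero ha hb lam).choose_spec.1

/-! ### Projections onto boxes, total variation, and the scale -/

/-- The box `B_R = {x ∈ ℤ^d : |x_i| ≤ R for every i}`. -/
abbrev Box (d R : ℕ) : Type :=
  {x : Fin d → ℤ // x ∈ Fintype.piFinset fun _ => Finset.Icc (-(R : ℤ)) (R : ℤ)}

/-- The projection `Π_R`: the configuration seen in the box `B_R` through the covering map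
`ℤ^d → ℤ^d / n ℤ^d`. -/
def boxProj (d n R : ℕ) (η : Config (Torus d n)) : Config (Box d R) :=
  fun x => η fun i => (x.1 i : ZMod n)

/-- The total variation distance between two probability measures on a finite set. -/
noncomputable def tvDist {Ω : Type} [Fintype Ω] [MeasurableSpace Ω] (μ ν : Measure Ω) : ℝ :=
  1 / 2 * ∑ ω, |μ.real {ω} - ν.real {ω}|

/-- `g_d(n)` is `n` for `d = 1`, `log n` for `d = 2` and `1` for `d ≥ 3`. -/
noncomputable def green (d n : ℕ) : ℝ :=
  if d = 1 then n else if d = 2 then Real.log n else 1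

end ReactionDiffusion

open ReactionDiffusion

namespace ReactionDiffusion

/-! ### Bernoulli weights on a finite set of sites -/

/-! The stationary state is compared with the Bernoulli measure ν of density ρ = ρ_* through the
relative entropy H of its density f. Write ω_x for the centred occupation variables. Testing
stationarity against log f (`entropy_production`) bounds the Dirichlet forms of the exclusion part,
which carries a factor n², and of the flips by λ/(2dρ) E[V f], where V = `nbrCorr` sums ω_x ω_y over
neighbouring pairs. The choice of ρ as the zero of F matters here: the adjoint of the flip dynamics
applied to 1 is then purely quadratic (`bexp_flipRate`).

The core is the estimate of E[V f] (`abs_bexp_nbrCorr_le`). Let G = (1 − n²Δ)⁻¹, and let K be G with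
its diagonal lowered so that K_xx = K_xy for neighbours. The exclusion generator applied to the
quadratic form Q = ω·Kω produces a multiple of V, up to W = ω·Gω and a multiple of Σ ω_x²
(`nbrCorr_eq`). Hence E[V f] costs a part of the exclusion Dirichlet form plus squared gradients of
Kω, and the energy identity for G bounds the latter by W. Since 0 ≤ G ≤ 1, the exponential moment of
W under ν is at most exp(tr G / 2) (`bexp_exp_quadratic_le`), and the entropy inequality gives E[W
f] ≤ H + tr G / 2. The logarithmic Sobolev inequality bounds H by the flip form, so for small |λ|
everything is absorbed and H ≤ C n^d (G_00 + n⁻²) (`nessEntropy_le`). A lattice sum over frequencies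
gives G_00 ≤ C g_d(n)/n².

To localise, pack N = ⌊n/(2R+1)⌋^d disjoint translates of the box into the torus. They are
independent under ν and, by translation invariance, identically distributed under the stationary
state. The entropy inequality for the sum of the translates of one event, with Hoeffding's lemma,
gives 2N(p − q)² ≤ H for its two probabilities p and q. The event that realises the total variation
distance then yields d_TV² ≤ C (R^d + 1) g_d(n)/n², in which R^d g_d(n)/n² is the d-th power of the
quantity assumed to vanish and g_d(n)/n² ≤ 1/n. -/

/-- The weight of a configuration under the Bernoulli product measure of density `ρ`. -/
noncomputable def bweight {S : Type} [Fintype S] (ρ : ℝ) (η : Config S) : ℝ :=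
  ∏ x, if η x then ρ else 1 - ρ

/-- Expectation under the Bernoulli product measure of density `ρ`. -/
noncomputable def bexp {S : Type} [Fintype S] [DecidableEq S] (ρ : ℝ) (f : Config S → ℝ) : ℝ :=
  ∑ η, bweight ρ η * f η

/-- Conditional expectation given the configuration outside `x`. -/
noncomputable def siteAvg {S : Type} [DecidableEq S] (ρ : ℝ) (x : S) (f : Config S → ℝ)
    (η : Config S) : ℝ :=
  ρ * f (Function.update η x true) + (1 - ρ) * f (Function.update η x false)

/-- The Dirichlet form of the flip at `x`. -/
noncomputable def flipForm {S : Type} [Fintype S] [DecidableEq S] (ρ : ℝ) (f : Config S → ℝ)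
    (x : S) : ℝ :=
  bexp ρ fun η => (√(f (flipAt η x)) - √(f η)) ^ 2

section Bernoulli

set_option linter.unusedSectionVars false

variable {S : Type} [Fintype S] [DecidableEq S] {ρ : ℝ}

theorem bweight_pos (h0 : 0 < ρ) (h1 : ρ < 1) (η : Config S) : 0 < bweight ρ η :=
  Finset.prod_pos fun x _ => by split_ifs <;> linarith

theorem bexp_prod (ρ : ℝ) (φ : S → Bool → ℝ) :
    bexp ρ (fun η => ∏ x, φ x (η x)) = ∏ x, (ρ * φ x true + (1 - ρ) * φ x false) := by
  have h : ∀ x, ρ * φ x true + (1 - ρ) * φ x false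
      = ∑ c : Bool, (if c then ρ else 1 - ρ) * φ x c := by
    intro x; simp
  simp only [h, Finset.prod_univ_sum, Fintype.piFinset_univ]
  unfold bexp bweight
  exact Finset.sum_congr rfl fun η _ => by rw [← Finset.prod_mul_distrib]

theorem bexp_const (ρ c : ℝ) : bexp (S := S) ρ (fun _ => c) = c := by
  have h := bexp_prod (S := S) ρ (fun _ _ => 1)
  simp only [Finset.prod_const_one, mul_one, add_sub_cancel] at h
  unfold bexp at h ⊢
  simp only [mul_one] at h
  rw [← Finset.sum_mul, h, one_mul]

theorem bexp_mono (h0 : 0 < ρ) (h1 : ρ < 1) {f g : Config S → ℝ} (h : ∀ η, f η ≤ g η) :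
    bexp ρ f ≤ bexp ρ g :=
  Finset.sum_le_sum fun η _ => mul_le_mul_of_nonneg_left (h η) (bweight_pos h0 h1 η).le

theorem bexp_nonneg (h0 : 0 < ρ) (h1 : ρ < 1) {f : Config S → ℝ} (h : ∀ η, 0 ≤ f η) :
    0 ≤ bexp ρ f :=
  Finset.sum_nonneg fun η _ => mul_nonneg (bweight_pos h0 h1 η).le (h η)

theorem bexp_add (ρ : ℝ) (f g : Config S → ℝ) :
    bexp ρ (fun η => f η + g η) = bexp ρ f + bexp ρ g := by
  simp only [bexp, mul_add, Finset.sum_add_distrib]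

theorem bexp_sub (ρ : ℝ) (f g : Config S → ℝ) :
    bexp ρ (fun η => f η - g η) = bexp ρ f - bexp ρ g := by
  simp only [bexp, mul_sub, Finset.sum_sub_distrib]

theorem bexp_const_mul (ρ c : ℝ) (f : Config S → ℝ) :
    bexp ρ (fun η => c * f η) = c * bexp ρ f := by
  simp only [bexp, Finset.mul_sum]
  exact Finset.sum_congr rfl fun η _ => by ring

theorem bexp_sum {ι : Type*} (ρ : ℝ) (s : Finset ι) (f : ι → Config S → ℝ) :
    bexp ρ (fun η => ∑ i ∈ s, f i η) = ∑ i ∈ s, bexp ρ (f i) := by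
  simp only [bexp, Finset.mul_sum]
  exact Finset.sum_comm

/-- The flip at `x` as a permutation of the configurations. -/
def flipEquiv (x : S) : Config S ≃ Config S :=
  (show Function.Involutive fun η : Config S => flipAt η x from fun η => flipAt_flipAt η x).toPerm

theorem sum_flipAt (x : S) (F : Config S → ℝ) : ∑ η, F (flipAt η x) = ∑ η, F η :=
  Equiv.sum_comp (flipEquiv x) F

theorem bweight_eq_mul (ρ : ℝ) (η : Config S) (x : S) :
    bweight ρ η = (if η x then ρ else 1 - ρ) *
      ∏ y ∈ Finset.univ.erase x, if η y then ρ else 1 - ρ :=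
  (Finset.mul_prod_erase _ _ (Finset.mem_univ x)).symm

theorem bweight_flipAt (ρ : ℝ) (η : Config S) (x : S) :
    bweight ρ (flipAt η x) = (if η x then 1 - ρ else ρ) *
      ∏ y ∈ Finset.univ.erase x, if η y then ρ else 1 - ρ := by
  rw [bweight_eq_mul ρ _ x]
  congr 1
  · cases h : η x <;> simp [flipAt, h]
  · refine Finset.prod_congr rfl fun y hy => ?_
    simp [flipAt, Finset.ne_of_mem_erase hy]

theorem update_self_eq {η : Config S} {x : S} {c : Bool} (h : η x = c) :
    Function.update η x c = η := by
  subst h; simp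

theorem update_flipAt (η : Config S) (x : S) (c : Bool) :
    Function.update (flipAt η x) x c = Function.update η x c := by
  simp [flipAt]

theorem flipAt_eq_update {η : Config S} {x : S} {c : Bool} (h : η x = c) :
    flipAt η x = Function.update η x (!c) := by
  simp [flipAt, h]

theorem siteAvg_flipAt (ρ : ℝ) (x : S) (f : Config S → ℝ) (η : Config S) :
    siteAvg ρ x f (flipAt η x) = siteAvg ρ x f η := by
  simp only [siteAvg, update_flipAt]

/-- The flip at `x` pairs the configurations. Within a pair the weights are ρ and 1 − ρ times a
common factor, so averaging inside each pair leaves the total unchanged. -/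
theorem bexp_siteAvg (ρ : ℝ) (x : S) (f : Config S → ℝ) :
    bexp ρ (siteAvg ρ x f) = bexp ρ f := by
  have key : ∀ g : Config S → ℝ, 2 * bexp ρ g
      = ∑ η, (bweight ρ η * g η + bweight ρ (flipAt η x) * g (flipAt η x)) := by
    intro g
    rw [Finset.sum_add_distrib, sum_flipAt x fun η => bweight ρ η * g η]
    unfold bexp; ring
  have : 2 * bexp ρ (siteAvg ρ x f) = 2 * bexp ρ f := by
    rw [key, key]
    refine Finset.sum_congr rfl fun η _ => ?_
    rw [siteAvg_flipAt, bweight_flipAt, bweight_eq_mul ρ η x]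
    unfold siteAvg
    cases h : η x
    · rw [update_self_eq h, flipAt_eq_update h]; simp; ring
    · rw [update_self_eq h, flipAt_eq_update h]; simp; ring
  linarith

theorem siteAvg_pos (h0 : 0 < ρ) (h1 : ρ < 1) {f : Config S → ℝ} (hf : ∀ η, 0 < f η) (x : S)
    (η : Config S) : 0 < siteAvg ρ x f η :=
  add_pos (mul_pos h0 (hf _)) (mul_pos (by linarith) (hf _))

/-! ### Logarithmic Sobolev inequality -/

/-- With m the mean, log w ≤ log m + w/m − 1 bounds the entropy by the variance over m. This is at
most (√u − √v)² because the difference, multiplied by m, is a perfect square. The constant 1 does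
not depend on ρ. -/
theorem two_point_logSobolev (h0 : 0 < ρ) (h1 : ρ < 1) {u v : ℝ} (hu : 0 < u) (hv : 0 < v) :
    ρ * (u * Real.log u) + (1 - ρ) * (v * Real.log v)
      ≤ (ρ * u + (1 - ρ) * v) * Real.log (ρ * u + (1 - ρ) * v) + (√u - √v) ^ 2 := by
  have hq : 0 < 1 - ρ := by linarith
  set m := ρ * u + (1 - ρ) * v with hm
  have hmp : 0 < m := by positivity
  have hlog : ∀ w, 0 < w → w * Real.log w ≤ w * Real.log m + w * (w / m - 1) := by
    intro w hw
    have := Real.log_le_sub_one_of_pos (div_pos hw hmp)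
    rw [Real.log_div hw.ne' hmp.ne'] at this
    nlinarith
  have h2 : ρ * (u * (u / m - 1)) + (1 - ρ) * (v * (v / m - 1))
      = ρ * (1 - ρ) * (u - v) ^ 2 / m := by
    field_simp
    rw [hm]; ring
  have h3 : ρ * (1 - ρ) * (u - v) ^ 2 / m ≤ (√u - √v) ^ 2 := by
    rw [div_le_iff₀ hmp]
    obtain ⟨A, hA, rfl⟩ : ∃ A : ℝ, 0 ≤ A ∧ u = A ^ 2 :=
      ⟨√u, Real.sqrt_nonneg u, (Real.sq_sqrt hu.le).symm⟩
    obtain ⟨B, hB, rfl⟩ : ∃ B : ℝ, 0 ≤ B ∧ v = B ^ 2 :=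
      ⟨√v, Real.sqrt_nonneg v, (Real.sq_sqrt hv.le).symm⟩
    rw [Real.sqrt_sq hA, Real.sqrt_sq hB, hm]
    have : (A - B) ^ 2 * (ρ * A ^ 2 + (1 - ρ) * B ^ 2) - ρ * (1 - ρ) * (A ^ 2 - B ^ 2) ^ 2
        = ((A - B) * (ρ * A - (1 - ρ) * B)) ^ 2 := by ring
    nlinarith [sq_nonneg ((A - B) * (ρ * A - (1 - ρ) * B))]
  have h4 := mul_le_mul_of_nonneg_left (hlog u hu) h0.le
  have h5 := mul_le_mul_of_nonneg_left (hlog v hv) hq.le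
  have h6 : m * Real.log m = ρ * (u * Real.log m) + (1 - ρ) * (v * Real.log m) := by
    rw [hm]; ring
  linarith

/-- Joint convexity of (u, u') ↦ (√u − √u')²: after expanding the squares only the cross terms
differ, and they compare by Cauchy–Schwarz. -/
theorem sq_sqrt_avg_sub_le (h0 : 0 < ρ) (h1 : ρ < 1) {u v u' v' : ℝ} (hu : 0 ≤ u) (hv : 0 ≤ v)
    (hu' : 0 ≤ u') (hv' : 0 ≤ v') :
    (√(ρ * u + (1 - ρ) * v) - √(ρ * u' + (1 - ρ) * v')) ^ 2
      ≤ ρ * (√u - √u') ^ 2 + (1 - ρ) * (√v - √v') ^ 2 := by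
  have hq : 0 < 1 - ρ := by linarith
  have hm : 0 ≤ ρ * u + (1 - ρ) * v := by positivity
  have hm' : 0 ≤ ρ * u' + (1 - ρ) * v' := by positivity
  have key : ρ * (√u * √u') + (1 - ρ) * (√v * √v')
      ≤ √(ρ * u + (1 - ρ) * v) * √(ρ * u' + (1 - ρ) * v') := by
    rw [← Real.sqrt_mul hm]
    apply Real.le_sqrt_of_sq_le
    have e1 := Real.sq_sqrt hu
    have e2 := Real.sq_sqrt hv
    have e3 := Real.sq_sqrt hu'
    have e4 := Real.sq_sqrt hv'
    generalize √u = A at *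
    generalize √v = B at *
    generalize √u' = A' at *
    generalize √v' = B' at *
    subst e1 e2 e3 e4
    have : (ρ * A ^ 2 + (1 - ρ) * B ^ 2) * (ρ * A' ^ 2 + (1 - ρ) * B' ^ 2)
        - (ρ * (A * A') + (1 - ρ) * (B * B')) ^ 2 = ρ * (1 - ρ) * (A * B' - A' * B) ^ 2 := by
      ring
    have h2 : 0 ≤ ρ * (1 - ρ) * (A * B' - A' * B) ^ 2 := by positivity
    linarith
  have e1 := Real.sq_sqrt hu
  have e2 := Real.sq_sqrt hv
  have e3 := Real.sq_sqrt hu'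
  have e4 := Real.sq_sqrt hv'
  have e5 := Real.sq_sqrt hm
  have e6 := Real.sq_sqrt hm'
  simp only [sub_sq, e1, e2, e3, e4, e5, e6]
  nlinarith

theorem flipForm_nonneg (h0 : 0 < ρ) (h1 : ρ < 1) (f : Config S → ℝ) (x : S) :
    0 ≤ flipForm ρ f x :=
  bexp_nonneg h0 h1 fun _ => sq_nonneg _

theorem update_flipAt_comm {x y : S} (h : y ≠ x) (η : Config S) (c : Bool) :
    Function.update (flipAt η y) x c = flipAt (Function.update η x c) y := by
  unfold flipAt
  rw [Function.update_comm h, Function.update_of_ne h]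

theorem flipForm_siteAvg_self (ρ : ℝ) (f : Config S → ℝ) (x : S) :
    flipForm ρ (siteAvg ρ x f) x = 0 := by
  simp [flipForm, siteAvg_flipAt, bexp]

/-- Averaging at `x` commutes with the flip at another site, so joint convexity applies; at `x`
itself the averaged function has no flip form left. -/
theorem flipForm_siteAvg_le (h0 : 0 < ρ) (h1 : ρ < 1) {f : Config S → ℝ} (hf : ∀ η, 0 < f η)
    (x y : S) : flipForm ρ (siteAvg ρ x f) y ≤ flipForm ρ f y := by
  by_cases h : y = x
  · subst h
    rw [flipForm_siteAvg_self]
    exact flipForm_nonneg h0 h1 f y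
  · unfold flipForm
    rw [← bexp_siteAvg ρ x fun η => (√(f (flipAt η y)) - √(f η)) ^ 2]
    refine bexp_mono h0 h1 fun η => ?_
    unfold siteAvg
    rw [update_flipAt_comm h, update_flipAt_comm h]
    exact sq_sqrt_avg_sub_le h0 h1 (hf _).le (hf _).le (hf _).le (hf _).le

/-- One step of the tensorization: the two-point inequality conditionally on all sites other than
`x`. -/
theorem bexp_mul_log_le_siteAvg (h0 : 0 < ρ) (h1 : ρ < 1) {f : Config S → ℝ}
    (hf : ∀ η, 0 < f η) (x : S) :
    bexp ρ (fun η => f η * Real.log (f η))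
      ≤ bexp ρ (fun η => siteAvg ρ x f η * Real.log (siteAvg ρ x f η)) + flipForm ρ f x := by
  rw [← bexp_siteAvg ρ x fun η => f η * Real.log (f η)]
  unfold flipForm
  rw [← bexp_add]
  refine bexp_mono h0 h1 fun η => ?_
  have h := two_point_logSobolev h0 h1 (hf (Function.update η x true))
    (hf (Function.update η x false))
  refine h.trans (le_of_eq ?_)
  unfold siteAvg
  congr 1
  cases hη : η x
  · rw [flipAt_eq_update hη]
    nth_rw 4 [← update_self_eq hη]
    rfl
  · rw [flipAt_eq_update hη]
    nth_rw 4 [← update_self_eq hη]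
    simp only [Bool.not_true]
    ring

/-- Average over the sites of `s` one after the other. Flip forms never increase along the way, so
each step costs at most the flip form of the original `f`, and sites already averaged keep a
vanishing form. -/
theorem logSobolev_finset (h0 : 0 < ρ) (h1 : ρ < 1) {f : Config S → ℝ} (hf : ∀ η, 0 < f η)
    (s : Finset S) :
    ∃ g : Config S → ℝ, (∀ η, 0 < g η) ∧ bexp ρ g = bexp ρ f ∧
      (∀ y, flipForm ρ g y ≤ flipForm ρ f y) ∧ (∀ x ∈ s, flipForm ρ g x = 0) ∧
      bexp ρ (fun η => f η * Real.log (f η))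
        ≤ bexp ρ (fun η => g η * Real.log (g η)) + ∑ x ∈ s, flipForm ρ f x := by
  induction s using Finset.induction_on with
  | empty => exact ⟨f, hf, rfl, fun _ => le_rfl, by simp, by simp⟩
  | insert x s hx ih =>
    obtain ⟨g, hg, hgf, hle, hz, hent⟩ := ih
    refine ⟨siteAvg ρ x g, siteAvg_pos h0 h1 hg x, by rw [bexp_siteAvg, hgf],
      fun y => (flipForm_siteAvg_le h0 h1 hg x y).trans (hle y), fun y hy => ?_, ?_⟩
    · rcases Finset.mem_insert.1 hy with rfl | hy
      · exact flipForm_siteAvg_self ρ g y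
      · exact le_antisymm ((flipForm_siteAvg_le h0 h1 hg x y).trans (hz y hy).le)
          (flipForm_nonneg h0 h1 _ _)
    · rw [Finset.sum_insert hx]
      have := bexp_mul_log_le_siteAvg h0 h1 hg x
      linarith [hle x]

/-- All weights are positive, so a vanishing flip form means invariance under that flip; flips at
successive sites join any two configurations. -/
theorem eq_const_of_flipForm_eq_zero (h0 : 0 < ρ) (h1 : ρ < 1) {g : Config S → ℝ}
    (hg : ∀ η, 0 < g η) (h : ∀ x, flipForm ρ g x = 0) (η ζ : Config S) : g η = g ζ := by
  have step : ∀ η x, g (flipAt η x) = g η := by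
    intro η x
    have hx := h x
    unfold flipForm bexp at hx
    rw [Finset.sum_eq_zero_iff_of_nonneg
      fun η _ => mul_nonneg (bweight_pos h0 h1 η).le (sq_nonneg _)] at hx
    have h2 := (mul_eq_zero.1 (hx η (Finset.mem_univ _))).resolve_left (bweight_pos h0 h1 η).ne'
    have h3 : √(g (flipAt η x)) = √(g η) := sub_eq_zero.1 (pow_eq_zero_iff two_ne_zero |>.1 h2)
    exact (Real.sqrt_inj (hg _).le (hg _).le).1 h3
  have hall : ∀ s : Finset S, g (fun x => if x ∈ s then η x else ζ x) = g ζ := by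
    intro s
    induction s using Finset.induction_on with
    | empty => simp
    | insert x s hx ih =>
      by_cases h : η x = ζ x
      · rw [← ih]
        congr 1
        funext z
        by_cases hz : z = x
        · subst hz; simp [h]
        · simp [hz]
      · rw [← ih, ← step _ x]
        congr 1
        funext z
        by_cases hz : z = x
        · subst hz
          simp only [flipAt, Finset.mem_insert, true_or, if_true, Function.update_self, hx,
            if_false]
          cases h1 : η z <;> cases h2 : ζ z <;> simp_all
        · simp [flipAt, hz]
  simpa using hall Finset.univ

/-- Logarithmic Sobolev inequality for the Bernoulli product measure. -/
theorem logSobolev (h0 : 0 < ρ) (h1 : ρ < 1) {f : Config S → ℝ} (hf : ∀ η, 0 < f η)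
    (hf1 : bexp ρ f = 1) :
    bexp ρ (fun η => f η * Real.log (f η)) ≤ ∑ x, flipForm ρ f x := by
  obtain ⟨g, hg, hgf, -, hz, hent⟩ := logSobolev_finset h0 h1 hf Finset.univ
  have hc := eq_const_of_flipForm_eq_zero h0 h1 hg fun x => hz x (Finset.mem_univ x)
  have hg1 : ∀ η, g η = 1 := by
    intro η
    have : g = fun _ => g η := funext fun ζ => hc ζ η
    rw [hf1, this, bexp_const] at hgf
    exact hgf
  simpa [hg1, bexp] using hent

/-! ### Entropy inequality and exponential moments -/

/-- The Donsker-Varadhan entropy inequality. -/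
theorem entropy_inequality (h0 : 0 < ρ) (h1 : ρ < 1) {f : Config S → ℝ} (hf : ∀ η, 0 < f η)
    (hf1 : bexp ρ f = 1) (X : Config S → ℝ) :
    bexp ρ (fun η => X η * f η)
      ≤ bexp ρ (fun η => f η * Real.log (f η)) + Real.log (bexp ρ fun η => Real.exp (X η)) := by
  set Z := bexp ρ fun η => Real.exp (X η) with hZ
  have hZp : 0 < Z :=
    Finset.sum_pos (fun η _ => mul_pos (bweight_pos h0 h1 η) (Real.exp_pos _))
      Finset.univ_nonempty
  -- This is log t ≤ t − 1 at t = exp(X)/(Z f), multiplied by f; the last bracket has expectation 1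
  -- − 1 = 0.
  have hpt : ∀ η, X η * f η
      ≤ f η * Real.log (f η) + Real.log Z * f η + (Z⁻¹ * Real.exp (X η) - f η) := by
    intro η
    have := Real.log_le_sub_one_of_pos (div_pos (div_pos (Real.exp_pos (X η)) hZp) (hf η))
    rw [Real.log_div (div_pos (Real.exp_pos _) hZp).ne' (hf η).ne',
      Real.log_div (Real.exp_pos _).ne' hZp.ne', Real.log_exp] at this
    have h2 := mul_le_mul_of_nonneg_left this (hf η).le
    have h3 : f η * (Real.exp (X η) / Z / f η - 1) = Z⁻¹ * Real.exp (X η) - f η := by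
      have := (hf η).ne'
      field_simp
    rw [h3] at h2
    linarith
  refine (bexp_mono h0 h1 hpt).trans (le_of_eq ?_)
  rw [bexp_add, bexp_add, bexp_sub, bexp_const_mul, bexp_const_mul, ← hZ, hf1,
    inv_mul_cancel₀ hZp.ne']
  ring

/-- Hoeffding's lemma for a centred two-point variable. -/
theorem hoeffding_two_point {p : ℝ} (h0 : 0 ≤ p) (h1 : p ≤ 1) (t : ℝ) :
    p * Real.exp (t * (1 - p)) + (1 - p) * Real.exp (t * (0 - p)) ≤ Real.exp (t ^ 2 / 8) := by
  let P : unitInterval := ⟨p, h0, h1⟩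
  let μ := ProbabilityTheory.bernoulliMeasure true false P
  have hint : ∀ g : Bool → ℝ, ∫ c, g c ∂μ = p * g true + (1 - p) * g false := by
    intro g
    rw [integral_fintype Integrable.of_finite]
    simp [μ, P, ProbabilityTheory.bernoulliMeasure_real_apply]
  -- The centred variable lives in [−p, 1 − p], of length one, hence the variance proxy 1/4 and the
  -- exponent t²/8.
  have h := ProbabilityTheory.hasSubgaussianMGF_of_mem_Icc_of_integral_eq_zero (μ := μ)
    (X := fun c : Bool => (if c then 1 else 0) - p) (a := -p) (b := 1 - p)
    (Measurable.of_discrete.aemeasurable)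
    (Eventually.of_forall fun c => by
      cases c <;> simp)
    (by rw [hint]; simp; ring)
  have h2 := h.mgf_le t
  unfold ProbabilityTheory.mgf at h2
  rw [hint] at h2
  simp only [if_true, Bool.false_eq_true, if_false] at h2
  refine h2.trans (le_of_eq ?_)
  congr 1
  simp
  ring

end Bernoulli

/-! ### Exponential moments of quadratic forms -/

theorem integral_exp_quadratic (t : ℝ) :
    ∫ x : ℝ, Real.exp (-(1 / 2) * x ^ 2 + t * x) = Real.exp (t ^ 2 / 2) * √(2 * Real.pi) := by
  have h1 : ∀ x : ℝ, Real.exp (-(1 / 2) * x ^ 2 + t * x)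
      = Real.exp (t ^ 2 / 2) * Real.exp (-(1 / 2) * (x - t) ^ 2) := by
    intro x; rw [← Real.exp_add]; ring_nf
  simp only [h1]
  rw [integral_const_mul, integral_sub_right_eq_self (fun x : ℝ => Real.exp (-(1 / 2) * x ^ 2)) t,
    integral_gaussian]
  congr 2
  ring

theorem integrable_exp_quadratic (t : ℝ) :
    Integrable fun x : ℝ => Real.exp (-(1 / 2) * x ^ 2 + t * x) := by
  have h1 : ∀ x : ℝ, Real.exp (-(1 / 2) * x ^ 2 + t * x)
      = Real.exp (t ^ 2 / 2) * Real.exp (-(1 / 2) * (x - t) ^ 2) := by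
    intro x; rw [← Real.exp_add]; ring_nf
  simp only [h1]
  exact ((integrable_exp_neg_mul_sq (by norm_num : (0 : ℝ) < 1 / 2)).comp_sub_right t).const_mul _

/-- This amounts to (1 − m/2)^(−1/2) ≤ exp(m/2), that is exp(−m) ≤ 1 − m/2 on [0, 1]; it follows
from exp m ≥ 1 + m. -/
theorem inv_sqrt_one_sub_le {m : ℝ} (hm0 : 0 ≤ m) (hm1 : m ≤ 1) :
    √(Real.pi / ((1 - m / 2) / 2)) ≤ Real.exp (m / 2) * √(2 * Real.pi) := by
  have h2 : Real.exp (-m) ≤ 1 - m / 2 := by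
    have h3 := Real.add_one_le_exp m
    have h4 : 0 < Real.exp m := Real.exp_pos m
    rw [Real.exp_neg, inv_le_iff_one_le_mul₀ h4]
    nlinarith
  have hp : 0 < 1 - m / 2 := by linarith
  have e : Real.exp (m / 2) = √(Real.exp m) := by
    rw [Real.exp_half]
  rw [e, ← Real.sqrt_mul (Real.exp_pos m).le]
  apply Real.sqrt_le_sqrt
  rw [div_div_eq_mul_div, div_le_iff₀ hp]
  have h5 : 1 ≤ Real.exp m * (1 - m / 2) := by
    have := mul_le_mul_of_nonneg_left h2 (Real.exp_pos m).le
    rwa [← Real.exp_add, add_neg_cancel, Real.exp_zero] at this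
  nlinarith [Real.pi_pos]

/-- Gaussian linearization in one variable. -/
theorem sum_exp_sq_le {Ω : Type*} [Fintype Ω] (w s : Ω → ℝ) {C : ℝ}
    (h : ∀ t : ℝ, ∑ η, w η * Real.exp (t * s η) ≤ C * Real.exp (t ^ 2 / 8)) {m : ℝ}
    (hm0 : 0 ≤ m) (hm1 : m ≤ 1) (hC : 0 ≤ C) :
    ∑ η, w η * Real.exp (m * s η ^ 2) ≤ C * Real.exp (m / 2) := by
  have hpi : 0 < √(2 * Real.pi) := Real.sqrt_pos.2 (by positivity)
  -- With r² = 2m, exp(m s²) = exp((r s)²/2) is the average of exp(r s x) over a standard Gaussian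
  -- x, which makes s appear linearly.
  set r := √(2 * m) with hr
  have hr2 : r ^ 2 = 2 * m := Real.sq_sqrt (by positivity)
  have hp : 0 < (1 - m / 2) / 2 := by linarith
  have h1 : (∑ η, w η * Real.exp (m * s η ^ 2)) * √(2 * Real.pi)
      = ∫ x : ℝ, ∑ η, w η * Real.exp (-(1 / 2) * x ^ 2 + (r * s η) * x) := by
    rw [integral_finsetSum _ fun η _ => (integrable_exp_quadratic _).const_mul _, Finset.sum_mul]
    refine Finset.sum_congr rfl fun η _ => ?_
    rw [integral_const_mul, integral_exp_quadratic, mul_pow, hr2, mul_assoc]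
    congr 3
    ring
  -- The hypothesis at t = r x contributes exp(m x²/4), which changes the Gaussian exponent from
  -- −x²/2 to −(1 − m/2) x²/2.
  have h2 : ∫ x : ℝ, ∑ η, w η * Real.exp (-(1 / 2) * x ^ 2 + (r * s η) * x)
      ≤ ∫ x : ℝ, C * Real.exp (-((1 - m / 2) / 2) * x ^ 2) := by
    refine integral_mono
      (integrable_finsetSum _ fun η _ => (integrable_exp_quadratic _).const_mul _)
      ((integrable_exp_neg_mul_sq hp).const_mul _) fun x => ?_
    have h3 := mul_le_mul_of_nonneg_left (h (r * x)) (Real.exp_pos (-(1 / 2) * x ^ 2)).le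
    calc ∑ η, w η * Real.exp (-(1 / 2) * x ^ 2 + (r * s η) * x)
        = Real.exp (-(1 / 2) * x ^ 2) * ∑ η, w η * Real.exp (r * x * s η) := by
          rw [Finset.mul_sum]
          refine Finset.sum_congr rfl fun η _ => ?_
          rw [Real.exp_add]; ring_nf
      _ ≤ _ := h3
      _ = C * Real.exp (-((1 - m / 2) / 2) * x ^ 2) := by
          rw [mul_left_comm, ← Real.exp_add, mul_pow, hr2]
          congr 2
          ring
  rw [integral_const_mul, integral_gaussian] at h2
  have h4 := mul_le_mul_of_nonneg_left (inv_sqrt_one_sub_le hm0 hm1) hC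
  rw [← mul_assoc] at h4
  exact le_of_mul_le_mul_right (by linarith) hpi

/-- Linear terms are traded for squares one coordinate at a time; the other linear coefficients stay
arbitrary, which keeps the induction going. No independence of the `s i` is needed, only their joint
sub-Gaussian bound. -/
theorem sum_exp_sum_sq_le {Ω ι : Type*} [Fintype Ω] [Fintype ι] [DecidableEq ι] (w : Ω → ℝ)
    (s : ι → Ω → ℝ)
    (h : ∀ t : ι → ℝ, ∑ η, w η * Real.exp (∑ i, t i * s i η) ≤ Real.exp ((∑ i, t i ^ 2) / 8))
    (m : ι → ℝ) (hm0 : ∀ i, 0 ≤ m i) (hm1 : ∀ i, m i ≤ 1) :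
    ∑ η, w η * Real.exp (∑ i, m i * s i η ^ 2) ≤ Real.exp ((∑ i, m i) / 2) := by
  have key : ∀ (I : Finset ι) (t : ι → ℝ),
      ∑ η, w η * Real.exp (∑ i ∈ I, m i * s i η ^ 2 + ∑ i ∈ Iᶜ, t i * s i η)
        ≤ Real.exp ((∑ i ∈ I, m i) / 2 + (∑ i ∈ Iᶜ, t i ^ 2) / 8) := by
    intro I
    induction I using Finset.induction_on with
    | empty => intro t; simpa using h t
    | insert i I hi ih =>
      intro t
      have hc : Iᶜ = insert i (insert i I)ᶜ := by
        ext j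
        by_cases hj : j = i
        · subst hj; simp [hi]
        · simp [hj]
      have hni : i ∉ (insert i I)ᶜ := by simp
      have := sum_exp_sq_le
        (fun η => w η * Real.exp (∑ j ∈ I, m j * s j η ^ 2 + ∑ j ∈ (insert i I)ᶜ, t j * s j η))
        (s i) (C := Real.exp ((∑ j ∈ I, m j) / 2 + (∑ j ∈ (insert i I)ᶜ, t j ^ 2) / 8))
        (fun τ => ?_) (hm0 i) (hm1 i) (Real.exp_pos _).le
      · rw [← Real.exp_add] at this
        simp only [mul_assoc, ← Real.exp_add] at this
        rw [Finset.sum_insert hi]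
        simp only [Finset.sum_insert hi]
        refine le_trans (le_of_eq ?_) (this.trans (le_of_eq ?_))
        · refine Finset.sum_congr rfl fun η _ => ?_
          congr 2
          ring
        · congr 1
          ring
      · have h2 := ih (Function.update t i τ)
        rw [hc, Finset.sum_insert hni] at h2
        simp only [Finset.sum_insert hni, Function.update_self] at h2
        have e : ∀ (g : ℝ → ι → ℝ), ∑ j ∈ (insert i I)ᶜ, g (Function.update t i τ j) j
            = ∑ j ∈ (insert i I)ᶜ, g (t j) j := by
          intro g
          refine Finset.sum_congr rfl fun j hj => ?_
          rw [Function.update_of_ne]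
          rintro rfl
          exact hni hj
        rw [e fun y _ => y ^ 2] at h2
        have e2 : ∀ η, ∑ j ∈ (insert i I)ᶜ, Function.update t i τ j * s j η
            = ∑ j ∈ (insert i I)ᶜ, t j * s j η := fun η => e fun y j => y * s j η
        simp only [e2] at h2
        rw [← Real.exp_add]
        simp only [mul_assoc, ← Real.exp_add]
        refine le_trans (le_of_eq ?_) (h2.trans (le_of_eq ?_))
        · refine Finset.sum_congr rfl fun η _ => ?_
          congr 2
          ring
        · congr 1
          ring
  simpa using key Finset.univ 0

/-- The centred occupation variable. -/
noncomputable def cocc {S : Type} (ρ : ℝ) (η : Config S) (x : S) : ℝ := occ η x - ρ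

section

variable {S : Type} [Fintype S] [DecidableEq S] {ρ : ℝ}

theorem bexp_exp_linear_le (h0 : 0 < ρ) (h1 : ρ < 1) (t : S → ℝ) :
    bexp ρ (fun η => Real.exp (∑ x, t x * cocc ρ η x)) ≤ Real.exp ((∑ x, t x ^ 2) / 8) := by
  have e : ∀ η : Config S, Real.exp (∑ x, t x * cocc ρ η x)
      = ∏ x, Real.exp (t x * ((if η x then 1 else 0) - ρ)) := by
    intro η; rw [Real.exp_sum]; rfl
  simp only [e]
  rw [bexp_prod ρ fun x c => Real.exp (t x * ((if c then 1 else 0) - ρ)), Finset.sum_div,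
    Real.exp_sum]
  refine Finset.prod_le_prod (fun x _ => ?_) fun x _ => ?_
  · have : 0 < 1 - ρ := by linarith
    positivity
  · simpa using hoeffding_two_point h0.le h1.le (t x)

open Matrix in
/-- Exponential moment of a quadratic form in the centred occupation variables. -/
theorem bexp_exp_quadratic_le (h0 : 0 < ρ) (h1 : ρ < 1) {M : Matrix S S ℝ} (hM : M.IsHermitian)
    (hpos : ∀ v : S → ℝ, 0 ≤ v ⬝ᵥ M *ᵥ v) (hle : ∀ v : S → ℝ, v ⬝ᵥ M *ᵥ v ≤ v ⬝ᵥ v) :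
    bexp ρ (fun η => Real.exp (cocc ρ η ⬝ᵥ M *ᵥ cocc ρ η)) ≤ Real.exp (M.trace / 2) := by
  -- Diagonalising turns the form into Σ λ_i (Uᵀω)_i² with λ_i in [0, 1]. The rotated coordinates
  -- are no longer independent, but U preserves norms, so they inherit the joint sub-Gaussian bound
  -- with the same constant.
  set U : Matrix S S ℝ := (hM.eigenvectorUnitary : Matrix S S ℝ) with hU
  have hUU : U * Uᵀ = 1 := by
    have := (Unitary.mem_iff.1 hM.eigenvectorUnitary.2).2
    simpa [star_eq_conjTranspose] using this
  have hUU' : Uᵀ * U = 1 := mul_eq_one_comm.1 hUU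
  have hspec : M = U * diagonal hM.eigenvalues * Uᵀ := by
    have := hM.spectral_theorem
    simpa [Unitary.conjStarAlgAut_apply, star_eq_conjTranspose, Function.comp_def] using this
  have hquad : ∀ v : S → ℝ, v ⬝ᵥ M *ᵥ v = ∑ i, hM.eigenvalues i * (Uᵀ *ᵥ v) i ^ 2 := by
    intro v
    conv_lhs => rw [hspec]
    rw [← mulVec_mulVec, ← mulVec_mulVec, dotProduct_mulVec, ← mulVec_transpose]
    simp only [dotProduct, mulVec_diagonal]
    exact Finset.sum_congr rfl fun i _ => by ring
  have hcol : ∀ i, Uᵀ *ᵥ (U *ᵥ Pi.single i 1) = Pi.single i 1 := by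
    intro i; rw [mulVec_mulVec, hUU', one_mulVec]
  have hev : ∀ i, hM.eigenvalues i = (U *ᵥ Pi.single i 1) ⬝ᵥ M *ᵥ (U *ᵥ Pi.single i 1) := by
    intro i
    rw [hquad, hcol]
    simp [Pi.single_apply]
  have hnorm : ∀ t : S → ℝ, (U *ᵥ t) ⬝ᵥ (U *ᵥ t) = t ⬝ᵥ t := by
    intro t
    rw [dotProduct_mulVec, ← mulVec_transpose, mulVec_mulVec, hUU', one_mulVec]
  have hb := sum_exp_sum_sq_le (bweight ρ) (fun i (η : Config S) => (Uᵀ *ᵥ cocc ρ η) i) ?_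
    hM.eigenvalues (fun i => by rw [hev]; exact hpos _)
    (fun i => by
      rw [hev]
      refine (hle _).trans ?_
      rw [hnorm]; simp)
  · rw [hM.trace_eq_sum_eigenvalues]
    simpa [bexp, hquad] using hb
  · intro t
    have := bexp_exp_linear_le h0 h1 (U *ᵥ t)
    have e1 : ∑ x, (U *ᵥ t) x ^ 2 = ∑ i, t i ^ 2 := by
      have := hnorm t
      simpa [dotProduct, sq] using this
    have e2 : ∀ η : Config S, ∑ x, (U *ᵥ t) x * cocc ρ η x
        = ∑ i, t i * (Uᵀ *ᵥ cocc ρ η) i := by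
      intro η
      change (U *ᵥ t) ⬝ᵥ cocc ρ η = t ⬝ᵥ (Uᵀ *ᵥ cocc ρ η)
      rw [dotProduct_mulVec, vecMul_transpose]
    simpa [bexp, e1, e2] using this

end

/-! ### Neighbours on the torus -/

section Torus

set_option linter.unusedSectionVars false

variable {d n : ℕ} [NeZero n]

theorem mem_neighbors {x y : Torus d n} : y ∈ neighbors x ↔
    y ≠ x ∧ ∃ i : Fin d, y = x + Pi.single i 1 ∨ y = x - Pi.single i 1 := by
  simp [neighbors]

theorem neighbors_comm {x y : Torus d n} : y ∈ neighbors x ↔ x ∈ neighbors y := by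
  have h : ∀ x y : Torus d n, y ∈ neighbors x → x ∈ neighbors y := by
    intro x y hy
    rw [mem_neighbors] at hy ⊢
    obtain ⟨hne, i, h | h⟩ := hy
    · exact ⟨hne.symm, i, Or.inr (by rw [h]; abel)⟩
    · exact ⟨hne.symm, i, Or.inl (by rw [h]; abel)⟩
  exact ⟨h x y, h y x⟩

theorem ne_of_mem_neighbors {x y : Torus d n} (h : y ∈ neighbors x) : x ≠ y :=
  (mem_neighbors.1 h).1.symm

theorem sum_neighbors_comm (F : Torus d n → Torus d n → ℝ) :
    ∑ x, ∑ y ∈ neighbors x, F x y = ∑ x, ∑ y ∈ neighbors x, F y x :=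
  Finset.sum_comm' fun x y => by simp [neighbors_comm (x := x)]

theorem sum_neighbors_by_parts (c u : Torus d n → ℝ) :
    ∑ x, ∑ y ∈ neighbors x, (c x - c y) * (u x - u y)
      = 2 * ∑ x, c x * ∑ y ∈ neighbors x, (u x - u y) := by
  have h1 : ∑ x, ∑ y ∈ neighbors x, (c x - c y) * (u x - u y)
      = ∑ x, ∑ y ∈ neighbors x, c x * (u x - u y)
        + ∑ x, ∑ y ∈ neighbors x, c y * (u y - u x) := by
    simp only [← Finset.sum_add_distrib]
    exact Finset.sum_congr rfl fun x _ => Finset.sum_congr rfl fun y _ => by ring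
  rw [h1, ← sum_neighbors_comm fun x y => c x * (u x - u y)]
  simp only [Finset.mul_sum]
  rw [← Finset.sum_add_distrib]
  refine Finset.sum_congr rfl fun x _ => ?_
  rw [← Finset.sum_add_distrib]
  exact Finset.sum_congr rfl fun y _ => by ring

/-- The unit step in direction `i`, forward or backward. -/
def unitStep (d n : ℕ) (p : Fin d × Bool) : Torus d n :=
  if p.2 then Pi.single p.1 1 else -Pi.single p.1 1

/-- For n = 2 the steps e_i and −e_i coincide. From n = 3 on each site has exactly 2d neighbours, on
which the centring of neighbour sums relies. -/
theorem unitStep_injective (hn : 3 ≤ n) : Function.Injective (unitStep d n) := by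
  have h1 : (1 : ZMod n) ≠ 0 := by
    have : Fact (1 < n) := ⟨by omega⟩
    exact one_ne_zero
  have h2 : (1 : ZMod n) ≠ -1 := by
    intro h
    have h3 : ((2 : ℕ) : ZMod n) = 0 := by
      push_cast
      linear_combination h
    rw [ZMod.natCast_eq_zero_iff] at h3
    exact absurd (Nat.le_of_dvd (by norm_num) h3) (by omega)
  rintro ⟨i, s⟩ ⟨j, t⟩ h
  have hi := congrFun h i
  have hij : i = j := by
    by_contra hne
    cases s <;> cases t <;> simp [unitStep, hne, h1] at hi
  subst hij
  cases s <;> cases t <;> simp [unitStep, h2, h2.symm] at hi ⊢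

theorem sum_neighbors_eq (hn : 3 ≤ n) (x : Torus d n) (f : Torus d n → ℝ) :
    ∑ y ∈ neighbors x, f y
      = ∑ i : Fin d, (f (x + Pi.single i 1) + f (x - Pi.single i 1)) := by
  have h1 : (1 : ZMod n) ≠ 0 := by
    have : Fact (1 < n) := ⟨by omega⟩
    exact one_ne_zero
  have himg : neighbors x = Finset.univ.image fun p => x + unitStep d n p := by
    ext y
    simp only [mem_neighbors, Finset.mem_image, Finset.mem_univ, true_and, Prod.exists,
      Bool.exists_bool, unitStep]
    constructor
    · rintro ⟨-, i, h | h⟩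
      · exact ⟨i, Or.inr (by simp [h])⟩
      · exact ⟨i, Or.inl (by simp [h, sub_eq_add_neg])⟩
    · rintro ⟨i, h | h⟩
      · refine ⟨?_, i, Or.inr (by simp [← h, sub_eq_add_neg])⟩
        rintro rfl
        have := congrFun h i
        simp [h1] at this
      · refine ⟨?_, i, Or.inl (by simp [← h])⟩
        rintro rfl
        have := congrFun h i
        simp [h1] at this
  rw [himg, Finset.sum_image fun p _ q _ h => unitStep_injective hn (add_left_cancel h),
    Fintype.sum_prod_type]
  refine Finset.sum_congr rfl fun i _ => ?_
  simp [unitStep, sub_eq_add_neg]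

theorem card_neighbors (hn : 3 ≤ n) (x : Torus d n) : ((neighbors x).card : ℝ) = 2 * d := by
  have := sum_neighbors_eq hn x fun _ => 1
  simp only [Finset.sum_const, Finset.card_univ, Fintype.card_fin, nsmul_eq_mul, mul_one] at this
  rw [this]; ring

/-! ### The resolvent of the Laplacian -/

/-- The character of the torus with frequency `k`. -/
noncomputable def torusChar (k x : Torus d n) : ℂ := ∏ i, ZMod.stdAddChar (k i * x i)

/-- The eigenvalue of minus the Laplacian at frequency `k`. -/
noncomputable def symbol (k : Torus d n) : ℝ :=
  ∑ i, (2 - 2 * (ZMod.stdAddChar (k i) : ℂ).re)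

/-- The kernel of the resolvent `(1 - n² Δ)⁻¹`. -/
noncomputable def resolventKernel (x : Torus d n) : ℝ :=
  1 / (n : ℝ) ^ d * ∑ k : Torus d n, (torusChar k x).re / (1 + (n : ℝ) ^ 2 * symbol k)

theorem norm_stdAddChar (k : ZMod n) : ‖(ZMod.stdAddChar k : ℂ)‖ = 1 :=
  AddChar.norm_apply _ _

theorem stdAddChar_neg (k : ZMod n) :
    (ZMod.stdAddChar (-k) : ℂ) = (starRingEnd ℂ) (ZMod.stdAddChar k) :=
  AddChar.map_neg_eq_conj _ _

theorem symbol_nonneg (k : Torus d n) : 0 ≤ symbol k :=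
  Finset.sum_nonneg fun i _ => by
    have := Complex.re_le_norm (ZMod.stdAddChar (k i) : ℂ)
    rw [norm_stdAddChar] at this
    linarith

theorem one_add_symbol_pos (k : Torus d n) : 0 < 1 + (n : ℝ) ^ 2 * symbol k := by
  have := symbol_nonneg k
  positivity

theorem torusChar_add (k x y : Torus d n) :
    torusChar k (x + y) = torusChar k x * torusChar k y := by
  simp only [torusChar, Pi.add_apply, mul_add, AddChar.map_add_eq_mul, Finset.prod_mul_distrib]

theorem torusChar_neg (k x : Torus d n) :
    torusChar k (-x) = (starRingEnd ℂ) (torusChar k x) := by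
  simp only [torusChar, Pi.neg_apply, mul_neg, stdAddChar_neg, map_prod]

theorem torusChar_single (k : Torus d n) (i : Fin d) :
    torusChar k (Pi.single i 1) = ZMod.stdAddChar (k i) := by
  unfold torusChar
  rw [Finset.prod_eq_single i]
  · simp
  · intro j _ hj; simp [hj]
  · simp

theorem torusChar_zero (k : Torus d n) : torusChar k 0 = 1 := by simp [torusChar]

theorem sum_torusChar (x : Torus d n) :
    ∑ k, torusChar k x = if x = 0 then ((n : ℂ) ^ d) else 0 := by
  have h : ∑ k, torusChar k x = ∏ i, ∑ c : ZMod n, (ZMod.stdAddChar (c * x i) : ℂ) := by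
    rw [Finset.prod_univ_sum, Fintype.piFinset_univ]
    rfl
  have h1 : ∀ i, ∑ c : ZMod n, (ZMod.stdAddChar (c * x i) : ℂ)
      = if x i = 0 then (n : ℂ) else 0 := by
    intro i
    rw [AddChar.sum_mulShift _ (ZMod.isPrimitive_stdAddChar n)]
    simp [ZMod.card]
  rw [h]
  simp only [h1]
  split_ifs with hx
  · subst hx; simp
  · obtain ⟨i, hi⟩ := Function.ne_iff.1 hx
    exact Finset.prod_eq_zero (Finset.mem_univ i) (if_neg hi)

theorem resolventKernel_neg (x : Torus d n) : resolventKernel (-x) = resolventKernel x := by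
  simp [resolventKernel, torusChar_neg]

theorem resolventKernel_zero :
    resolventKernel (0 : Torus d n)
      = 1 / (n : ℝ) ^ d * ∑ k : Torus d n, 1 / (1 + (n : ℝ) ^ 2 * symbol k) := by
  simp [resolventKernel, torusChar_zero]

theorem resolventKernel_zero_nonneg : 0 ≤ resolventKernel (0 : Torus d n) := by
  rw [resolventKernel_zero]
  have := fun k : Torus d n => one_add_symbol_pos k
  exact mul_nonneg (by positivity) (Finset.sum_nonneg fun k _ => (one_div_pos.2 (this k)).le)

/-- Exchanging two coordinates of the frequency preserves the symbol. By this isotropy G has one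
common value at all neighbouring pairs, so that a single diagonal correction suffices in
`pairKernel`. -/
theorem resolventKernel_single (i j : Fin d) :
    resolventKernel (Pi.single i 1 : Torus d n)
      = resolventKernel (Pi.single j 1 : Torus d n) := by
  unfold resolventKernel
  congr 1
  refine Fintype.sum_equiv (Equiv.arrowCongr (Equiv.swap i j) (Equiv.refl _)) _ _ fun k => ?_
  have h : symbol ((Equiv.arrowCongr (Equiv.swap i j) (Equiv.refl (ZMod n))) k) = symbol k := by
    unfold symbol
    exact Equiv.sum_comp (Equiv.swap i j)
      fun l => (2 - 2 * (ZMod.stdAddChar (k l) : ℂ).re)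
  rw [h, torusChar_single, torusChar_single]
  simp

/-- Characters are eigenfunctions of the Laplacian: applying 1 − n²Δ cancels each denominator and
leaves the orthogonality relation for characters. -/
theorem resolventKernel_eq (x : Torus d n) :
    resolventKernel x + (n : ℝ) ^ 2 * ∑ i : Fin d, (2 * resolventKernel x
      - (resolventKernel (x + Pi.single i 1) + resolventKernel (x - Pi.single i 1)))
      = if x = 0 then 1 else 0 := by
  have hstep : ∀ (k : Torus d n) (i : Fin d),
      (torusChar k (x + Pi.single i 1)).re + (torusChar k (x - Pi.single i 1)).re
        = (torusChar k x).re * (2 * (ZMod.stdAddChar (k i) : ℂ).re) := by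
    intro k i
    rw [sub_eq_add_neg, torusChar_add, torusChar_add, torusChar_neg, torusChar_single]
    simp only [Complex.mul_re, Complex.conj_re, Complex.conj_im]
    ring
  have hre : ∑ k, (torusChar k x).re = if x = 0 then (n : ℝ) ^ d else 0 := by
    rw [← Complex.re_sum, sum_torusChar]
    split_ifs
    · norm_cast
    · simp
  have hn : (n : ℝ) ^ d ≠ 0 := pow_ne_zero _ (Nat.cast_ne_zero.2 (NeZero.ne n))
  have h1 : resolventKernel x + (n : ℝ) ^ 2 * ∑ i : Fin d, (2 * resolventKernel x
      - (resolventKernel (x + Pi.single i 1) + resolventKernel (x - Pi.single i 1)))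
      = 1 / (n : ℝ) ^ d * ∑ k, (torusChar k x).re := by
    simp only [resolventKernel]
    simp only [← mul_add, ← Finset.sum_add_distrib, ← add_div, hstep, mul_left_comm (2 : ℝ),
      ← mul_sub, ← Finset.mul_sum]
    rw [mul_left_comm, ← mul_add]
    congr 1
    simp only [Finset.mul_sum, ← Finset.sum_sub_distrib]
    rw [Finset.sum_comm, ← Finset.sum_add_distrib]
    refine Finset.sum_congr rfl fun k _ => ?_
    rw [← Finset.mul_sum]
    have : ∑ i : Fin d, (2 * ((torusChar k x).re / (1 + (n : ℝ) ^ 2 * symbol k))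
        - (torusChar k x).re * (2 * (ZMod.stdAddChar (k i) : ℂ).re)
          / (1 + (n : ℝ) ^ 2 * symbol k))
        = (torusChar k x).re / (1 + (n : ℝ) ^ 2 * symbol k) * symbol k := by
      generalize 1 + (n : ℝ) ^ 2 * symbol k = D
      rw [symbol, Finset.mul_sum]
      exact Finset.sum_congr rfl fun i _ => by ring
    rw [this]
    have := (one_add_symbol_pos k).ne'
    field_simp
  rw [h1, hre]
  split_ifs
  · field_simp
  · simp

/-- The resolvent `(1 - n² Δ)⁻¹` as a matrix. -/
noncomputable def resolvent (d n : ℕ) [NeZero n] : Matrix (Torus d n) (Torus d n) ℝ :=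
  fun x y => resolventKernel (x - y)

theorem resolvent_comm (x y : Torus d n) : resolvent d n x y = resolvent d n y x := by
  unfold resolvent
  rw [← resolventKernel_neg, neg_sub]

theorem resolvent_isHermitian : (resolvent d n).IsHermitian := by
  ext x y
  simp [Matrix.conjTranspose_apply, resolvent_comm x y]

theorem resolvent_self (x : Torus d n) : resolvent d n x x = resolventKernel (0 : Torus d n) := by
  simp [resolvent]

theorem resolvent_neighbor {x y x' y' : Torus d n} (h : y ∈ neighbors x)
    (h' : y' ∈ neighbors x') : resolvent d n x y = resolvent d n x' y' := by
  have key : ∀ x y : Torus d n, y ∈ neighbors x →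
      ∃ i, resolvent d n x y = resolventKernel (Pi.single i 1 : Torus d n) := by
    intro x y hy
    obtain ⟨-, i, h | h⟩ := mem_neighbors.1 hy
    · refine ⟨i, ?_⟩
      rw [resolvent, h, ← resolventKernel_neg]; simp
    · refine ⟨i, ?_⟩
      rw [resolvent, h]; simp
  obtain ⟨i, hi⟩ := key x y h
  obtain ⟨j, hj⟩ := key x' y' h'
  rw [hi, hj, resolventKernel_single i j]

theorem trace_resolvent : (resolvent d n).trace = (n : ℝ) ^ d * resolventKernel (0 : Torus d n) := by
  simp [Matrix.trace, resolvent_self, ZMod.card]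

/-! ### The resolvent equation, its energy identity and the bounds 0 ≤ G ≤ 1 -/

open Matrix

theorem resolvent_mulVec_eq (hn : 3 ≤ n) (v : Torus d n → ℝ) (x : Torus d n) :
    (resolvent d n *ᵥ v) x + (n : ℝ) ^ 2 *
      ∑ y ∈ neighbors x, ((resolvent d n *ᵥ v) x - (resolvent d n *ᵥ v) y) = v x := by
  have h : ∀ z, resolvent d n x z + (n : ℝ) ^ 2 *
      ∑ y ∈ neighbors x, (resolvent d n x z - resolvent d n y z) = if x = z then 1 else 0 := by
    intro z
    rw [sum_neighbors_eq hn x fun y => resolvent d n x z - resolvent d n y z]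
    have := resolventKernel_eq (x - z)
    simp only [sub_eq_zero] at this
    rw [← this]
    unfold resolvent
    congr 2
    refine Finset.sum_congr rfl fun i _ => ?_
    rw [show x + Pi.single i 1 - z = x - z + Pi.single i 1 by abel,
      show x - Pi.single i 1 - z = x - z - Pi.single i 1 by abel]
    ring
  have h2 : ∑ z, (resolvent d n x z + (n : ℝ) ^ 2 *
      ∑ y ∈ neighbors x, (resolvent d n x z - resolvent d n y z)) * v z = v x := by
    simp only [h]
    simp
  rw [← h2]
  simp only [mulVec, dotProduct, add_mul, Finset.sum_add_distrib, ← Finset.sum_sub_distrib]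
  congr 1
  rw [Finset.sum_comm, Finset.mul_sum]
  refine Finset.sum_congr rfl fun z _ => ?_
  rw [Finset.mul_sum, Finset.mul_sum, Finset.sum_mul]
  exact Finset.sum_congr rfl fun y _ => by ring

/-- With u = Gv one has v = u − n²Δu; pair this with u and sum by parts. -/
theorem resolvent_energy (hn : 3 ≤ n) (v : Torus d n → ℝ) :
    v ⬝ᵥ resolvent d n *ᵥ v = (resolvent d n *ᵥ v) ⬝ᵥ (resolvent d n *ᵥ v)
      + (n : ℝ) ^ 2 / 2 * ∑ x, ∑ y ∈ neighbors x,
        ((resolvent d n *ᵥ v) x - (resolvent d n *ᵥ v) y) ^ 2 := by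
  have h := sum_neighbors_by_parts (resolvent d n *ᵥ v) (resolvent d n *ᵥ v)
  have h2 : v ⬝ᵥ resolvent d n *ᵥ v = ∑ x, ((resolvent d n *ᵥ v) x + (n : ℝ) ^ 2 *
      ∑ y ∈ neighbors x, ((resolvent d n *ᵥ v) x - (resolvent d n *ᵥ v) y))
        * (resolvent d n *ᵥ v) x := by
    simp only [resolvent_mulVec_eq hn]; rfl
  rw [h2]
  simp only [sq ((resolvent d n *ᵥ v) _ - (resolvent d n *ᵥ v) _)]
  rw [h, dotProduct, Finset.mul_sum, Finset.mul_sum, ← Finset.sum_add_distrib]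
  exact Finset.sum_congr rfl fun x _ => by ring

theorem resolvent_quadratic_nonneg (hn : 3 ≤ n) (v : Torus d n → ℝ) :
    0 ≤ v ⬝ᵥ resolvent d n *ᵥ v := by
  rw [resolvent_energy hn]
  have h1 : 0 ≤ (resolvent d n *ᵥ v) ⬝ᵥ (resolvent d n *ᵥ v) :=
    Finset.sum_nonneg fun x _ => mul_self_nonneg _
  have h2 : 0 ≤ ∑ x, ∑ y ∈ neighbors x,
      ((resolvent d n *ᵥ v) x - (resolvent d n *ᵥ v) y) ^ 2 :=
    Finset.sum_nonneg fun x _ => Finset.sum_nonneg fun y _ => sq_nonneg _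
  positivity

/-- With u = Gv, v·v − v·u is n² times the gradient energy of u plus the squared norm of n²Δu. -/
theorem resolvent_quadratic_le (hn : 3 ≤ n) (v : Torus d n → ℝ) :
    v ⬝ᵥ resolvent d n *ᵥ v ≤ v ⬝ᵥ v := by
  set u := resolvent d n *ᵥ v with hu
  have hv : ∀ x, u x + (n : ℝ) ^ 2 * ∑ y ∈ neighbors x, (u x - u y) = v x :=
    resolvent_mulVec_eq hn v
  have h := sum_neighbors_by_parts u u
  have h2 : 0 ≤ ∑ x, u x * ∑ y ∈ neighbors x, (u x - u y) := by
    have : 0 ≤ ∑ x, ∑ y ∈ neighbors x, (u x - u y) * (u x - u y) :=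
      Finset.sum_nonneg fun x _ => Finset.sum_nonneg fun y _ => mul_self_nonneg _
    linarith
  have h3 : v ⬝ᵥ v - v ⬝ᵥ u = (n : ℝ) ^ 2 * ∑ x, u x * ∑ y ∈ neighbors x, (u x - u y)
      + ∑ x, ((n : ℝ) ^ 2 * ∑ y ∈ neighbors x, (u x - u y)) ^ 2 := by
    unfold dotProduct
    rw [← Finset.sum_sub_distrib, Finset.mul_sum, ← Finset.sum_add_distrib]
    refine Finset.sum_congr rfl fun x _ => ?_
    rw [← hv x]; ring
  have h4 : 0 ≤ ∑ x, ((n : ℝ) ^ 2 * ∑ y ∈ neighbors x, (u x - u y)) ^ 2 :=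
    Finset.sum_nonneg fun x _ => sq_nonneg _
  have h5 : 0 ≤ (n : ℝ) ^ 2 * ∑ x, u x * ∑ y ∈ neighbors x, (u x - u y) := by positivity
  linarith

end Torus

/-! ### Exchanges and the Bernoulli measure -/

section Exchange

set_option linter.unusedSectionVars false

variable {S : Type} [Fintype S] [DecidableEq S] {ρ : ℝ}

theorem exchange_exchange (η : Config S) (x y : S) : exchange (exchange η x y) x y = η := by
  funext z; simp [exchange]

/-- The exchange of the values at `x` and `y` as a permutation of the configurations. -/
def exchangeEquiv (x y : S) : Config S ≃ Config S :=
  (show Function.Involutive fun η : Config S => exchange η x y from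
    fun η => exchange_exchange η x y).toPerm

theorem bweight_exchange (ρ : ℝ) (η : Config S) (x y : S) :
    bweight ρ (exchange η x y) = bweight ρ η :=
  Equiv.prod_comp (Equiv.swap x y) fun z => if η z then ρ else 1 - ρ

theorem bexp_exchange (ρ : ℝ) (f : Config S → ℝ) (x y : S) :
    bexp ρ (fun η => f (exchange η x y)) = bexp ρ f := by
  unfold bexp
  rw [← Equiv.sum_comp (exchangeEquiv x y) fun η => bweight ρ η * f η]
  refine Finset.sum_congr rfl fun η _ => ?_
  change _ = bweight ρ (exchange η x y) * f (exchange η x y)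
  rw [bweight_exchange]

theorem cocc_exchange (ρ : ℝ) (η : Config S) {x y : S} (h : x ≠ y) :
    cocc ρ (exchange η x y) = cocc ρ η
      + (cocc ρ η y - cocc ρ η x) • (Pi.single x 1 - Pi.single y 1 : S → ℝ) := by
  funext z
  by_cases hx : z = x
  · subst hx; simp [cocc, occ, exchange, h]
  · by_cases hy : z = y
    · subst hy; simp [cocc, occ, exchange, h.symm]
    · simp [cocc, occ, exchange, Equiv.swap_apply_of_ne_of_ne, hx, hy]

theorem cocc_sub_sq_le (ρ : ℝ) (η : Config S) (x y : S) :
    (cocc ρ η x - cocc ρ η y) ^ 2 ≤ 1 := by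
  have := occ_nonneg η x
  have := occ_nonneg η y
  have := occ_le_one η x
  have := occ_le_one η y
  unfold cocc
  nlinarith

theorem cocc_sq_le (h0 : 0 < ρ) (h1 : ρ < 1) (η : Config S) (x : S) : cocc ρ η x ^ 2 ≤ 1 := by
  have := occ_nonneg η x
  have := occ_le_one η x
  unfold cocc
  nlinarith

open Matrix in
-- An exchange moves the centred configuration along a single direction. The coefficient of δ² is
-- the second-order term that `pairKernel` is built to annihilate at neighbouring sites.
theorem quadratic_add (K : Matrix S S ℝ) (hK : ∀ x y, K x y = K y x) (c : S → ℝ) (δ : ℝ)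
    (x y : S) :
    (c + δ • (Pi.single x 1 - Pi.single y 1 : S → ℝ)) ⬝ᵥ
        K *ᵥ (c + δ • (Pi.single x 1 - Pi.single y 1 : S → ℝ))
      = c ⬝ᵥ K *ᵥ c + 2 * δ * ((K *ᵥ c) x - (K *ᵥ c) y)
        + δ ^ 2 * (K x x - 2 * K x y + K y y) := by
  have hT : Kᵀ = K := by ext i j; exact hK j i
  have hs : ∀ z, c ⬝ᵥ K.col z = (K *ᵥ c) z := by
    intro z
    simp only [mulVec, dotProduct, col_apply]
    exact Finset.sum_congr rfl fun w _ => by rw [hK z w]; ring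
  simp only [mulVec_add, mulVec_smul, mulVec_sub, mulVec_single_one, dotProduct_add,
    add_dotProduct, dotProduct_smul, smul_dotProduct, dotProduct_sub, sub_dotProduct,
    single_one_dotProduct, hs, col_apply, smul_eq_mul]
  rw [hK y x]
  ring

/-- The Dirichlet form of an exchange controls the correlation of `f` with the increments of a
function `Q` under the exchange. -/
theorem abs_bexp_exchange_le (h0 : 0 < ρ) (h1 : ρ < 1) {f : Config S → ℝ} (hf : ∀ η, 0 < f η)
    (Q h : Config S → ℝ) (x y : S)
    (hQ : ∀ η, (Q (exchange η x y) - Q η) ^ 2 ≤ 4 * h η ^ 2)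
    (hh : ∀ η, h (exchange η x y) = h η) :
    |bexp ρ fun η => (Q (exchange η x y) - Q η) * f η|
      ≤ 1 / 2 * bexp ρ (fun η => (√(f (exchange η x y)) - √(f η)) ^ 2)
        + 4 * bexp ρ (fun η => h η ^ 2 * f η) := by
  have e1 : bexp ρ (fun η => (Q (exchange η x y) - Q η) * f η)
      = -bexp ρ (fun η => (Q (exchange η x y) - Q η) * f (exchange η x y)) := by
    rw [← bexp_exchange ρ (fun η => (Q (exchange η x y) - Q η) * f η) x y]
    simp only [exchange_exchange]
    rw [← neg_one_mul, ← bexp_const_mul]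
    congr 1
    funext η; ring
  -- The exchange preserves ν and reverses the sign of the increment of Q; symmetrising replaces f
  -- by −1/2 times its own increment.
  have e2 : 2 * bexp ρ (fun η => (Q (exchange η x y) - Q η) * f η)
      = -bexp ρ (fun η => (Q (exchange η x y) - Q η) * (f (exchange η x y) - f η)) := by
    simp only [mul_sub ((Q (exchange _ x y) - Q _) : ℝ) (f _), bexp_sub]
    linarith
  have e3 : bexp ρ (fun η => h η ^ 2 * f (exchange η x y)) = bexp ρ fun η => h η ^ 2 * f η := by
    rw [← bexp_exchange ρ (fun η => h η ^ 2 * f η) x y]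
    simp only [hh]
  -- Factor the increment of f as (A − B)(A + B), with A and B the square roots, and apply Young's
  -- inequality; (A + B)² ≤ 2A² + 2B² brings back f.
  have hpt : ∀ η, |(Q (exchange η x y) - Q η) * (f (exchange η x y) - f η)|
      ≤ (√(f (exchange η x y)) - √(f η)) ^ 2
        + (4 * (h η ^ 2 * f (exchange η x y)) + 4 * (h η ^ 2 * f η)) := by
    intro η
    have hq := hQ η
    have s1 := Real.sq_sqrt (hf (exchange η x y)).le
    have s2 := Real.sq_sqrt (hf η).le
    generalize √(f (exchange η x y)) = A at *
    generalize √(f η) = B at *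
    rw [← s1, ← s2]
    generalize Q (exchange η x y) - Q η = q at *
    have h4 : q ^ 2 * (A + B) ^ 2 ≤ 4 * h η ^ 2 * (2 * A ^ 2 + 2 * B ^ 2) := by
      apply mul_le_mul hq _ (sq_nonneg _) (by positivity)
      nlinarith [sq_nonneg (A - B)]
    rw [show q * (A ^ 2 - B ^ 2) = (A - B) * (q * (A + B)) by ring, abs_le]
    constructor <;> nlinarith [sq_nonneg ((A - B) + q * (A + B) / 2),
      sq_nonneg ((A - B) - q * (A + B) / 2), mul_nonneg (sq_nonneg (h η)) (sq_nonneg A),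
      mul_nonneg (sq_nonneg (h η)) (sq_nonneg B), sq_nonneg (A - B)]
  have h5 : |bexp ρ (fun η => (Q (exchange η x y) - Q η) * (f (exchange η x y) - f η))|
      ≤ bexp ρ fun η => |(Q (exchange η x y) - Q η) * (f (exchange η x y) - f η)| := by
    unfold bexp
    refine (Finset.abs_sum_le_sum_abs _ _).trans (le_of_eq ?_)
    refine Finset.sum_congr rfl fun η _ => ?_
    rw [abs_mul (bweight ρ η), abs_of_pos (bweight_pos h0 h1 η)]
  have h6 := bexp_mono h0 h1 hpt
  rw [bexp_add, bexp_add, bexp_const_mul, bexp_const_mul, e3] at h6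
  have h7 : |2 * bexp ρ (fun η => (Q (exchange η x y) - Q η) * f η)|
      = 2 * |bexp ρ (fun η => (Q (exchange η x y) - Q η) * f η)| := by
    rw [abs_mul, abs_two]
  rw [e2, abs_neg] at h7
  linarith

end Exchange

/-! ### Correlations of neighbouring sites -/

section Correlation

variable {d n : ℕ} [NeZero n]

open Matrix

/-- The sum of the products of the centred occupation variables over ordered pairs of
neighbours. -/
noncomputable def nbrCorr (ρ : ℝ) (η : Config (Torus d n)) : ℝ :=
  ∑ x, cocc ρ η x * ∑ y ∈ neighbors x, cocc ρ η y

/-- The Dirichlet form of the exclusion dynamics, over ordered pairs of neighbours. -/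
noncomputable def exchForm (ρ : ℝ) (f : Config (Torus d n) → ℝ) : ℝ :=
  ∑ x, ∑ y ∈ neighbors x, bexp ρ fun η => (√(f (exchange η x y)) - √(f η)) ^ 2

/-- The resolvent with the diagonal lowered to its value at neighbouring sites. -/
noncomputable def pairKernel (d n : ℕ) [NeZero n] : Matrix (Torus d n) (Torus d n) ℝ :=
  resolvent d n - ((1 - resolventKernel (0 : Torus d n)) / (2 * d * (n : ℝ) ^ 2)) • 1

theorem pairKernel_comm (x y : Torus d n) : pairKernel d n x y = pairKernel d n y x := by
  simp [pairKernel, resolvent_comm x y, one_apply, eq_comm]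

theorem resolventKernel_zero_le (hn : 3 ≤ n) : resolventKernel (0 : Torus d n) ≤ 1 := by
  have := resolvent_quadratic_le hn (Pi.single (0 : Torus d n) 1)
  simpa [resolvent_self] using this

/-- The resolvent equation on the diagonal reads G_00 + 2d n² (G_00 − G_xy) = 1, so the amount
subtracted in `pairKernel` is exactly G_00 − G_xy. -/
theorem pairKernel_neighbor (hd : 1 ≤ d) (hn : 3 ≤ n) {x y : Torus d n} (h : y ∈ neighbors x) :
    pairKernel d n x x = pairKernel d n x y := by
  have h1 := resolvent_mulVec_eq hn (Pi.single x 1) x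
  have h2 : ∀ z ∈ neighbors x, resolvent d n x x - resolvent d n z x
      = resolvent d n x x - resolvent d n x y := fun z hz => by
    rw [resolvent_comm z x, resolvent_neighbor hz h]
  simp only [mulVec_single_one, col_apply, Pi.single_eq_same] at h1
  rw [Finset.sum_congr rfl h2, Finset.sum_const, nsmul_eq_mul, card_neighbors hn,
    resolvent_self] at h1
  have hd' : (d : ℝ) ≠ 0 := Nat.cast_ne_zero.2 (by omega)
  have hn' : (n : ℝ) ≠ 0 := Nat.cast_ne_zero.2 (by omega)
  simp only [pairKernel, Matrix.sub_apply, Matrix.smul_apply, one_apply_eq, one_apply_ne (ne_of_mem_neighbors h),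
    resolvent_self, smul_eq_mul, mul_one, mul_zero, sub_zero]
  field_simp
  linear_combination h1

theorem pairKernel_mulVec (c : Torus d n → ℝ) (x : Torus d n) :
    (pairKernel d n *ᵥ c) x = (resolvent d n *ᵥ c) x
      - (1 - resolventKernel (0 : Torus d n)) / (2 * d * (n : ℝ) ^ 2) * c x := by
  simp [pairKernel, sub_mulVec, smul_mulVec]

/-- The Laplacian of Gc comes from the resolvent equation; the diagonal correction contributes a
multiple of the Laplacian of c itself, and this is where the neighbour sum comes from. -/
theorem laplacian_pairKernel (hd : 1 ≤ d) (hn : 3 ≤ n) (c : Torus d n → ℝ) (x : Torus d n) :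
    (n : ℝ) ^ 2 * ∑ y ∈ neighbors x, ((pairKernel d n *ᵥ c) x - (pairKernel d n *ᵥ c) y)
      = resolventKernel (0 : Torus d n) * c x - (resolvent d n *ᵥ c) x
        + (1 - resolventKernel (0 : Torus d n)) / (2 * d) * ∑ y ∈ neighbors x, c y := by
  have h1 := resolvent_mulVec_eq hn c x
  have hd' : (d : ℝ) ≠ 0 := Nat.cast_ne_zero.2 (by omega)
  have hn' : (n : ℝ) ≠ 0 := Nat.cast_ne_zero.2 (by omega)
  simp only [pairKernel_mulVec, Finset.sum_sub_distrib, Finset.sum_const, nsmul_eq_mul,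
    card_neighbors hn, ← Finset.mul_sum] at h1 ⊢
  field_simp
  field_simp at h1
  linear_combination (2 * (d : ℝ)) * h1

/-- The double sum is a multiple of the exclusion generator applied to Q. As the second-order terms
vanish, each increment is −2(ω_x − ω_y) times the gradient of Kω, and summation by parts reduces the
sum to the Laplacian of Kω. -/
theorem nbrCorr_eq (hd : 1 ≤ d) (hn : 3 ≤ n) (ρ : ℝ) (η : Config (Torus d n)) :
    (1 - resolventKernel (0 : Torus d n)) / (2 * d) * nbrCorr ρ η
      = cocc ρ η ⬝ᵥ resolvent d n *ᵥ cocc ρ η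
        - resolventKernel (0 : Torus d n) * ∑ x, cocc ρ η x ^ 2
        - (n : ℝ) ^ 2 / 4 * ∑ x, ∑ y ∈ neighbors x,
          (cocc ρ (exchange η x y) ⬝ᵥ pairKernel d n *ᵥ cocc ρ (exchange η x y)
            - cocc ρ η ⬝ᵥ pairKernel d n *ᵥ cocc ρ η) := by
  have h1 : ∑ x, ∑ y ∈ neighbors x,
      (cocc ρ (exchange η x y) ⬝ᵥ pairKernel d n *ᵥ cocc ρ (exchange η x y)
        - cocc ρ η ⬝ᵥ pairKernel d n *ᵥ cocc ρ η)
      = -2 * ∑ x, ∑ y ∈ neighbors x, (cocc ρ η x - cocc ρ η y)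
        * ((pairKernel d n *ᵥ cocc ρ η) x - (pairKernel d n *ᵥ cocc ρ η) y) := by
    simp only [Finset.mul_sum]
    refine Finset.sum_congr rfl fun x _ => Finset.sum_congr rfl fun y hy => ?_
    rw [cocc_exchange ρ η (ne_of_mem_neighbors hy), quadratic_add _ pairKernel_comm,
      ← pairKernel_neighbor hd hn hy, pairKernel_neighbor hd hn (neighbors_comm.1 hy),
      pairKernel_comm y x, ← pairKernel_neighbor hd hn hy]
    ring
  rw [h1, sum_neighbors_by_parts]
  have h2 : (n : ℝ) ^ 2 * ∑ x, cocc ρ η x * ∑ y ∈ neighbors x,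
      ((pairKernel d n *ᵥ cocc ρ η) x - (pairKernel d n *ᵥ cocc ρ η) y)
      = resolventKernel (0 : Torus d n) * ∑ x, cocc ρ η x ^ 2
        - cocc ρ η ⬝ᵥ resolvent d n *ᵥ cocc ρ η
        + (1 - resolventKernel (0 : Torus d n)) / (2 * d) * nbrCorr ρ η := by
    unfold nbrCorr dotProduct
    rw [Finset.mul_sum, Finset.mul_sum, Finset.mul_sum, ← Finset.sum_sub_distrib,
      ← Finset.sum_add_distrib]
    refine Finset.sum_congr rfl fun x _ => ?_
    rw [mul_left_comm, laplacian_pairKernel hd hn]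
    ring
  linarith

/-- The gradient of Kω is that of Gω, controlled by the resolvent energy, minus α times that of ω.
The latter is at most one over each of the 2d n^d ordered pairs, and α ≤ 1/(2d n²). -/
theorem sum_gradient_pairKernel_le (hd : 1 ≤ d) (hn : 3 ≤ n) (ρ : ℝ) (η : Config (Torus d n)) :
    (n : ℝ) ^ 2 / 2 * ∑ x, ∑ y ∈ neighbors x,
        ((pairKernel d n *ᵥ cocc ρ η) x - (pairKernel d n *ᵥ cocc ρ η) y) ^ 2
      ≤ 2 * (cocc ρ η ⬝ᵥ resolvent d n *ᵥ cocc ρ η) + (n : ℝ) ^ d / (n : ℝ) ^ 2 := by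
  have hen := resolvent_energy hn (cocc ρ η)
  set G0 := resolventKernel (0 : Torus d n) with hG0
  have hG1 : G0 ≤ 1 := resolventKernel_zero_le hn
  have hG2 : 0 ≤ G0 := resolventKernel_zero_nonneg
  have hd' : (1 : ℝ) ≤ d := by exact_mod_cast hd
  have hn' : (0 : ℝ) < n := Nat.cast_pos.2 (by omega)
  set α := (1 - G0) / (2 * d * (n : ℝ) ^ 2) with hα
  have hα2 : α ^ 2 ≤ 1 / (2 * d * (n : ℝ) ^ 2) ^ 2 := by
    rw [hα, div_pow]
    apply div_le_div_of_nonneg_right _ (by positivity)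
    nlinarith
  have hterm : ∀ x y, ((pairKernel d n *ᵥ cocc ρ η) x - (pairKernel d n *ᵥ cocc ρ η) y) ^ 2
      ≤ 2 * ((resolvent d n *ᵥ cocc ρ η) x - (resolvent d n *ᵥ cocc ρ η) y) ^ 2
        + 2 * (1 / (2 * d * (n : ℝ) ^ 2) ^ 2) := by
    intro x y
    rw [pairKernel_mulVec, pairKernel_mulVec, ← hG0, ← hα]
    have h1 := cocc_sub_sq_le ρ η x y
    have h2 : α ^ 2 * (cocc ρ η x - cocc ρ η y) ^ 2 ≤ 1 / (2 * d * (n : ℝ) ^ 2) ^ 2 :=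
      (mul_le_of_le_one_right (sq_nonneg α) h1).trans hα2
    nlinarith [sq_nonneg ((resolvent d n *ᵥ cocc ρ η) x - (resolvent d n *ᵥ cocc ρ η) y
      + α * (cocc ρ η x - cocc ρ η y))]
  have hsum : ∑ x, ∑ y ∈ neighbors x,
        ((pairKernel d n *ᵥ cocc ρ η) x - (pairKernel d n *ᵥ cocc ρ η) y) ^ 2
      ≤ 2 * ∑ x, ∑ y ∈ neighbors x,
        ((resolvent d n *ᵥ cocc ρ η) x - (resolvent d n *ᵥ cocc ρ η) y) ^ 2
        + (n : ℝ) ^ d * (2 * d) * (2 * (1 / (2 * d * (n : ℝ) ^ 2) ^ 2)) := by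
    refine (Finset.sum_le_sum fun x _ => Finset.sum_le_sum fun y _ => hterm x y).trans
      (le_of_eq ?_)
    simp only [Finset.sum_add_distrib, Finset.sum_const, nsmul_eq_mul, card_neighbors hn,
      ← Finset.mul_sum, Finset.card_univ, Fintype.card_pi, ZMod.card, Finset.prod_const,
      Fintype.card_fin]
    push_cast
    ring
  have hu : 0 ≤ (resolvent d n *ᵥ cocc ρ η) ⬝ᵥ (resolvent d n *ᵥ cocc ρ η) :=
    Finset.sum_nonneg fun x _ => mul_self_nonneg _
  have hlast : (n : ℝ) ^ 2 / 2 * ((n : ℝ) ^ d * (2 * d) * (2 * (1 / (2 * d * (n : ℝ) ^ 2) ^ 2)))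
      ≤ (n : ℝ) ^ d / (n : ℝ) ^ 2 := by
    have e : (n : ℝ) ^ 2 / 2 * ((n : ℝ) ^ d * (2 * d) * (2 * (1 / (2 * d * (n : ℝ) ^ 2) ^ 2)))
        = (n : ℝ) ^ d / (n : ℝ) ^ 2 * (1 / (2 * d)) := by
      field_simp
    rw [e]
    apply mul_le_of_le_one_right (by positivity)
    rw [div_le_one (by positivity)]
    linarith
  have := mul_le_mul_of_nonneg_left hsum (by positivity : (0 : ℝ) ≤ (n : ℝ) ^ 2 / 2)
  rw [mul_add] at this
  linarith

/-- The correlations of neighbouring sites are controlled by the Dirichlet form of the exclusion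
dynamics and by the quadratic form of the resolvent. -/
theorem abs_bexp_nbrCorr_le (hd : 1 ≤ d) (hn : 3 ≤ n) {ρ : ℝ} (h0 : 0 < ρ) (h1 : ρ < 1)
    {f : Config (Torus d n) → ℝ} (hf : ∀ η, 0 < f η) (hf1 : bexp ρ f = 1) :
    (1 - resolventKernel (0 : Torus d n)) / (2 * d) * |bexp ρ fun η => nbrCorr ρ η * f η|
      ≤ (n : ℝ) ^ 2 / 8 * exchForm ρ f
        + 5 * bexp ρ (fun η => (cocc ρ η ⬝ᵥ resolvent d n *ᵥ cocc ρ η) * f η)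
        + (n : ℝ) ^ d * (resolventKernel (0 : Torus d n) + 2 / (n : ℝ) ^ 2) := by
  set G0 := resolventKernel (0 : Torus d n) with hG0
  have hG1 : G0 ≤ 1 := resolventKernel_zero_le hn
  have hG2 : 0 ≤ G0 := resolventKernel_zero_nonneg
  set W : Config (Torus d n) → ℝ := fun η => cocc ρ η ⬝ᵥ resolvent d n *ᵥ cocc ρ η with hW
  set Q : Config (Torus d n) → ℝ := fun η => cocc ρ η ⬝ᵥ pairKernel d n *ᵥ cocc ρ η with hQ
  let h : Torus d n → Torus d n → Config (Torus d n) → ℝ := fun x y η =>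
    (pairKernel d n *ᵥ cocc ρ η) x - (pairKernel d n *ᵥ cocc ρ η) y
  have hWn : ∀ η, 0 ≤ W η := fun η => resolvent_quadratic_nonneg hn _
  -- Equality of K on the diagonal and at neighbours is used twice: the increment of Q is exactly
  -- 2(ω_y − ω_x) h, and the exchange leaves the gradient h unchanged.
  have hexch : ∀ x, ∀ y ∈ neighbors x, |bexp ρ fun η => (Q (exchange η x y) - Q η) * f η|
      ≤ 1 / 2 * bexp ρ (fun η => (√(f (exchange η x y)) - √(f η)) ^ 2)
        + 4 * bexp ρ (fun η => h x y η ^ 2 * f η) := by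
    intro x y hy
    have k1 := pairKernel_neighbor hd hn hy
    have k2 := pairKernel_neighbor hd hn (neighbors_comm.1 hy)
    refine abs_bexp_exchange_le h0 h1 hf Q (h x y) x y (fun η => ?_) fun η => ?_
    · simp only [hQ]
      rw [cocc_exchange ρ η (ne_of_mem_neighbors hy), quadratic_add _ pairKernel_comm]
      have e : pairKernel d n x x - 2 * pairKernel d n x y + pairKernel d n y y = 0 := by
        linarith [pairKernel_comm y x]
      rw [e]
      have := cocc_sub_sq_le ρ η y x
      have h2 := mul_le_mul_of_nonneg_right this (sq_nonneg (h x y η))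
      simp only [h] at h2 ⊢
      nlinarith
    · simp only [h]
      rw [cocc_exchange ρ η (ne_of_mem_neighbors hy)]
      simp only [mulVec_add, mulVec_smul, mulVec_sub, mulVec_single_one, Pi.add_apply,
        Pi.smul_apply, Pi.sub_apply, col_apply, smul_eq_mul]
      linear_combination (cocc ρ η y - cocc ρ η x) * (k1 + k2)
  have hgrad : (n : ℝ) ^ 2 / 2 * ∑ x, ∑ y ∈ neighbors x, bexp ρ (fun η => h x y η ^ 2 * f η)
      ≤ 2 * bexp ρ (fun η => W η * f η) + (n : ℝ) ^ d / (n : ℝ) ^ 2 := by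
    have e : (n : ℝ) ^ 2 / 2 * ∑ x, ∑ y ∈ neighbors x, bexp ρ (fun η => h x y η ^ 2 * f η)
        = bexp ρ fun η => ((n : ℝ) ^ 2 / 2 * ∑ x, ∑ y ∈ neighbors x, h x y η ^ 2) * f η := by
      simp only [mul_assoc, Finset.sum_mul]
      rw [bexp_const_mul, bexp_sum]
      simp only [bexp_sum]
    have e2 : 2 * bexp ρ (fun η => W η * f η) + (n : ℝ) ^ d / (n : ℝ) ^ 2
        = bexp ρ fun η => (2 * W η + (n : ℝ) ^ d / (n : ℝ) ^ 2) * f η := by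
      simp only [add_mul, mul_assoc]
      rw [bexp_add, bexp_const_mul, bexp_const_mul, hf1, mul_one]
    rw [e, e2]
    exact bexp_mono h0 h1 fun η =>
      mul_le_mul_of_nonneg_right (sum_gradient_pairKernel_le hd hn ρ η) (hf η).le
  have hC : (1 - G0) / (2 * d) * bexp ρ (fun η => nbrCorr ρ η * f η)
      = bexp ρ (fun η => W η * f η) - bexp ρ (fun η => (G0 * ∑ x, cocc ρ η x ^ 2) * f η)
        - (n : ℝ) ^ 2 / 4 * ∑ x, ∑ y ∈ neighbors x,
          bexp ρ (fun η => (Q (exchange η x y) - Q η) * f η) := by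
    have e : ∀ η, (1 - G0) / (2 * d) * (nbrCorr ρ η * f η)
        = W η * f η - (G0 * ∑ x, cocc ρ η x ^ 2) * f η
          - (n : ℝ) ^ 2 / 4 * ∑ x, ∑ y ∈ neighbors x, (Q (exchange η x y) - Q η) * f η := by
      intro η
      rw [← mul_assoc, hG0, nbrCorr_eq hd hn ρ]
      simp only [← Finset.sum_mul]
      ring
    rw [← bexp_const_mul]
    simp only [e]
    rw [bexp_sub, bexp_sub, bexp_const_mul, bexp_sum]
    simp only [bexp_sum]
  have hdiag : bexp ρ (fun η => (G0 * ∑ x, cocc ρ η x ^ 2) * f η) ≤ G0 * (n : ℝ) ^ d := by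
    have : ∀ η : Config (Torus d n), (G0 * ∑ x, cocc ρ η x ^ 2) * f η
        ≤ (G0 * (n : ℝ) ^ d) * f η := by
      intro η
      refine mul_le_mul_of_nonneg_right (mul_le_mul_of_nonneg_left ?_ hG2) (hf η).le
      refine (Finset.sum_le_sum fun x _ => cocc_sq_le h0 h1 η x).trans (le_of_eq ?_)
      simp [ZMod.card]
    have := bexp_mono h0 h1 this
    rwa [bexp_const_mul, hf1, mul_one] at this
  have hdiag0 : 0 ≤ bexp ρ (fun η => (G0 * ∑ x, cocc ρ η x ^ 2) * f η) :=
    bexp_nonneg h0 h1 fun η => mul_nonneg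
      (mul_nonneg hG2 (Finset.sum_nonneg fun x _ => sq_nonneg _)) (hf η).le
  have hW0 : 0 ≤ bexp ρ (fun η => W η * f η) :=
    bexp_nonneg h0 h1 fun η => mul_nonneg (hWn η) (hf η).le
  have hT : (n : ℝ) ^ 2 / 4 * |∑ x, ∑ y ∈ neighbors x,
      bexp ρ (fun η => (Q (exchange η x y) - Q η) * f η)|
      ≤ (n : ℝ) ^ 2 / 8 * exchForm ρ f
        + 2 * ((n : ℝ) ^ 2 / 2 * ∑ x, ∑ y ∈ neighbors x, bexp ρ (fun η => h x y η ^ 2 * f η)) := by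
    have : |∑ x, ∑ y ∈ neighbors x, bexp ρ (fun η => (Q (exchange η x y) - Q η) * f η)|
        ≤ ∑ x, ∑ y ∈ neighbors x,
          (1 / 2 * bexp ρ (fun η => (√(f (exchange η x y)) - √(f η)) ^ 2)
            + 4 * bexp ρ (fun η => h x y η ^ 2 * f η)) :=
      (Finset.abs_sum_le_sum_abs _ _).trans (Finset.sum_le_sum fun x _ =>
        (Finset.abs_sum_le_sum_abs _ _).trans (Finset.sum_le_sum fun y hy => hexch x y hy))
    refine (mul_le_mul_of_nonneg_left this (by positivity)).trans (le_of_eq ?_)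
    simp only [exchForm, Finset.sum_add_distrib, ← Finset.mul_sum]
    ring
  have hpos : 0 ≤ (1 - G0) / (2 * d) := div_nonneg (by linarith) (by positivity)
  have habs : (1 - G0) / (2 * d) * |bexp ρ fun η => nbrCorr ρ η * f η|
      = |(1 - G0) / (2 * d) * bexp ρ fun η => nbrCorr ρ η * f η| := by
    rw [abs_mul, abs_of_nonneg hpos]
  have hfin : (n : ℝ) ^ d * (G0 + 2 / (n : ℝ) ^ 2)
      = G0 * (n : ℝ) ^ d + 2 * ((n : ℝ) ^ d / (n : ℝ) ^ 2) := by ring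
  rw [habs, hC, hfin]
  have h4 : |bexp ρ (fun η => W η * f η) - bexp ρ (fun η => (G0 * ∑ x, cocc ρ η x ^ 2) * f η)|
      ≤ bexp ρ (fun η => W η * f η) + G0 * (n : ℝ) ^ d := by
    rw [abs_le]; constructor <;> linarith
  have h5 := abs_sub (bexp ρ (fun η => W η * f η)
      - bexp ρ (fun η => (G0 * ∑ x, cocc ρ η x ^ 2) * f η))
    ((n : ℝ) ^ 2 / 4 * ∑ x, ∑ y ∈ neighbors x,
          bexp ρ (fun η => (Q (exchange η x y) - Q η) * f η))
  rw [abs_mul, abs_of_nonneg (by positivity : (0 : ℝ) ≤ (n : ℝ) ^ 2 / 4)] at h5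
  linarith

end Correlation

/-! ### Entropy production -/

/-- This is log t ≤ t − 1 at t = √(v/u), multiplied by 2u: the right-hand side equals 2√(uv) − 2u.
-/
theorem mul_log_sub_log_le {u v : ℝ} (hu : 0 < u) (hv : 0 < v) :
    u * (Real.log v - Real.log u) ≤ (v - u) - (√v - √u) ^ 2 := by
  obtain ⟨A, hA, rfl⟩ : ∃ A : ℝ, 0 < A ∧ u = A ^ 2 :=
    ⟨√u, Real.sqrt_pos.2 hu, (Real.sq_sqrt hu.le).symm⟩
  obtain ⟨B, hB, rfl⟩ : ∃ B : ℝ, 0 < B ∧ v = B ^ 2 :=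
    ⟨√v, Real.sqrt_pos.2 hv, (Real.sq_sqrt hv.le).symm⟩
  rw [Real.sqrt_sq hA.le, Real.sqrt_sq hB.le, Real.log_pow, Real.log_pow]
  have h := Real.log_le_sub_one_of_pos (div_pos hB hA)
  rw [Real.log_div hB.ne' hA.ne'] at h
  have h2 := mul_le_mul_of_nonneg_left h (by positivity : 0 ≤ 2 * A ^ 2)
  have h3 : 2 * A ^ 2 * (B / A - 1) = 2 * A * B - 2 * A ^ 2 := by field_simp
  push_cast
  nlinarith

section

variable {d n : ℕ} [NeZero n]

theorem sum_occ_flipAt (x : Torus d n) (η : Config (Torus d n)) :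
    ∑ y ∈ neighbors x, occ (flipAt η x) y = ∑ y ∈ neighbors x, occ η y :=
  Finset.sum_congr rfl fun y hy => by
    simp [occ, flipAt, Function.update_of_ne (ne_of_mem_neighbors hy).symm]

/-- Move the flip onto the weight. The resulting factor at x is affine in the neighbour sum, and
F(ρ) = 0, solved for b, makes it vanish when every neighbour has density ρ; what remains is the
product of centred variables. -/
theorem bexp_flipRate (hd : 1 ≤ d) (hn : 3 ≤ n) {a b lam ρ : ℝ} (h0 : 0 < ρ)
    (hρ : reaction a b lam ρ = 0) (f : Config (Torus d n) → ℝ) (x : Torus d n) :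
    bexp ρ (fun η => flipRate a b lam x η * (f (flipAt η x) - f η))
      = lam / (2 * d * ρ) * bexp ρ (fun η => (cocc ρ η x * ∑ y ∈ neighbors x, cocc ρ η y) * f η) := by
  have hd' : (d : ℝ) ≠ 0 := Nat.cast_ne_zero.2 (by omega)
  have e1 : bexp ρ (fun η => flipRate a b lam x η * (f (flipAt η x) - f η))
      = ∑ η, (bweight ρ (flipAt η x) * flipRate a b lam x (flipAt η x)
          - bweight ρ η * flipRate a b lam x η) * f η := by
    have : ∑ η, bweight ρ η * flipRate a b lam x η * f (flipAt η x)
        = ∑ η, bweight ρ (flipAt η x) * flipRate a b lam x (flipAt η x) * f η := by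
      rw [← sum_flipAt x fun η => bweight ρ η * flipRate a b lam x η * f (flipAt η x)]
      simp only [flipAt_flipAt]
    simp only [sub_mul, Finset.sum_sub_distrib, ← this]
    rw [← Finset.sum_sub_distrib]
    exact Finset.sum_congr rfl fun η _ => by ring
  rw [e1, ← bexp_const_mul]
  unfold bexp
  refine Finset.sum_congr rfl fun η _ => ?_
  rw [bweight_flipAt, bweight_eq_mul ρ η x]
  unfold flipRate
  rw [sum_occ_flipAt]
  have e2 : ∑ y ∈ neighbors x, cocc ρ η y = ∑ y ∈ neighbors x, occ η y - 2 * d * ρ := by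
    simp only [cocc, Finset.sum_sub_distrib, Finset.sum_const, nsmul_eq_mul, card_neighbors hn]
  beta_reduce
  rw [e2]
  unfold reaction at hρ
  have hb : b = (a + lam * ρ) * (1 - ρ) / ρ := by
    field_simp; linarith
  generalize ∑ y ∈ neighbors x, occ η y = s
  generalize (∏ y ∈ Finset.univ.erase x, if η y = true then ρ else 1 - ρ) = P
  rw [hb]
  cases h : η x
  · simp [cocc, occ, flipAt, h]
    field_simp
    ring
  · simp [cocc, occ, flipAt, h]
    field_simp
    ring

/-- Stationarity is tested against log f, and `mul_log_sub_log_le` splits each jump into an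
increment of f minus a Dirichlet term. Increments under exchanges have mean zero by invariance of ν;
those under flips give the correlation term. -/
theorem entropy_production (hd : 1 ≤ d) (hn : 3 ≤ n) {a b lam ρ : ℝ} (h0 : 0 < ρ) (h1 : ρ < 1)
    (hρ : reaction a b lam ρ = 0) {f : Config (Torus d n) → ℝ} (hf : ∀ η, 0 < f η)
    (hinv : ∀ g, bexp ρ (fun η => f η * generator a b lam g η) = 0) {m : ℝ} (hm : 0 ≤ m)
    (hrate : ∀ x (η : Config (Torus d n)), m ≤ flipRate a b lam x η) :
    (n : ℝ) ^ 2 / 2 * exchForm ρ f + m * ∑ x, flipForm ρ f x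
      ≤ lam / (2 * d * ρ) * bexp ρ (fun η => nbrCorr ρ η * f η) := by
  have hpt : ∀ η, f η * generator a b lam (fun ζ => Real.log (f ζ)) η
      ≤ (n : ℝ) ^ 2 / 2 * ∑ x, ∑ y ∈ neighbors x,
          (f (exchange η x y) - f η - (√(f (exchange η x y)) - √(f η)) ^ 2)
        + ∑ x, (flipRate a b lam x η * (f (flipAt η x) - f η)
            - m * (√(f (flipAt η x)) - √(f η)) ^ 2) := by
    intro η
    unfold generator
    rw [mul_add]
    refine add_le_add ?_ ?_
    · have : f η * ((n : ℝ) ^ 2 * (1 / 2 * ∑ x, ∑ y ∈ neighbors x,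
          (Real.log (f (exchange η x y)) - Real.log (f η))))
          = (n : ℝ) ^ 2 / 2 * ∑ x, ∑ y ∈ neighbors x,
            f η * (Real.log (f (exchange η x y)) - Real.log (f η)) := by
        simp only [← Finset.mul_sum]; ring
      rw [this]
      exact mul_le_mul_of_nonneg_left (Finset.sum_le_sum fun x _ => Finset.sum_le_sum fun y _ =>
        mul_log_sub_log_le (hf _) (hf _)) (by positivity)
    · rw [Finset.mul_sum]
      refine Finset.sum_le_sum fun x _ => ?_
      have h2 := mul_le_mul_of_nonneg_left (mul_log_sub_log_le (hf η) (hf (flipAt η x)))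
        (hm.trans (hrate x η))
      have h3 := mul_le_mul_of_nonneg_right (hrate x η)
        (sq_nonneg (√(f (flipAt η x)) - √(f η)))
      nlinarith
  have h2 := bexp_mono h0 h1 hpt
  rw [hinv, bexp_add, bexp_const_mul, bexp_sum, bexp_sum] at h2
  simp only [bexp_sum, bexp_sub, bexp_const_mul, bexp_exchange] at h2
  have h3 : ∑ x : Torus d n, bexp ρ (fun η => flipRate a b lam x η * (f (flipAt η x) - f η))
      = lam / (2 * d * ρ) * bexp ρ (fun η => nbrCorr ρ η * f η) := by
    simp only [bexp_flipRate hd hn h0 hρ, ← Finset.mul_sum, nbrCorr, Finset.sum_mul, bexp_sum]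
  simp only [Finset.sum_sub_distrib, h3, ← Finset.mul_sum] at h2
  unfold exchForm flipForm
  simp only [sub_self, zero_sub] at h2
  linarith

theorem le_flipRate {a b lam : ℝ} (hlam : |lam| ≤ a / 2) (x : Torus d n)
    (η : Config (Torus d n)) : min (a / 2) b ≤ flipRate a b lam x η := by
  have hs0 : 0 ≤ ∑ y ∈ neighbors x, occ η y := Finset.sum_nonneg fun y _ => occ_nonneg η y
  have hs1 : ∑ y ∈ neighbors x, occ η y ≤ 2 * d := by
    calc ∑ y ∈ neighbors x, occ η y ≤ ∑ y ∈ neighbors x, (1 : ℝ) :=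
          Finset.sum_le_sum fun y _ => occ_le_one η y
      _ = ((neighbors x).card : ℝ) := by simp
      _ ≤ ((2 * d : ℕ) : ℝ) := by exact_mod_cast card_neighbors_le x
      _ = 2 * d := by push_cast; ring
  have key : a / 2 ≤ a + lam / (2 * d) * ∑ y ∈ neighbors x, occ η y := by
    generalize (∑ y ∈ neighbors x, occ η y) = s at hs0 hs1
    have ht0 : 0 ≤ s / (2 * d) := by positivity
    have ht1 : s / (2 * d) ≤ 1 := div_le_one_of_le₀ hs1 (by positivity)
    have e : lam / (2 * d) * s = lam * (s / (2 * d)) := by ring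
    have h2 : |lam * (s / (2 * d))| ≤ a / 2 := by
      rw [abs_mul, abs_of_nonneg ht0]
      exact (mul_le_of_le_one_right (abs_nonneg _) ht1).trans hlam
    rw [e]
    linarith [neg_abs_le (lam * (s / (2 * d)))]
  unfold flipRate
  cases h : η x
  · simpa [occ, h] using Or.inl key
  · simp [occ, h]

end

/-! ### The entropy of the stationary state -/

/-- For |λ| ≤ a/2 the birth factor a + λρ is at least a/2, so F(ρ) = 0 gives (a/2)(1 − ρ) ≤ bρ. The
lower bound is uniform in λ, so λ/ρ is small when λ is. -/
theorem rhoStar_bounds {a b lam : ℝ} (ha : 0 < a) (hb : 0 < b) (hlam : |lam| ≤ a / 2) :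
    a / (a + 2 * b) ≤ rhoStar ha hb lam ∧ (rhoStar ha hb lam : ℝ) < 1 := by
  have h := reaction_rhoStar ha hb lam
  have hr0 := (rhoStar ha hb lam).2.1
  have hr1 := (rhoStar ha hb lam).2.2
  generalize (rhoStar ha hb lam : ℝ) = r at h hr0 hr1
  unfold reaction at h
  constructor
  · rw [div_le_iff₀ (by positivity)]
    have h2 : |lam * r| ≤ a / 2 := by
      rw [abs_mul, abs_of_nonneg hr0]
      exact (mul_le_of_le_one_right (abs_nonneg _) hr1).trans hlam
    have h3 := neg_abs_le (lam * r)
    have h4 : a / 2 * (1 - r) ≤ (a + lam * r) * (1 - r) :=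
      mul_le_mul_of_nonneg_right (by linarith) (by linarith)
    nlinarith
  · rcases hr1.eq_or_lt with rfl | h2
    · linarith
    · exact h2

/-- The density of the stationary state with respect to the Bernoulli measure. -/
noncomputable def nessDensity {a b lam : ℝ} (ha : 0 < a) (hb : 0 < b) (hlam : -a < lam) (d n : ℕ)
    [NeZero n] (η : Config (Torus d n)) : ℝ :=
  (ness ha hb hlam d n).real {η} / bweight (rhoStar ha hb lam : ℝ) η

section Ness

variable {a b lam : ℝ} (ha : 0 < a) (hb : 0 < b) (hlam : -a < lam) (d n : ℕ) [NeZero n]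

theorem ness_sum_generator (g : Config (Torus d n) → ℝ) :
    ∑ η, (ness ha hb hlam d n).real {η} * generator a b lam g η = 0 := by
  obtain ⟨hp, hi⟩ := ness_isInvariant ha hb hlam d n
  have h := hi g
  rw [integral_fintype Integrable.of_finite] at h
  simpa only [smul_eq_mul] using h

theorem ness_sum_eq_one : ∑ η, (ness ha hb hlam d n).real {η} = 1 := by
  have := (ness_isInvariant ha hb hlam d n).1
  simp

/-- By irreducibility an invariant weight with a zero vanishes identically. Positivity is what
allows log f as a test function. -/
theorem ness_real_pos (η : Config (Torus d n)) : 0 < (ness ha hb hlam d n).real {η} := by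
  refine lt_of_le_of_ne measureReal_nonneg fun h => ?_
  have h2 := weight_eq_zero ha hb hlam (fun η => (ness ha hb hlam d n).real {η})
    (fun η => measureReal_nonneg) (ness_sum_generator ha hb hlam d n) η h.symm
  have h3 := ness_sum_eq_one ha hb hlam d n
  simp only [funext_iff, Pi.zero_apply] at h2
  simp [h2] at h3

theorem bexp_nessDensity (hr0 : 0 < (rhoStar ha hb lam : ℝ)) (hr1 : (rhoStar ha hb lam : ℝ) < 1)
    (g : Config (Torus d n) → ℝ) :
    bexp (rhoStar ha hb lam : ℝ) (fun η => g η * nessDensity ha hb hlam d n η)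
      = ∑ η, (ness ha hb hlam d n).real {η} * g η := by
  refine Finset.sum_congr rfl fun η _ => ?_
  have := (bweight_pos hr0 hr1 η).ne'
  unfold nessDensity
  field_simp

theorem nessDensity_pos (hr0 : 0 < (rhoStar ha hb lam : ℝ)) (hr1 : (rhoStar ha hb lam : ℝ) < 1)
    (η : Config (Torus d n)) : 0 < nessDensity ha hb hlam d n η :=
  div_pos (ness_real_pos ha hb hlam d n η) (bweight_pos hr0 hr1 η)

theorem bexp_nessDensity_eq_one (hr0 : 0 < (rhoStar ha hb lam : ℝ)) (hr1 : (rhoStar ha hb lam : ℝ) < 1) :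
    bexp (rhoStar ha hb lam : ℝ) (nessDensity ha hb hlam d n) = 1 := by
  have := bexp_nessDensity ha hb hlam d n hr0 hr1 fun _ => 1
  simpa [ness_sum_eq_one] using this

end Ness

/-- The relative entropy of the stationary state with respect to the Bernoulli measure. -/
noncomputable def nessEntropy {a b lam : ℝ} (ha : 0 < a) (hb : 0 < b) (hlam : -a < lam) (d n : ℕ)
    [NeZero n] : ℝ :=
  bexp (rhoStar ha hb lam : ℝ) fun η : Config (Torus d n) =>
    nessDensity ha hb hlam d n η * Real.log (nessDensity ha hb hlam d n η)

/-- For small `λ` the relative entropy is of the order of the trace of the resolvent. -/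
theorem nessEntropy_le {d : ℕ} (hd : 1 ≤ d) {a b : ℝ} (ha : 0 < a) (hb : 0 < b) :
    ∃ lamc : ℝ, 0 < lamc ∧ lamc ≤ a / 2 ∧ ∀ (lam : ℝ) (hlam : -a < lam), |lam| ≤ lamc →
      ∀ (n : ℕ) [NeZero n], 3 ≤ n → resolventKernel (0 : Torus d n) ≤ 1 / 2 →
        nessEntropy ha hb hlam d n ≤ 28 / min (a / 2) b *
          ((n : ℝ) ^ d * (resolventKernel (0 : Torus d n) + 1 / (n : ℝ) ^ 2)) := by
  set m := min (a / 2) b with hm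
  have hmp : 0 < m := lt_min (by positivity) hb
  set r := a / (a + 2 * b) with hr
  have hrp : 0 < r := by positivity
  -- The choice makes κ = 2|λ|/ρ at most 4 and m/10: then κ n²/8 ≤ n²/2 absorbs the exclusion form,
  -- and 5κ ≤ m/2 absorbs the flip form.
  refine ⟨min (a / 2) (r * min 4 (m / 10) / 2), lt_min (by positivity) ?_, min_le_left _ _, ?_⟩
  · have : 0 < min 4 (m / 10) := lt_min (by norm_num) (by positivity)
    positivity
  intro lam hlam hl n _ hn hG
  have hl1 : |lam| ≤ a / 2 := hl.trans (min_le_left _ _)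
  have hl2 : |lam| ≤ r * min 4 (m / 10) / 2 := hl.trans (min_le_right _ _)
  obtain ⟨hρr, h1⟩ := rhoStar_bounds ha hb hl1
  have h0 : 0 < (rhoStar ha hb lam : ℝ) := hrp.trans_le hρr
  have hf := nessDensity_pos ha hb hlam d n h0 h1
  have hf1 := bexp_nessDensity_eq_one ha hb hlam d n h0 h1
  have hprod := entropy_production hd hn h0 h1 (reaction_rhoStar ha hb lam) hf
    (fun g => by
      simp only [mul_comm (nessDensity _ _ _ _ _ _)]
      rw [bexp_nessDensity ha hb hlam d n h0 h1]
      exact ness_sum_generator ha hb hlam d n g) hmp.le (le_flipRate hl1)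
  have hcorr := abs_bexp_nbrCorr_le hd hn h0 h1 hf hf1
  have hls := logSobolev h0 h1 hf hf1
  have hent := entropy_inequality h0 h1 hf hf1
    fun η => cocc (rhoStar ha hb lam : ℝ) η ⬝ᵥ Matrix.mulVec (resolvent d n)
      (cocc (rhoStar ha hb lam : ℝ) η)
  have hmom := bexp_exp_quadratic_le h0 h1 resolvent_isHermitian
    (resolvent_quadratic_nonneg (d := d) hn) (resolvent_quadratic_le hn)
  have hexpos : 0 < bexp (rhoStar ha hb lam : ℝ) fun η : Config (Torus d n) =>
      Real.exp (cocc (rhoStar ha hb lam : ℝ) η ⬝ᵥ Matrix.mulVec (resolvent d n)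
        (cocc (rhoStar ha hb lam : ℝ) η)) :=
    Finset.sum_pos (fun η _ => mul_pos (bweight_pos h0 h1 η) (Real.exp_pos _))
      Finset.univ_nonempty
  have hlog := Real.log_le_log hexpos hmom
  rw [Real.log_exp, trace_resolvent] at hlog
  change nessEntropy ha hb hlam d n ≤ _ at hls
  change _ ≤ nessEntropy ha hb hlam d n + _ at hent
  have hDx : 0 ≤ exchForm (rhoStar ha hb lam : ℝ) (nessDensity ha hb hlam d n) :=
    Finset.sum_nonneg fun x _ => Finset.sum_nonneg fun y _ =>
      bexp_nonneg h0 h1 fun η => sq_nonneg _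
  generalize bexp (rhoStar ha hb lam : ℝ) (fun η => nbrCorr (rhoStar ha hb lam : ℝ) η
    * nessDensity ha hb hlam d n η) = X at hprod hcorr
  generalize bexp (rhoStar ha hb lam : ℝ) (fun η => (cocc (rhoStar ha hb lam : ℝ) η ⬝ᵥ
    Matrix.mulVec (resolvent d n) (cocc (rhoStar ha hb lam : ℝ) η))
      * nessDensity ha hb hlam d n η) = W at hcorr hent
  generalize ∑ x, flipForm (rhoStar ha hb lam : ℝ) (nessDensity ha hb hlam d n) x = F at hprod hls
  generalize exchForm (rhoStar ha hb lam : ℝ) (nessDensity ha hb hlam d n) = D at hprod hcorr hDx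
  generalize nessEntropy ha hb hlam d n = H at hls hent ⊢
  have hG0 := resolventKernel_zero_nonneg (d := d) (n := n)
  generalize resolventKernel (0 : Torus d n) = G at hG hcorr hlog hG0 ⊢
  generalize (rhoStar ha hb lam : ℝ) = ρ at *
  have hd' : (1 : ℝ) ≤ d := by exact_mod_cast hd
  have hn' : (0 : ℝ) < n := Nat.cast_pos.2 (by omega)
  set B := (n : ℝ) ^ 2 / 8 * D + 5 * W + (n : ℝ) ^ d * (G + 2 / (n : ℝ) ^ 2) with hB
  -- The assumption G ≤ 1/2 keeps the prefactor 1 − G of the correlation term at least 1/2.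
  have hX : |X| / (2 * d) ≤ 2 * B := by
    have e : (1 - G) / (2 * d) * |X| = (1 - G) * (|X| / (2 * d)) := by ring
    rw [e] at hcorr
    have : 0 ≤ |X| / (2 * d) := by positivity
    nlinarith
  have hB0 : 0 ≤ B := by
    have : 0 ≤ |X| / (2 * d) := by positivity
    linarith
  set κ := 2 * |lam| / ρ with hκ
  have hκ0 : 0 ≤ κ := by positivity
  have hκ1 : κ ≤ min 4 (m / 10) := by
    rw [hκ, div_le_iff₀ h0]
    have : 0 < min 4 (m / 10) := lt_min (by norm_num) (by positivity)
    nlinarith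
  have hκ4 : κ ≤ 4 := hκ1.trans (min_le_left _ _)
  have hκm : κ ≤ m / 10 := hκ1.trans (min_le_right _ _)
  have hV : lam / (2 * d * ρ) * X ≤ κ * B := by
    have h2 : lam / (2 * d * ρ) * X ≤ |lam / (2 * d * ρ) * X| := le_abs_self _
    have h3 : |lam / (2 * d * ρ) * X| = |lam| / ρ * (|X| / (2 * d)) := by
      rw [abs_mul, abs_div, abs_of_pos (by positivity : 0 < 2 * d * ρ)]
      field_simp
    have h4 : |lam| / ρ * (|X| / (2 * d)) ≤ |lam| / ρ * (2 * B) :=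
      mul_le_mul_of_nonneg_left hX (by positivity)
    have h5 : |lam| / ρ * (2 * B) = κ * B := by rw [hκ]; ring
    linarith
  have hN : 0 ≤ (n : ℝ) ^ d * G := by positivity
  have hN2 : 0 ≤ (n : ℝ) ^ d * (1 / (n : ℝ) ^ 2) := by positivity
  -- Entropy inequality, exponential moment and logarithmic Sobolev inequality combined.
  have hWle : W ≤ F + (n : ℝ) ^ d * G / 2 := by linarith
  have hB2 : B ≤ (n : ℝ) ^ 2 / 8 * D + 5 * F
      + (7 / 2 * ((n : ℝ) ^ d * G) + 2 * ((n : ℝ) ^ d * (1 / (n : ℝ) ^ 2))) := by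
    have : (n : ℝ) ^ d * (G + 2 / (n : ℝ) ^ 2)
        = (n : ℝ) ^ d * G + 2 * ((n : ℝ) ^ d * (1 / (n : ℝ) ^ 2)) := by ring
    rw [hB, this]
    linarith
  set T := 7 / 2 * ((n : ℝ) ^ d * G) + 2 * ((n : ℝ) ^ d * (1 / (n : ℝ) ^ 2)) with hT
  have hT0 : 0 ≤ T := by positivity
  have hκB := mul_le_mul_of_nonneg_left hB2 hκ0
  have hD1 : κ * ((n : ℝ) ^ 2 / 8 * D) ≤ 4 * ((n : ℝ) ^ 2 / 8 * D) :=
    mul_le_mul_of_nonneg_right hκ4 (by positivity)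
  have hT1 : κ * T ≤ 4 * T := mul_le_mul_of_nonneg_right hκ4 hT0
  have hmain : m * F ≤ 5 * (κ * F) + 4 * T := by
    have e : κ * ((n : ℝ) ^ 2 / 8 * D + 5 * F + T)
        = κ * ((n : ℝ) ^ 2 / 8 * D) + 5 * (κ * F) + κ * T := by ring
    linarith
  rcases le_or_gt F 0 with hF | hF
  · refine hls.trans (hF.trans ?_)
    positivity
  -- Half of m F is absorbed, leaving m F ≤ 8T; the largest coefficient of 8T is 8 · 7/2 = 28.
  · have hF1 : κ * F ≤ m / 10 * F := mul_le_mul_of_nonneg_right hκm hF.le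
    have hF2 : m * F ≤ 8 * T := by linarith
    have hF3 : F ≤ 8 * T / m := by
      rw [le_div_iff₀ hmp]; linarith
    refine hls.trans (hF3.trans ?_)
    rw [div_mul_eq_mul_div]
    apply div_le_div_of_nonneg_right _ hmp.le
    rw [hT, mul_add ((n : ℝ) ^ d)]
    linarith

/-! ### The diagonal of the resolvent -/

section Lattice

variable {n : ℕ} [NeZero n]

/-- For the representative z of `c` nearest to zero the angle 2πz/n lies in [−π, π], where cos θ ≤ 1
− 2θ²/π². -/
theorem le_symbol_coord (c : ZMod n) :
    16 * ((c.valMinAbs.natAbs : ℝ)) ^ 2 / (n : ℝ) ^ 2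
      ≤ 2 - 2 * (ZMod.stdAddChar c : ℂ).re := by
  have hn : (0 : ℝ) < n := Nat.cast_pos.2 (NeZero.pos n)
  set z : ℤ := c.valMinAbs with hz
  have hcz : (z : ZMod n) = c := ZMod.coe_valMinAbs c
  have hre : (ZMod.stdAddChar c : ℂ).re = Real.cos (2 * Real.pi * z / n) := by
    rw [← hcz, ZMod.stdAddChar_coe]
    have : (2 * Real.pi * Complex.I * z / n : ℂ) = ((2 * Real.pi * z / n : ℝ) : ℂ) * Complex.I := by
      push_cast; ring
    rw [this, Complex.exp_ofReal_mul_I_re]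
  have habs : |2 * Real.pi * z / n| ≤ Real.pi := by
    have h1 : 2 * (z.natAbs : ℝ) ≤ n := by
      have := ZMod.natAbs_valMinAbs_le c
      have h2 : 2 * z.natAbs ≤ n := by omega
      exact_mod_cast h2
    rw [Nat.cast_natAbs, Int.cast_abs] at h1
    rw [abs_div, abs_mul, abs_of_pos hn, abs_of_pos (by positivity : (0 : ℝ) < 2 * Real.pi),
      div_le_iff₀ hn]
    nlinarith [Real.pi_pos]
  have := Real.cos_le_one_sub_mul_cos_sq habs
  rw [hre]
  have e : 2 / Real.pi ^ 2 * (2 * Real.pi * z / n) ^ 2 = 8 * (z.natAbs : ℝ) ^ 2 / (n : ℝ) ^ 2 := by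
    rw [Nat.cast_natAbs, Int.cast_abs, sq_abs]
    field_simp
    ring
  have e2 : 16 * ((z.natAbs : ℝ)) ^ 2 / (n : ℝ) ^ 2 = 2 * (8 * (z.natAbs : ℝ) ^ 2 / (n : ℝ) ^ 2) := by
    ring
  linarith

theorem le_symbol {d : ℕ} (k : Torus d n) (i : Fin d) :
    ((k i).valMinAbs.natAbs : ℝ) ^ 2 ≤ (n : ℝ) ^ 2 * symbol k := by
  have hn : (0 : ℝ) < n := Nat.cast_pos.2 (NeZero.pos n)
  have h1 : 16 * ((k i).valMinAbs.natAbs : ℝ) ^ 2 / (n : ℝ) ^ 2 ≤ symbol k := by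
    refine (le_symbol_coord (k i)).trans ?_
    refine Finset.single_le_sum (f := fun j => 2 - 2 * (ZMod.stdAddChar (k j) : ℂ).re)
      (fun j _ => ?_) (Finset.mem_univ i)
    have := Complex.re_le_norm (ZMod.stdAddChar (k j) : ℂ)
    rw [norm_stdAddChar] at this
    linarith
  rw [div_le_iff₀ (by positivity)] at h1
  nlinarith [sq_nonneg ((k i).valMinAbs.natAbs : ℝ)]

theorem card_valMinAbs_le (m : ℕ) :
    (Finset.univ.filter fun c : ZMod n => c.valMinAbs.natAbs ≤ m).card ≤ 2 * m + 1 := by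
  have h : (Finset.univ.filter fun c : ZMod n => c.valMinAbs.natAbs ≤ m).card
      ≤ (Finset.Icc (-(m : ℤ)) m).card := by
    refine Finset.card_le_card_of_injOn ZMod.valMinAbs (fun c hc => ?_)
      ZMod.injective_valMinAbs.injOn
    simp only [Finset.coe_filter, Finset.mem_univ, true_and, Set.mem_ofPred_eq] at hc
    simp only [Finset.coe_Icc, Set.mem_Icc]
    omega
  rw [Int.card_Icc] at h
  omega

/-- The distance of a residue to zero is the standard representative of `c` or of `-c`, and each
family of representatives runs once through 0, …, n − 1. -/
theorem sum_valMinAbs_le (h : ℕ → ℝ) (hh : ∀ m, 0 ≤ h m) :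
    ∑ c : ZMod n, h c.valMinAbs.natAbs ≤ 2 * ∑ m ∈ Finset.range n, h m := by
  have hval : ∑ c : ZMod n, h c.val = ∑ m ∈ Finset.range n, h m := by
    refine Finset.sum_bij (fun c _ => c.val) (fun c _ => Finset.mem_range.2 (ZMod.val_lt c))
      (fun c _ c' _ e => ZMod.val_injective n e) (fun m hm => ?_) fun _ _ => rfl
    exact ⟨(m : ZMod n), Finset.mem_univ _, ZMod.val_cast_of_lt (Finset.mem_range.1 hm)⟩
  have hneg : ∑ c : ZMod n, h (-c).val = ∑ c : ZMod n, h c.val :=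
    Equiv.sum_comp (Equiv.neg (ZMod n)) fun c => h c.val
  have hpt : ∀ c : ZMod n, h c.valMinAbs.natAbs ≤ h c.val + h (-c).val := by
    intro c
    rw [ZMod.valMinAbs_natAbs_eq_min]
    rcases eq_or_ne c 0 with rfl | hc
    · simpa using hh 0
    · have : NeZero c := ⟨hc⟩
      rw [ZMod.val_neg_of_ne_zero]
      rcases min_choice c.val (n - c.val) with e | e <;> rw [e]
      · linarith [hh (n - c.val)]
      · linarith [hh c.val]
  refine (Finset.sum_le_sum fun c _ => hpt c).trans (le_of_eq ?_)
  rw [Finset.sum_add_distrib, hneg, hval]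
  ring

/-- Sort the frequencies by a coordinate i of largest absolute value and its value c: the symbol
then exceeds a multiple of c²/n², and each of the other d − 1 coordinates has at most 2|c| + 1
values. -/
theorem sum_inv_one_add_symbol_le {d : ℕ} (hd : 1 ≤ d) :
    ∑ k : Torus d n, 1 / (1 + (n : ℝ) ^ 2 * symbol k)
      ≤ 2 * (d : ℝ) * ∑ m ∈ Finset.range n, (2 * (m : ℝ) + 1) ^ (d - 1) / (1 + (m : ℝ) ^ 2) := by
  classical
  have : Nonempty (Fin d) := ⟨⟨0, hd⟩⟩
  let A : Fin d → ZMod n → Finset (Torus d n) := fun i c =>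
    Finset.univ.filter fun k => k i = c ∧ ∀ j, (k j).valMinAbs.natAbs ≤ c.valMinAbs.natAbs
  have hcard : ∀ i c, ((A i c).card : ℝ) ≤ (2 * (c.valMinAbs.natAbs : ℝ) + 1) ^ (d - 1) := by
    intro i c
    have hsub : A i c ⊆ Fintype.piFinset fun j => if j = i then {c} else
        Finset.univ.filter fun e : ZMod n => e.valMinAbs.natAbs ≤ c.valMinAbs.natAbs := by
      intro k hk
      simp only [A, Finset.mem_filter, Finset.mem_univ, true_and] at hk
      rw [Fintype.mem_piFinset]
      intro j
      split_ifs with hj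
      · subst hj; simpa using hk.1
      · simpa using hk.2 j
    have h1 := Finset.card_le_card hsub
    rw [Fintype.card_piFinset, ← Finset.mul_prod_erase _ _ (Finset.mem_univ i)] at h1
    have h2 : ∏ j ∈ Finset.univ.erase i, (if j = i then ({c} : Finset (ZMod n)) else
        Finset.univ.filter fun e : ZMod n => e.valMinAbs.natAbs ≤ c.valMinAbs.natAbs).card
        ≤ (2 * c.valMinAbs.natAbs + 1) ^ (d - 1) := by
      refine (Finset.prod_le_pow_card _ _ (2 * c.valMinAbs.natAbs + 1) fun j hj => ?_).trans
        (le_of_eq ?_)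
      · rw [if_neg (Finset.ne_of_mem_erase hj)]
        exact card_valMinAbs_le _
      · rw [Finset.card_erase_of_mem (Finset.mem_univ i)]; simp
    simp only [if_true, Finset.card_singleton, one_mul] at h1
    exact_mod_cast h1.trans h2
  have hpt : ∀ k : Torus d n, 1 / (1 + (n : ℝ) ^ 2 * symbol k)
      ≤ ∑ i, ∑ c : ZMod n, if k ∈ A i c then 1 / (1 + (c.valMinAbs.natAbs : ℝ) ^ 2) else 0 := by
    intro k
    obtain ⟨i, -, hi⟩ := Finset.exists_max_image Finset.univ
      (fun j => (k j).valMinAbs.natAbs) Finset.univ_nonempty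
    have hnn : ∀ i (c : ZMod n),
        0 ≤ if k ∈ A i c then 1 / (1 + (c.valMinAbs.natAbs : ℝ) ^ 2) else 0 := by
      intro i c; split_ifs <;> positivity
    refine le_trans ?_ (Finset.single_le_sum
      (f := fun i => ∑ c : ZMod n, if k ∈ A i c then 1 / (1 + (c.valMinAbs.natAbs : ℝ) ^ 2) else 0)
      (fun i _ => Finset.sum_nonneg fun c _ => hnn i c) (Finset.mem_univ i))
    refine le_trans ?_ (Finset.single_le_sum (f := fun c : ZMod n =>
      if k ∈ A i c then 1 / (1 + (c.valMinAbs.natAbs : ℝ) ^ 2) else 0)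
      (fun c _ => hnn i c) (Finset.mem_univ (k i)))
    have hmem : k ∈ A i (k i) := by
      simp only [A, Finset.mem_filter, Finset.mem_univ, true_and]
      exact fun j => hi j (Finset.mem_univ j)
    rw [if_pos hmem]
    exact one_div_le_one_div_of_le (by positivity) (by linarith [le_symbol k i])
  calc ∑ k : Torus d n, 1 / (1 + (n : ℝ) ^ 2 * symbol k)
      ≤ ∑ k : Torus d n, ∑ i, ∑ c : ZMod n,
          if k ∈ A i c then 1 / (1 + (c.valMinAbs.natAbs : ℝ) ^ 2) else 0 :=
        Finset.sum_le_sum fun k _ => hpt k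
    _ = ∑ i, ∑ c : ZMod n, ((A i c).card : ℝ) * (1 / (1 + (c.valMinAbs.natAbs : ℝ) ^ 2)) := by
        rw [Finset.sum_comm]
        refine Finset.sum_congr rfl fun i _ => ?_
        rw [Finset.sum_comm]
        refine Finset.sum_congr rfl fun c _ => ?_
        rw [← Finset.sum_filter, Finset.sum_const, nsmul_eq_mul]
        simp
    _ ≤ ∑ i : Fin d, ∑ c : ZMod n, (2 * (c.valMinAbs.natAbs : ℝ) + 1) ^ (d - 1)
          / (1 + (c.valMinAbs.natAbs : ℝ) ^ 2) := by
        refine Finset.sum_le_sum fun i _ => Finset.sum_le_sum fun c _ => ?_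
        rw [mul_one_div]
        exact div_le_div_of_nonneg_right (hcard i c) (by positivity)
    _ ≤ ∑ i : Fin d, 2 * ∑ m ∈ Finset.range n, (2 * (m : ℝ) + 1) ^ (d - 1) / (1 + (m : ℝ) ^ 2) :=
        Finset.sum_le_sum fun i _ => sum_valMinAbs_le
          (fun m => (2 * (m : ℝ) + 1) ^ (d - 1) / (1 + (m : ℝ) ^ 2)) fun m => by positivity
    _ = _ := by
        rw [Finset.sum_const, Finset.card_univ, Fintype.card_fin, nsmul_eq_mul]; ring

end Lattice

/-! ### Growth of the lattice sum in each dimension -/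

theorem sum_one_div_one_add_sq_le {n : ℕ} (hn : 1 ≤ n) :
    ∑ m ∈ Finset.range n, 1 / (1 + (m : ℝ) ^ 2) ≤ 3 - 2 / (n : ℝ) := by
  induction n, hn using Nat.le_induction with
  | base => norm_num
  | succ n hn ih =>
    rw [Finset.sum_range_succ]
    have hn' : (1 : ℝ) ≤ n := by exact_mod_cast hn
    have : 1 / (1 + (n : ℝ) ^ 2) ≤ 2 / (n : ℝ) - 2 / ((n : ℝ) + 1) := by
      rw [div_sub_div _ _ (by positivity) (by positivity), div_le_div_iff₀ (by positivity)
        (by positivity)]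
      nlinarith
    push_cast
    linarith

theorem one_le_log {n : ℕ} (hn : 3 ≤ n) : 1 ≤ Real.log n := by
  rw [Real.le_log_iff_exp_le (by positivity)]
  have : (3 : ℝ) ≤ n := by exact_mod_cast hn
  linarith [Real.exp_one_lt_d9]

theorem one_le_green {d n : ℕ} (hn : 3 ≤ n) : 1 ≤ green d n := by
  unfold green
  split_ifs
  · exact_mod_cast (by omega : 1 ≤ n)
  · exact one_le_log hn
  · exact le_rfl

theorem green_le {d n : ℕ} (hn : 1 ≤ n) : green d n ≤ n := by
  unfold green
  split_ifs
  · exact le_rfl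
  · exact Real.log_le_self (Nat.cast_nonneg n)
  · exact_mod_cast hn

/-- The summand behaves like m^(d−3): a convergent series for d = 1, the harmonic sum for d = 2, and
at most a constant times n^(d−3) per term for d ≥ 3. -/
theorem lattice_sum_le {d n : ℕ} (hd : 1 ≤ d) (hn : 3 ≤ n) :
    ∑ m ∈ Finset.range n, (2 * (m : ℝ) + 1) ^ (d - 1) / (1 + (m : ℝ) ^ 2)
      ≤ 8 * 2 ^ d * ((n : ℝ) ^ d * green d n / (n : ℝ) ^ 2) := by
  have hn0 : (0 : ℝ) < n := Nat.cast_pos.2 (by omega)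
  obtain rfl | rfl | h3 : d = 1 ∨ d = 2 ∨ 3 ≤ d := by omega
  · have h := sum_one_div_one_add_sq_le (by omega : 1 ≤ n)
    have e : (n : ℝ) ^ 1 * green 1 n / (n : ℝ) ^ 2 = 1 := by
      simp only [green, if_true]; field_simp
    rw [e]
    simp only [Nat.sub_self, pow_zero]
    have : 0 < 2 / (n : ℝ) := by positivity
    norm_num at h ⊢
    linarith
  · have hl := one_le_log hn
    have e : (n : ℝ) ^ 2 * green 2 n / (n : ℝ) ^ 2 = Real.log n := by
      simp only [green, if_true, OfNat.ofNat_ne_one, if_false]; field_simp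
    rw [e]
    have h1 : ∀ m ∈ Finset.range n, (2 * (m : ℝ) + 1) ^ (2 - 1) / (1 + (m : ℝ) ^ 2)
        ≤ 4 * ((m : ℝ) + 1)⁻¹ := by
      intro m _
      rw [← div_eq_mul_inv, div_le_div_iff₀ (by positivity) (by positivity)]
      norm_num
      nlinarith [sq_nonneg ((m : ℝ) - 1)]
    have h2 := harmonic_le_one_add_log n
    have h3 : ((harmonic n : ℚ) : ℝ) = ∑ m ∈ Finset.range n, ((m : ℝ) + 1)⁻¹ := by
      simp [harmonic]
    refine (Finset.sum_le_sum h1).trans ?_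
    rw [← Finset.mul_sum, ← h3]
    linarith
  · have e : (n : ℝ) ^ d * green d n / (n : ℝ) ^ 2 = n * (n : ℝ) ^ (d - 3) := by
      have hg : green d n = 1 := by
        rw [green, if_neg (by omega), if_neg (by omega)]
      have : (n : ℝ) ^ d = (n : ℝ) ^ (d - 3) * (n : ℝ) ^ 3 := by
        rw [← pow_add]; congr 1; omega
      rw [hg, this, div_eq_iff (by positivity)]
      ring
    rw [e]
    have h1 : ∀ m ∈ Finset.range n, (2 * (m : ℝ) + 1) ^ (d - 1) / (1 + (m : ℝ) ^ 2)
        ≤ 5 * (2 * (n : ℝ)) ^ (d - 3) := by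
      intro m hm
      have hm' : (m : ℝ) + 1 ≤ n := by exact_mod_cast Finset.mem_range.1 hm
      rw [div_le_iff₀ (by positivity), (by omega : d - 1 = d - 3 + 2), pow_add]
      have h2 : (2 * (m : ℝ) + 1) ^ (d - 3) ≤ (2 * (n : ℝ)) ^ (d - 3) :=
        pow_le_pow_left₀ (by positivity) (by linarith) _
      have h3 : (2 * (m : ℝ) + 1) ^ 2 ≤ 5 * (1 + (m : ℝ) ^ 2) := by
        nlinarith [sq_nonneg ((m : ℝ) - 2)]
      calc (2 * (m : ℝ) + 1) ^ (d - 3) * (2 * (m : ℝ) + 1) ^ 2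
          ≤ (2 * (n : ℝ)) ^ (d - 3) * (5 * (1 + (m : ℝ) ^ 2)) :=
            mul_le_mul h2 h3 (by positivity) (by positivity)
        _ = _ := by ring
    refine (Finset.sum_le_sum h1).trans ?_
    rw [Finset.sum_const, Finset.card_range, nsmul_eq_mul, mul_pow]
    have h4 : (2 : ℝ) ^ (d - 3) ≤ 2 ^ d := pow_le_pow_right₀ (by norm_num) (by omega)
    have h5 : 0 ≤ (n : ℝ) * (n : ℝ) ^ (d - 3) := by positivity
    have h6 : (0 : ℝ) < 2 ^ (d - 3) := by positivity
    calc (n : ℝ) * (5 * (2 ^ (d - 3) * (n : ℝ) ^ (d - 3)))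
        = 5 * 2 ^ (d - 3) * ((n : ℝ) * (n : ℝ) ^ (d - 3)) := by ring
      _ ≤ 8 * 2 ^ d * ((n : ℝ) * (n : ℝ) ^ (d - 3)) :=
          mul_le_mul_of_nonneg_right (by linarith) h5

theorem resolventKernel_zero_le_green {d n : ℕ} [NeZero n] (hd : 1 ≤ d) (hn : 3 ≤ n) :
    resolventKernel (0 : Torus d n) ≤ 16 * d * 2 ^ d * (green d n / (n : ℝ) ^ 2) := by
  have hn0 : (0 : ℝ) < n := Nat.cast_pos.2 (by omega)
  rw [resolventKernel_zero, one_div_mul_eq_div, div_le_iff₀ (by positivity)]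
  refine (sum_inv_one_add_symbol_le hd).trans ?_
  refine (mul_le_mul_of_nonneg_left (lattice_sum_le hd hn) (by positivity)).trans (le_of_eq ?_)
  ring

/-! ### Independence under the Bernoulli measure -/

section Independence

variable {S : Type} [Fintype S] [DecidableEq S]

/-- Splitting a configuration into its restrictions to A and to the complement factorises the
weight, and each function reads only one of the two parts. -/
theorem bexp_mul_of_dependsOn (ρ : ℝ) {g h : Config S → ℝ} {A B : Set S} (hg : DependsOn g A)
    (hh : DependsOn h B) (hAB : Disjoint A B) :
    bexp ρ (fun η => g η * h η) = bexp ρ g * bexp ρ h := by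
  classical
  let e := Equiv.piEquivPiSubtypeProd (fun x => x ∈ A) (fun _ : S => Bool)
  let w1 : ({x // x ∈ A} → Bool) → ℝ := fun u => ∏ x, if u x then ρ else 1 - ρ
  let w2 : ({x // x ∉ A} → Bool) → ℝ := fun v => ∏ x, if v x then ρ else 1 - ρ
  let G : ({x // x ∈ A} → Bool) → ℝ := fun u => g (e.symm (u, fun _ => false))
  let H : ({x // x ∉ A} → Bool) → ℝ := fun v => h (e.symm (fun _ => false, v))
  have hG : ∀ p, g (e.symm p) = G p.1 := fun p => hg fun x hx => by simp [e, hx]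
  have hH : ∀ p, h (e.symm p) = H p.2 := fun p => hh fun x hx => by
    have : x ∉ A := fun hxA => Set.disjoint_left.1 hAB hxA hx
    simp [e, this]
  have hw : ∀ p, bweight ρ (e.symm p) = w1 p.1 * w2 p.2 := by
    intro p
    unfold bweight
    rw [← Fintype.prod_subtype_mul_prod_subtype (fun x => x ∈ A)]
    congr 1
    · exact Finset.prod_congr rfl fun x _ => by simp [e]
    · exact Finset.prod_congr rfl fun x _ => by simp [e, x.2]
  have key : ∀ φ : Config S → ℝ, bexp ρ φ = ∑ u, ∑ v, w1 u * w2 v * φ (e.symm (u, v)) := by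
    intro φ
    unfold bexp
    rw [← Equiv.sum_comp e.symm, Fintype.sum_prod_type]
    simp only [hw]
  have hone1 : ∑ u, w1 u = 1 := by
    have := bexp_const (S := {x // x ∈ A}) ρ 1
    simpa [bexp, bweight] using this
  have hone2 : ∑ v, w2 v = 1 := by
    have := bexp_const (S := {x // x ∉ A}) ρ 1
    simpa [bexp, bweight] using this
  have eg : bexp ρ g = ∑ u, w1 u * G u := by
    rw [key]
    refine Finset.sum_congr rfl fun u _ => ?_
    simp only [hG]
    rw [← Finset.sum_mul, ← Finset.mul_sum, hone2, mul_one]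
  have eh : bexp ρ h = ∑ v, w2 v * H v := by
    rw [key, Finset.sum_comm]
    refine Finset.sum_congr rfl fun v _ => ?_
    simp only [hH]
    rw [← Finset.sum_mul, ← Finset.sum_mul, hone1, one_mul]
  rw [key, eg, eh, Finset.sum_mul_sum]
  refine Finset.sum_congr rfl fun u _ => Finset.sum_congr rfl fun v _ => ?_
  rw [hG, hH]
  ring

theorem bexp_prod_of_dependsOn {ι : Type*} (ρ : ℝ) (J : Finset ι) (g : ι → Config S → ℝ)
    (A : ι → Set S) (hg : ∀ j, DependsOn (g j) (A j))
    (hA : ∀ i j, i ≠ j → Disjoint (A i) (A j)) :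
    bexp ρ (fun η => ∏ j ∈ J, g j η) = ∏ j ∈ J, bexp ρ (g j) := by
  classical
  induction J using Finset.induction_on with
  | empty => simpa using bexp_const (S := S) ρ 1
  | insert i J hi ih =>
    simp only [Finset.prod_insert hi]
    rw [← ih]
    refine bexp_mul_of_dependsOn ρ (B := ⋃ j ∈ J, A j) (hg i) ?_ ?_
    · intro η ζ h
      exact Finset.prod_congr rfl fun j hj => hg j fun x hx =>
        h x (Set.mem_biUnion hj hx)
    · rw [Set.disjoint_iUnion₂_right]
      exact fun j hj => hA i j fun e => hi (e ▸ hj)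

end Independence

/-! ### Translation invariance -/

section Translation

set_option linter.unusedSectionVars false

variable {d n : ℕ} [NeZero n]

/-- Translation of configurations as a permutation. -/
def shiftEquiv (t : Torus d n) : Config (Torus d n) ≃ Config (Torus d n) :=
  Equiv.arrowCongr (Equiv.addRight t).symm (Equiv.refl Bool)

theorem shiftEquiv_apply (t : Torus d n) (η : Config (Torus d n)) (x : Torus d n) :
    shiftEquiv t η x = η (x + t) := rfl

theorem add_mem_neighbors {x y t : Torus d n} : y + t ∈ neighbors (x + t) ↔ y ∈ neighbors x := by
  rw [mem_neighbors, mem_neighbors]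
  simp only [ne_eq, add_left_inj, add_right_comm x t, add_sub_right_comm x t]

theorem sum_neighbors_add (F : Torus d n → ℝ) (x t : Torus d n) :
    ∑ y ∈ neighbors x, F (y + t) = ∑ y ∈ neighbors (x + t), F y := by
  refine Finset.sum_bij (fun y _ => y + t) (fun y hy => add_mem_neighbors.2 hy)
    (fun _ _ _ _ h => add_left_injective t h) (fun y hy => ⟨y - t, ?_, by simp⟩) fun _ _ => rfl
  rw [← add_mem_neighbors (t := t)]
  simpa using hy

theorem exchange_shift (t x y : Torus d n) (η : Config (Torus d n)) :
    exchange (shiftEquiv t η) x y = shiftEquiv t (exchange η (x + t) (y + t)) := by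
  funext z
  simp only [exchange, shiftEquiv_apply]
  congr 1
  simp only [Equiv.swap_apply_def, add_left_inj]
  split_ifs <;> rfl

theorem flipAt_shift (t x : Torus d n) (η : Config (Torus d n)) :
    flipAt (shiftEquiv t η) x = shiftEquiv t (flipAt η (x + t)) := by
  funext z
  by_cases h : z = x
  · subst h; simp [flipAt, shiftEquiv_apply]
  · simp [flipAt, shiftEquiv_apply, h]

theorem flipRate_shift (a b lam : ℝ) (t x : Torus d n) (η : Config (Torus d n)) :
    flipRate a b lam x (shiftEquiv t η) = flipRate a b lam (x + t) η := by
  unfold flipRate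
  rw [← sum_neighbors_add (occ η)]
  rfl

theorem generator_shift (a b lam : ℝ) (g : Config (Torus d n) → ℝ) (t : Torus d n)
    (η : Config (Torus d n)) :
    generator a b lam g (shiftEquiv t η)
      = generator a b lam (fun ζ => g (shiftEquiv t ζ)) η := by
  unfold generator
  simp only [exchange_shift, flipAt_shift, flipRate_shift]
  congr 1
  · congr 2
    have h : ∀ x, ∑ y ∈ neighbors x,
        (g (shiftEquiv t (exchange η (x + t) (y + t))) - g (shiftEquiv t η))
        = ∑ y ∈ neighbors (x + t), (g (shiftEquiv t (exchange η (x + t) y))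
          - g (shiftEquiv t η)) := fun x =>
      sum_neighbors_add (fun z => g (shiftEquiv t (exchange η (x + t) z)) - g (shiftEquiv t η)) x t
    simp only [h]
    exact Equiv.sum_comp (Equiv.addRight t) fun x => ∑ y ∈ neighbors x,
      (g (shiftEquiv t (exchange η x y)) - g (shiftEquiv t η))
  · exact Equiv.sum_comp (Equiv.addRight t) fun x =>
      flipRate a b lam x η * (g (shiftEquiv t (flipAt η x)) - g (shiftEquiv t η))

/-- The generator commutes with translations, so the translated minus the original weight is an
invariant signed weight of total mass zero, which uniqueness forces to vanish. -/
theorem ness_real_shift {a b lam : ℝ} (ha : 0 < a) (hb : 0 < b) (hlam : -a < lam)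
    (t : Torus d n) (η : Config (Torus d n)) :
    (ness ha hb hlam d n).real {(shiftEquiv t).symm η} = (ness ha hb hlam d n).real {η} := by
  have h := invariant_weight_unique ha hb hlam
    (fun η => (ness ha hb hlam d n).real {(shiftEquiv t).symm η}
      - (ness ha hb hlam d n).real {η})
    (by
      rw [Finset.sum_sub_distrib,
        Equiv.sum_comp (shiftEquiv t).symm fun η => (ness ha hb hlam d n).real {η}, sub_self])
    (fun g => by
      simp only [sub_mul, Finset.sum_sub_distrib]
      rw [ness_sum_generator, ← Equiv.sum_comp (shiftEquiv t)]
      simp only [Equiv.symm_apply_apply, generator_shift]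
      rw [ness_sum_generator, sub_zero])
  exact sub_eq_zero.1 (congrFun h η)

theorem ness_sum_shift {a b lam : ℝ} (ha : 0 < a) (hb : 0 < b) (hlam : -a < lam)
    (t : Torus d n) (g : Config (Torus d n) → ℝ) :
    ∑ η, (ness ha hb hlam d n).real {η} * g (shiftEquiv t η)
      = ∑ η, (ness ha hb hlam d n).real {η} * g η := by
  rw [← Equiv.sum_comp (shiftEquiv t) fun η => (ness ha hb hlam d n).real {η} * g η]
  refine Finset.sum_congr rfl fun η _ => ?_
  rw [← ness_real_shift ha hb hlam t (shiftEquiv t η), Equiv.symm_apply_apply]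

theorem bweight_shift (ρ : ℝ) (t : Torus d n) (η : Config (Torus d n)) :
    bweight ρ (shiftEquiv t η) = bweight ρ η :=
  Equiv.prod_comp (Equiv.addRight t) fun x => if η x then ρ else 1 - ρ

theorem bexp_shift (ρ : ℝ) (t : Torus d n) (g : Config (Torus d n) → ℝ) :
    bexp ρ (fun η => g (shiftEquiv t η)) = bexp ρ g := by
  unfold bexp
  rw [← Equiv.sum_comp (shiftEquiv t) fun η => bweight ρ η * g η]
  simp only [bweight_shift]

end Translation

/-! ### Local marginals -/

section Local

set_option linter.unusedSectionVars false

variable {d n : ℕ} [NeZero n]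

/-- The sites of the torus covered by the translate of the box `B_R` by `t`. -/
def boxSites (d n R : ℕ) (t : Torus d n) : Set (Torus d n) :=
  Set.range fun x : Box d R => (fun i => (x.1 i : ZMod n)) + t

theorem dependsOn_boxProj_shift {R : ℕ} (t : Torus d n) {β : Type*} (φ : Config (Box d R) → β) :
    DependsOn (fun η : Config (Torus d n) => φ (boxProj d n R (shiftEquiv t η)))
      (boxSites d n R t) := by
  intro η ζ h
  have : boxProj d n R (shiftEquiv t η) = boxProj d n R (shiftEquiv t ζ) := by
    funext x
    exact h _ ⟨x, rfl⟩
  simp only [this]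

/-- The centres of disjoint boxes. -/
def boxCentre (d n R : ℕ) (j : Fin d → Fin (n / (2 * R + 1))) : Torus d n :=
  fun i => (((2 * R + 1) * (j i : ℕ) : ℕ) : ZMod n)

theorem disjoint_boxSites {R : ℕ} {j j' : Fin d → Fin (n / (2 * R + 1))} (h : j ≠ j') :
    Disjoint (boxSites d n R (boxCentre d n R j)) (boxSites d n R (boxCentre d n R j')) := by
  rw [Set.disjoint_left]
  rintro _ ⟨x, rfl⟩ ⟨x', hx'⟩
  apply h
  funext i
  have hx := Finset.mem_Icc.1 (Fintype.mem_piFinset.1 x.2 i)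
  have hy := Finset.mem_Icc.1 (Fintype.mem_piFinset.1 x'.2 i)
  have hi := congrFun hx' i
  simp only [Pi.add_apply, boxCentre] at hi
  -- Adding R makes the box coordinates naturals at most 2R. Together with their centres they stay
  -- below n, so there is no wrap-around, and division by 2R + 1 recovers the index of the centre.
  obtain ⟨p, hp⟩ : ∃ p : ℕ, (p : ℤ) = x.1 i + R := ⟨(x.1 i + R).toNat, by omega⟩
  obtain ⟨q, hq⟩ : ∃ q : ℕ, (q : ℤ) = x'.1 i + R := ⟨(x'.1 i + R).toNat, by omega⟩
  have hlt : ∀ (p : ℕ) (k : Fin (n / (2 * R + 1))), p < 2 * R + 1 →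
      p + (2 * R + 1) * (k : ℕ) < n := by
    intro p k hp
    have h1 : (2 * R + 1) * ((k : ℕ) + 1) ≤ (2 * R + 1) * (n / (2 * R + 1)) :=
      Nat.mul_le_mul_left _ k.2
    have h2 := Nat.mul_div_le n (2 * R + 1)
    rw [mul_add] at h1
    omega
  have hcast : ((q + (2 * R + 1) * (j' i : ℕ) : ℕ) : ZMod n)
      = ((p + (2 * R + 1) * (j i : ℕ) : ℕ) : ZMod n) := by
    have hq' : (q : ZMod n) = (x'.1 i : ZMod n) + R := by
      have := congrArg (Int.cast : ℤ → ZMod n) hq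
      push_cast at this
      exact this
    have hp' : (p : ZMod n) = (x.1 i : ZMod n) + R := by
      have := congrArg (Int.cast : ℤ → ZMod n) hp
      push_cast at this
      exact this
    push_cast at hi ⊢
    rw [hq', hp']
    linear_combination hi
  have hval := congrArg ZMod.val hcast
  rw [ZMod.val_cast_of_lt (hlt q _ (by omega)), ZMod.val_cast_of_lt (hlt p _ (by omega))] at hval
  have hq2 : (q + (2 * R + 1) * (j' i : ℕ)) / (2 * R + 1) = j' i := by
    rw [Nat.add_mul_div_left _ _ (by omega), Nat.div_eq_of_lt (by omega), zero_add]
  have hp2 : (p + (2 * R + 1) * (j i : ℕ)) / (2 * R + 1) = j i := by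
    rw [Nat.add_mul_div_left _ _ (by omega), Nat.div_eq_of_lt (by omega), zero_add]
  rw [hval, hp2] at hq2
  exact Fin.ext hq2

/-- The deviation of a local event is controlled by the entropy per box. -/
theorem sq_sub_le_nessEntropy {a b lam : ℝ} (ha : 0 < a) (hb : 0 < b) (hlam : -a < lam)
    (h0 : 0 < (rhoStar ha hb lam : ℝ)) (h1 : (rhoStar ha hb lam : ℝ) < 1) (R : ℕ)
    (φ : Config (Box d R) → Bool) :
    2 * ((n / (2 * R + 1) : ℕ) : ℝ) ^ d *
        (∑ η, (ness ha hb hlam d n).real {η} * (if φ (boxProj d n R η) then 1 else 0)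
          - bexp (rhoStar ha hb lam : ℝ)
            (fun η : Config (Torus d n) => if φ (boxProj d n R η) then 1 else 0)) ^ 2
      ≤ nessEntropy ha hb hlam d n := by
  set ρ : ℝ := (rhoStar ha hb lam : ℝ) with hρ
  set N : ℝ := ((n / (2 * R + 1) : ℕ) : ℝ) ^ d with hN
  let ψ : Config (Torus d n) → ℝ := fun η => if φ (boxProj d n R η) then 1 else 0
  set p := ∑ η, (ness ha hb hlam d n).real {η} * (if φ (boxProj d n R η) then 1 else 0) with hp
  set q := bexp ρ (fun η : Config (Torus d n) => if φ (boxProj d n R η) then 1 else 0) with hq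
  have hq0 : 0 ≤ q := bexp_nonneg h0 h1 fun η => by split_ifs <;> norm_num
  have hq1 : q ≤ 1 := by
    have := bexp_mono h0 h1 (f := ψ) (g := fun _ => 1) fun η => by
      simp only [ψ]; split_ifs <;> norm_num
    rwa [bexp_const] at this
  -- This value maximises s(p − q) − s²/8, the gain per box against Hoeffding's cost; the maximum is
  -- 2(p − q)².
  set s := 4 * (p - q) with hs
  have hent := entropy_inequality h0 h1 (nessDensity_pos ha hb hlam d n h0 h1)
    (bexp_nessDensity_eq_one ha hb hlam d n h0 h1)
    fun η => ∑ j, s * (ψ (shiftEquiv (boxCentre d n R j) η) - q)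
  change _ ≤ nessEntropy ha hb hlam d n + _ at hent
  have hcard : ((Finset.univ : Finset (Fin d → Fin (n / (2 * R + 1)))).card : ℝ) = N := by
    simp [hN]
  have hleft : bexp ρ (fun η => (∑ j, s * (ψ (shiftEquiv (boxCentre d n R j) η) - q))
      * nessDensity ha hb hlam d n η) = N * (s * (p - q)) := by
    rw [bexp_nessDensity ha hb hlam d n h0 h1]
    simp only [Finset.mul_sum]
    rw [Finset.sum_comm]
    have : ∀ j : Fin d → Fin (n / (2 * R + 1)), ∑ η, (ness ha hb hlam d n).real {η} *
        (s * (ψ (shiftEquiv (boxCentre d n R j) η) - q)) = s * (p - q) := by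
      intro j
      rw [ness_sum_shift ha hb hlam (boxCentre d n R j) fun η => s * (ψ η - q)]
      have h2 := ness_sum_eq_one ha hb hlam d n
      calc ∑ η, (ness ha hb hlam d n).real {η} * (s * (ψ η - q))
          = s * (∑ η, (ness ha hb hlam d n).real {η} * ψ η
              - q * ∑ η, (ness ha hb hlam d n).real {η}) := by
            rw [Finset.mul_sum, ← Finset.sum_sub_distrib, Finset.mul_sum]
            exact Finset.sum_congr rfl fun η _ => by ring
        _ = s * (p - q) := by rw [h2, mul_one]
    simp only [this, Finset.sum_const, nsmul_eq_mul, hcard]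
  -- The translated boxes are disjoint, so the exponential moment factorises under ν and each factor
  -- is a two-point Hoeffding bound.
  have hexp : bexp ρ (fun η : Config (Torus d n) =>
      Real.exp (∑ j, s * (ψ (shiftEquiv (boxCentre d n R j) η) - q)))
      ≤ Real.exp (N * (s ^ 2 / 8)) := by
    simp only [Real.exp_sum]
    rw [bexp_prod_of_dependsOn ρ Finset.univ
      (fun j η => Real.exp (s * (ψ (shiftEquiv (boxCentre d n R j) η) - q)))
      (fun j => boxSites d n R (boxCentre d n R j))
      (fun j => dependsOn_boxProj_shift _ fun ω => Real.exp (s * ((if φ ω then 1 else 0) - q)))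
      fun i j hij => disjoint_boxSites hij]
    have h2 : ∀ j : Fin d → Fin (n / (2 * R + 1)), bexp ρ (fun η : Config (Torus d n) =>
        Real.exp (s * (ψ (shiftEquiv (boxCentre d n R j) η) - q))) ≤ Real.exp (s ^ 2 / 8) := by
      intro j
      rw [bexp_shift ρ (boxCentre d n R j) fun η => Real.exp (s * (ψ η - q))]
      refine le_trans (le_of_eq ?_) (hoeffding_two_point hq0 hq1 s)
      have h3 : ∀ η, Real.exp (s * (ψ η - q)) = ψ η * Real.exp (s * (1 - q))
          + (1 - ψ η) * Real.exp (s * (0 - q)) := by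
        intro η
        simp only [ψ]
        split_ifs <;> simp
      simp only [h3, sub_mul, one_mul, mul_comm (ψ _)]
      rw [bexp_add, bexp_sub, bexp_const_mul, bexp_const_mul, bexp_const]
      ring
    refine (Finset.prod_le_prod (fun j _ => bexp_nonneg h0 h1 fun η => (Real.exp_pos _).le)
      fun j _ => h2 j).trans (le_of_eq ?_)
    rw [Finset.prod_const, ← Real.exp_nat_mul, hcard]
  have hpos : 0 < bexp ρ (fun η : Config (Torus d n) =>
      Real.exp (∑ j, s * (ψ (shiftEquiv (boxCentre d n R j) η) - q))) :=
    Finset.sum_pos (fun η _ => mul_pos (bweight_pos h0 h1 η) (Real.exp_pos _))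
      Finset.univ_nonempty
  have hlog := Real.log_le_log hpos hexp
  rw [Real.log_exp] at hlog
  rw [hleft] at hent
  have : N * (s * (p - q)) - N * (s ^ 2 / 8) = 2 * N * (p - q) ^ 2 := by
    rw [hs]; ring
  linarith

end Local

/-! ### Total variation -/

/-- Since the differences sum to zero, their positive part carries half of the absolute sum. The
distance thus becomes the difference of the probabilities of one event, the form required by the
entropy bound. -/
theorem tvDist_eq {Ω : Type} [Fintype Ω] [MeasurableSpace Ω] [MeasurableSingletonClass Ω]
    (μ ν : Measure Ω) [IsProbabilityMeasure μ] [IsProbabilityMeasure ν] :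
    tvDist μ ν = ∑ ω, (μ.real {ω} - ν.real {ω})
      * (if decide (ν.real {ω} ≤ μ.real {ω}) then 1 else 0) := by
  have hμ : ∑ ω, μ.real {ω} = 1 := by simp
  have hν : ∑ ω, ν.real {ω} = 1 := by simp
  have h : ∀ ω, |μ.real {ω} - ν.real {ω}| = 2 * ((μ.real {ω} - ν.real {ω})
      * (if decide (ν.real {ω} ≤ μ.real {ω}) then 1 else 0)) - (μ.real {ω} - ν.real {ω}) := by
    intro ω
    by_cases hle : ν.real {ω} ≤ μ.real {ω}
    · rw [abs_of_nonneg (by linarith)]; simp [hle]; ring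
    · rw [abs_of_nonpos (by linarith)]; simp [hle]
  unfold tvDist
  simp only [h]
  rw [Finset.sum_sub_distrib, Finset.sum_sub_distrib, hμ, hν, ← Finset.mul_sum]
  ring

theorem map_real_sum {α β : Type} [Fintype α] [Fintype β] [MeasurableSpace α]
    [MeasurableSpace β] [MeasurableSingletonClass α] [MeasurableSingletonClass β]
    (μ : Measure α) [IsFiniteMeasure μ] (π : α → β) (g : β → ℝ) :
    ∑ ω, (μ.map π).real {ω} * g ω = ∑ η, μ.real {η} * g (π η) := by
  have hπ : Measurable π := Measurable.of_discrete
  have h1 : ∫ ω, g ω ∂(μ.map π) = ∫ η, g (π η) ∂μ :=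
    integral_map hπ.aemeasurable (Measurable.of_discrete (f := g)).aestronglyMeasurable
  rw [integral_fintype Integrable.of_finite, integral_fintype Integrable.of_finite] at h1
  simpa using h1

theorem bernoulliProduct_real (d n : ℕ) [NeZero n] (ρ : unitInterval) (η : Config (Torus d n)) :
    (bernoulliProduct d n ρ).real {η} = bweight (ρ : ℝ) η := by
  unfold bernoulliProduct bweight
  rw [measureReal_def, Measure.pi_singleton, ENNReal.toReal_prod]
  refine Finset.prod_congr rfl fun x _ => ?_
  rw [← measureReal_def, ProbabilityTheory.bernoulliMeasure_real_apply]
  · cases h : η x <;> simp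
  · exact measurableSet_singleton _

instance bernoulliProduct_isProbabilityMeasure (d n : ℕ) [NeZero n] (ρ : unitInterval) :
    IsProbabilityMeasure (bernoulliProduct d n ρ) := by
  unfold bernoulliProduct; infer_instance

theorem sq_tvDist_le_nessEntropy {d n : ℕ} [NeZero n] {a b lam : ℝ} (ha : 0 < a) (hb : 0 < b)
    (hlam : -a < lam) (h0 : 0 < (rhoStar ha hb lam : ℝ)) (h1 : (rhoStar ha hb lam : ℝ) < 1)
    (R : ℕ) :
    2 * ((n / (2 * R + 1) : ℕ) : ℝ) ^ d *
      tvDist ((ness ha hb hlam d n).map (boxProj d n R))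
        ((bernoulliProduct d n (rhoStar ha hb lam)).map (boxProj d n R)) ^ 2
      ≤ nessEntropy ha hb hlam d n := by
  have := (ness_isInvariant ha hb hlam d n).1
  have hm : Measurable (boxProj d n R) := Measurable.of_discrete
  have := Measure.isProbabilityMeasure_map (μ := ness ha hb hlam d n) hm.aemeasurable
  have := Measure.isProbabilityMeasure_map
    (μ := bernoulliProduct d n (rhoStar ha hb lam)) hm.aemeasurable
  rw [tvDist_eq]
  simp only [sub_mul, Finset.sum_sub_distrib]
  rw [map_real_sum _ _ fun ω : Config (Box d R) => if decide
      (((bernoulliProduct d n (rhoStar ha hb lam)).map (boxProj d n R)).real {ω}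
        ≤ ((ness ha hb hlam d n).map (boxProj d n R)).real {ω}) then (1 : ℝ) else 0,
    map_real_sum _ _ fun ω : Config (Box d R) => if decide
      (((bernoulliProduct d n (rhoStar ha hb lam)).map (boxProj d n R)).real {ω}
        ≤ ((ness ha hb hlam d n).map (boxProj d n R)).real {ω}) then (1 : ℝ) else 0]
  simp only [bernoulliProduct_real]
  exact sq_sub_le_nessEntropy ha hb hlam h0 h1 R fun ω => decide
      (((bernoulliProduct d n (rhoStar ha hb lam)).map (boxProj d n R)).real {ω}
        ≤ ((ness ha hb hlam d n).map (boxProj d n R)).real {ω})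

/-! ### Local equilibrium -/

theorem tendsto_pnat_cast_atTop : Tendsto (fun n : ℕ+ => ((n : ℕ) : ℝ)) atTop atTop := by
  refine tendsto_natCast_atTop_atTop.comp
    (tendsto_atTop_atTop.2 fun k => ⟨k.succPNat, fun n hn => ?_⟩)
  have : (k.succPNat : ℕ) ≤ n := hn
  simp only [Nat.succPNat_coe] at this
  omega

theorem tvDist_nonneg {Ω : Type} [Fintype Ω] [MeasurableSpace Ω] (μ ν : Measure Ω) :
    0 ≤ tvDist μ ν :=
  mul_nonneg (by norm_num) (Finset.sum_nonneg fun _ _ => abs_nonneg _)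

theorem scale_pow {d : ℕ} (hd : 1 ≤ d) {R g n : ℝ} (hg : 0 ≤ g) (hn : 0 ≤ n) :
    (R * g ^ (1 / d : ℝ) / n ^ (2 / d : ℝ)) ^ d = R ^ d * (g / n ^ 2) := by
  have hd' : (d : ℝ) ≠ 0 := Nat.cast_ne_zero.2 (by omega)
  rw [div_pow, mul_pow, ← Real.rpow_natCast (g ^ _), ← Real.rpow_natCast (n ^ _),
    ← Real.rpow_mul hg, ← Real.rpow_mul hn, div_mul_cancel₀ _ hd', div_mul_cancel₀ _ hd',
    Real.rpow_one, Real.rpow_two, mul_div_assoc]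

/-- After taking d-th powers this is n² ≤ g_d(n) n^d, an equality for d = 1. It makes the box small
relative to the torus as soon as the scale is small. -/
theorem div_le_scale {d n : ℕ} (hd : 1 ≤ d) (hn : 3 ≤ n) (R : ℕ) :
    (R : ℝ) / n ≤ R * green d n ^ (1 / d : ℝ) / (n : ℝ) ^ (2 / d : ℝ) := by
  have hn0 : (1 : ℝ) ≤ n := by exact_mod_cast (by omega : 1 ≤ n)
  have hg := one_le_green (d := d) hn
  refine le_of_pow_le_pow_left₀ (by omega : d ≠ 0) (by positivity) ?_
  rw [scale_pow hd (by linarith) (by linarith), div_pow, div_eq_mul_one_div]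
  refine mul_le_mul_of_nonneg_left ?_ (by positivity)
  rw [div_le_div_iff₀ (by positivity) (by positivity), one_mul]
  obtain rfl | h2 : d = 1 ∨ 2 ≤ d := by omega
  · simp only [green, if_true]
    exact le_of_eq (by ring)
  · have h3 : (n : ℝ) ^ 2 ≤ (n : ℝ) ^ d := pow_le_pow_right₀ hn0 h2
    have h4 : 0 ≤ (n : ℝ) ^ d := by positivity
    nlinarith

theorem sq_tvDist_le {d : ℕ} (hd : 1 ≤ d) {a b : ℝ} (ha : 0 < a) (hb : 0 < b) :
    ∃ lamc : ℝ, 0 < lamc ∧ ∃ C : ℝ, 0 < C ∧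
      ∀ (lam : ℝ) (hlam : -a < lam), |lam| ≤ lamc → ∀ (n : ℕ) [NeZero n], C ≤ n → 3 ≤ n →
        ∀ R : ℕ, 2 * R + 1 ≤ n →
          tvDist ((ness ha hb hlam d n).map (boxProj d n R))
            ((bernoulliProduct d n (rhoStar ha hb lam)).map (boxProj d n R)) ^ 2
            ≤ C * ((R : ℝ) ^ d * (green d n / (n : ℝ) ^ 2) + green d n / (n : ℝ) ^ 2) := by
  obtain ⟨lamc, hlp, hla, hmain⟩ := nessEntropy_le hd ha hb
  have hm : 0 < min (a / 2) b := lt_min (by positivity) hb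
  set m := min (a / 2) b
  set K : ℝ := 16 * d * 2 ^ d with hK
  have hd' : (1 : ℝ) ≤ d := by exact_mod_cast hd
  have hKp : 0 < K := by positivity
  -- The first entry serves as a threshold: n ≥ 2K gives G_00 ≤ K g_d(n)/n² ≤ K/n ≤ 1/2. The second
  -- is the constant of the estimate.
  refine ⟨lamc, hlp, max (2 * K) (28 / m * (K + 1) * 8 ^ d), lt_max_of_lt_left (by positivity), ?_⟩
  intro lam hlam hl n _ hCn hn R hR
  obtain ⟨hρ, hρ1⟩ := rhoStar_bounds ha hb (hl.trans hla)
  have hρ0 : 0 < (rhoStar ha hb lam : ℝ) := lt_of_lt_of_le (by positivity) hρ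
  have hn0 : (0 : ℝ) < n := Nat.cast_pos.2 (by omega)
  have hg1 := one_le_green (d := d) hn
  have hgn := green_le (d := d) (n := n) (by omega)
  have hG := resolventKernel_zero_le_green (n := n) hd hn
  have h2K : 2 * K ≤ n := (le_max_left _ _).trans hCn
  have hG2 : resolventKernel (0 : Torus d n) ≤ 1 / 2 := by
    refine hG.trans ?_
    rw [← hK, ← mul_div_assoc, div_le_iff₀ (by positivity)]
    nlinarith
  have hH := hmain lam hlam hl n hn hG2
  have htv := sq_tvDist_le_nessEntropy (d := d) (n := n) ha hb hlam hρ0 hρ1 R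
  set tv := tvDist ((ness ha hb hlam d n).map (boxProj d n R))
    ((bernoulliProduct d n (rhoStar ha hb lam)).map (boxProj d n R))
  set γ := green d n / (n : ℝ) ^ 2 with hγ
  have hγ0 : 0 < γ := by positivity
  have hn2 : 1 / (n : ℝ) ^ 2 ≤ γ := div_le_div_of_nonneg_right hg1 (by positivity)
  have hH2 : nessEntropy ha hb hlam d n ≤ 28 / m * (K + 1) * γ * (n : ℝ) ^ d := by
    refine hH.trans ?_
    have : (n : ℝ) ^ d * (resolventKernel (0 : Torus d n) + 1 / (n : ℝ) ^ 2)
        ≤ (n : ℝ) ^ d * (K * γ + γ) :=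
      mul_le_mul_of_nonneg_left (by linarith) (by positivity)
    refine (mul_le_mul_of_nonneg_left this (by positivity)).trans (le_of_eq ?_)
    ring
  set k := n / (2 * R + 1) with hk
  have hk1 : 1 ≤ k := (Nat.one_le_div_iff (by omega)).2 hR
  -- At least one box fits along each axis, so rounding down loses at most a factor 2.
  have hnk : (n : ℝ) ≤ 2 * (2 * R + 1) * k := by
    have h1 : n < (2 * R + 1) * (k + 1) := by
      rw [mul_comm]; exact Nat.lt_mul_of_div_lt (by omega) (by omega)
    have h2 : (2 * R + 1) * 1 ≤ (2 * R + 1) * k := Nat.mul_le_mul_left _ hk1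
    have h3 : n ≤ 2 * (2 * R + 1) * k := by
      rw [mul_add] at h1
      rw [mul_assoc]
      omega
    exact_mod_cast h3
  have hnkd : (n : ℝ) ^ d ≤ (2 * (2 * R + 1)) ^ d * (k : ℝ) ^ d := by
    rw [← mul_pow]
    exact pow_le_pow_left₀ hn0.le hnk d
  -- The added 1 covers R = 0; for R ≥ 1 one has 2(2R + 1) ≤ 8R.
  have hbox : (2 * (2 * (R : ℝ) + 1)) ^ d ≤ 8 ^ d * ((R : ℝ) ^ d + 1) := by
    rcases Nat.eq_zero_or_pos R with rfl | hRp
    · have h1 : (2 * (2 * ((0 : ℕ) : ℝ) + 1)) ^ d ≤ 8 ^ d := by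
        apply pow_le_pow_left₀ <;> norm_num
      refine h1.trans ?_
      have : (0 : ℝ) ≤ ((0 : ℕ) : ℝ) ^ d := by positivity
      nlinarith [pow_pos (by norm_num : (0 : ℝ) < 8) d]
    · have hR1 : (1 : ℝ) ≤ R := by exact_mod_cast hRp
      have h1 : (2 * (2 * (R : ℝ) + 1)) ^ d ≤ (8 * R) ^ d :=
        pow_le_pow_left₀ (by positivity) (by linarith) d
      rw [mul_pow (8 : ℝ)] at h1
      nlinarith [pow_pos (by norm_num : (0 : ℝ) < 8) d]
  have hkd : (0 : ℝ) < (k : ℝ) ^ d := pow_pos (Nat.cast_pos.2 (by omega)) d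
  have hA : 0 ≤ 28 / m * (K + 1) * γ := by positivity
  have h5 : 2 * (k : ℝ) ^ d * tv ^ 2
      ≤ 28 / m * (K + 1) * γ * (8 ^ d * ((R : ℝ) ^ d + 1)) * (k : ℝ) ^ d := by
    refine htv.trans (hH2.trans ?_)
    rw [mul_assoc (28 / m * (K + 1) * γ)]
    exact mul_le_mul_of_nonneg_left
      (hnkd.trans (mul_le_mul_of_nonneg_right hbox hkd.le)) hA
  have h6 : tv ^ 2 ≤ 28 / m * (K + 1) * γ * (8 ^ d * ((R : ℝ) ^ d + 1)) := by
    refine le_of_mul_le_mul_right ?_ hkd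
    have : 0 ≤ (k : ℝ) ^ d * tv ^ 2 := by positivity
    linarith
  have h7 : 28 / m * (K + 1) * γ * (8 ^ d * ((R : ℝ) ^ d + 1))
      = 28 / m * (K + 1) * 8 ^ d * ((R : ℝ) ^ d * γ + γ) := by ring
  rw [h7] at h6
  exact h6.trans (mul_le_mul_of_nonneg_right (le_max_right _ _) (by positivity))

end ReactionDiffusion

open ReactionDiffusion
theorem theorem2p4 (d : ℕ) (hd : 1 ≤ d) {a b : ℝ} (ha : 0 < a) (hb : 0 < b) :
    ∃ lamc : ℝ, 0 < lamc ∧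
      ∀ (lam : ℝ) (hlam : -a < lam), lam ∈ Set.Icc (-lamc) lamc →
        ∀ R : ℕ+ → ℕ,
          Tendsto (fun n : ℕ+ =>
            (R n : ℝ) * green d n ^ (1 / d : ℝ) / (n : ℝ) ^ (2 / d : ℝ)) atTop (𝓝 0) →
          Tendsto (fun n : ℕ+ =>
            tvDist ((ness ha hb hlam d n).map (boxProj d n (R n)))
              ((bernoulliProduct d n (rhoStar ha hb lam)).map (boxProj d n (R n))))
            atTop (𝓝 0) := by
  obtain ⟨lamc, hlp, C, hC, hmain⟩ := sq_tvDist_le hd ha hb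
  refine ⟨lamc, hlp, fun lam hlam hl R hR => ?_⟩
  have hpow := hR.pow d
  rw [zero_pow (by omega : d ≠ 0)] at hpow
  have hinv : Tendsto (fun n : ℕ+ => ((n : ℕ) : ℝ)⁻¹) atTop (𝓝 0) :=
    tendsto_inv_atTop_zero.comp tendsto_pnat_cast_atTop
  have hn3 : ∀ᶠ n : ℕ+ in atTop, 3 ≤ (n : ℕ) := eventually_ge_atTop (3 : ℕ+)
  have hnC : ∀ᶠ n : ℕ+ in atTop, C ≤ ((n : ℕ) : ℝ) :=
    tendsto_pnat_cast_atTop.eventually_ge_atTop C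
  -- The threshold 1/3 yields 3R ≤ n, and with n ≥ 3 this gives 2R + 1 ≤ n, including when R = 0.
  have hsmall : ∀ᶠ n : ℕ+ in atTop,
      (R n : ℝ) * green d n ^ (1 / d : ℝ) / (n : ℝ) ^ (2 / d : ℝ) < 1 / 3 :=
    hR.eventually_lt_const (by norm_num)
  -- The d-th power of the scale is R^d g_d(n)/n², and the inverse of n dominates the remaining
  -- g_d(n)/n².
  have hlim : Tendsto (fun n : ℕ+ => √(C * (((R n : ℝ) * green d n ^ (1 / d : ℝ)
      / (n : ℝ) ^ (2 / d : ℝ)) ^ d + ((n : ℕ) : ℝ)⁻¹))) atTop (𝓝 0) := by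
    have := ((hpow.add hinv).const_mul C).sqrt
    simpa using this
  refine tendsto_of_tendsto_of_tendsto_of_le_of_le' tendsto_const_nhds hlim
    (Eventually.of_forall fun n => tvDist_nonneg _ _) ?_
  filter_upwards [hn3, hnC, hsmall] with n h3 hCn hs
  have hn0 : (0 : ℝ) < (n : ℕ) := Nat.cast_pos.2 n.pos
  have hg := one_le_green (d := d) h3
  have hgn := green_le (d := d) (n := n) n.pos
  have hRn : 2 * R n + 1 ≤ (n : ℕ) := by
    have h := (div_le_scale hd h3 (R n)).trans hs.le
    rw [div_le_iff₀ hn0] at h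
    have h' : 3 * (R n : ℝ) ≤ ((n : ℕ) : ℝ) := by linarith
    have h'' : 3 * R n ≤ (n : ℕ) := by exact_mod_cast h'
    omega
  apply Real.le_sqrt_of_sq_le
  refine (hmain lam hlam (abs_le.2 hl) n hCn h3 (R n) hRn).trans ?_
  rw [scale_pow hd (by linarith) hn0.le]
  refine mul_le_mul_of_nonneg_left (add_le_add le_rfl ?_) hC.le
  rw [div_le_iff₀ (by positivity), sq, ← mul_assoc, inv_mul_cancel₀ hn0.ne', one_mul]
  exact hgn
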